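/- **Setting.** Let $D=(a_1,b_1)\times(a_2,b_2)\times(a_3,b_3)\subset\mathbb R^3$ be a bounded nonempty open cuboid and $\mathbb H=L^2(D)^3\times L^2(D)^3$. Let $M(\mathbf E,\mathbf H)=(\nabla\times\mathbf H,-\nabla\times\mathbf E)$ be the Maxwell operator on $\mathbb H$ with domain $\mathcal D(M)=H_0(\mathrm{curl},D)\times H(\mathrm{curl},D)$, and let $J(\mathbf E,\mathbf H)=(-\mathbf H,\mathbf E)$. Let $\sigma\in W^{1,\infty}(D)$ with $\sigma\ge\sigma_0$ a.e. for a constant $\sigma_0>0$; let $\lambda_1\in\mathbb R$, $\boldsymbol\lambda_2\in\mathbb R^3$ and $\widetilde{\boldsymbol\lambda}_2=(\boldsymbol\lambda_2,\boldsymbol\lambda_2)\in\mathbb R^6$. Let $\{q_k\}_{k\ge1}$ be an orthonormal basis of $L^2(D)$, and for $i=1,2$ let $Q_i$ be a bounded operator on $L^2(D)$ with $Q_iq_k=\eta^{(i)}_kq_k$, $\eta_k^{(i)}\ge0$. Assume that, for some $\gamma>\frac32$ and $\gamma_2\ge2$, $Q_1^{1/2}$ is a Hilbert–Schmidt operator from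 $L^2(D)$ to $H^{2+\gamma}(D)$, $Q_2^{1/2}$ is a Hilbert–Schmidt operator from $L^2(D)$ to $H^{\gamma_2}(D)$, and $\sum_{k}\|Q_1^{1/2}q_k\|_{H^{1+\gamma}(D)}<\infty$. Let $W_i(t)=\sum_k\sqrt{\eta_k^{(i)}}\,q_k\beta_k^{(i)}(t)$, where $\{\beta^{(i)}_k\}_{k\ge1,\,i=1,2}$ are independent standard Brownian motions on a filtered probability space $(\Omega,\mathcal F,\{\mathcal F_t\}_{t\ge0},\mathbb P)$ (so their joint increments over $[s,t]$ are independent of $\mathcal F_s$). For a step size $\Delta t>0$ put $t_n=n\Delta t$, $\Delta W_2^n=W_2(t_{n+1})-W_2(t_n)$, $\xi_k^n=(\beta^{(1)}_k(t_{n+1})-\beta^{(1)}_k(t_n))/\sqrt{\Delta t}$, $A_{\Delta t}=\sqrt{2c|\ln\Delta t|}$ with a constant $c\ge4$, let $\zeta_k^n=\max(-A_{\Delta t},\min(A_{\Delta t},\xi_k^n))$, and let $\Delta\overline W_1^n=\sqrt{\Delta t}\sum_k\zeta^n_kQ_1^{1/2}q_k$. The temporal semi-discretization is, for $n\in\mathbb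 N$, $$u^{n+1}-e^{-\sigma\Delta t}u^n=\Delta t\,M\frac{u^{n+1}+e^{-\sigma\Delta t}u^n}{2}+\lambda_1J\frac{u^{n+1}+e^{-\sigma\Delta t}u^n}{2}\Delta\overline W_1^n+\widetilde{\boldsymbol\lambda}_2\Delta W_2^n ,\tag{1}$$ for $\{\mathcal F_{t_n}\}$-adapted $\mathbb H$-valued $u^n$, where the midpoint $\frac12(u^{n+1}+e^{-\sigma\Delta t}u^n)$ is required to lie in $\mathcal D(M)$ almost surely. Let $\mathcal P_2(\mathbb H)$ be the set of Borel probability measures on $\mathbb H$ with finite second moment, and let $\mathcal W_2$ be the $L^2$-Wasserstein distance, $\mathcal W_2(\mu,\nu)=\inf_\gamma\big(\int\|x-y\|_{\mathbb H}^2\,\gamma(dx,dy)\big)^{1/2}$ over all couplings $\gamma$ of $\mu$ and $\nu$. **Theorem.** There is $\delta>0$ such that for every $\Delta t\in(0,\delta)$ the scheme (1) has, for every $\mathcal F_0$-measurable initial value, an adapted solution, and the solutions have a Markov transition semigroup $\{P_n\}_{n\in\mathbb N}$ on $\mathbb H$ ($P_n\varphi(x)=\mathbb E[\varphi(u^n)]$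 when $u^0=x$, and $P_n^*\pi$ is the law of $u^n$ when $u^0$ has law $\pi$), for which the following hold. (i) There is a unique invariant measure $\pi^{\Delta t}$ among all Borel probability measures on $\mathbb H$ (that is, $\int P_n\varphi\,d\pi^{\Delta t}=\int\varphi\,d\pi^{\Delta t}$ for all bounded Borel $\varphi$ and all $n$), and $\pi^{\Delta t}\in\mathcal P_2(\mathbb H)$. The scheme is ergodic: for every $\varphi\in L^2(\mathbb H,\pi^{\Delta t})$, $\frac1N\sum_{n=0}^{N-1}P_n\varphi\to\int\varphi\,d\pi^{\Delta t}$ in $L^2(\mathbb H,\pi^{\Delta t})$ as $N\to\infty$. It is exponentially mixing: there are $\rho>0$ and a function $C:\mathbb H\to(0,\infty)$ such that for every bounded Lipschitz $\varphi:\mathbb H\to\mathbb R$ with Lipschitz constant $L_\varphi$, every $x\in\mathbb H$ and every $n\in\mathbb N$, $|P_n\varphi(x)-\int\varphi\,d\pi^{\Delta t}|\le C(x)L_\varphi e^{-\rho t_n}$. (ii) For every $\pi\in\mathcal P_2(\mathbb H)$ and every $n\in\mathbb N$, $\mathcal W_2(P_n^*\pi,\pi^{\Delta t})\le e^{-\sigma_0t_n}\,\mathcal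 W_2(\pi,\pi^{\Delta t})$. -/

import Mathlib

open MeasureTheory ProbabilityTheory Filter Topology
open scoped NNReal ENNReal

noncomputable section

namespace StochMaxwell

/-! ### The cuboid, weak derivatives and Sobolev spaces -/

/-- Euclidean three-space. -/
abbrev R3 : Type := EuclideanSpace ℝ (Fin 3)

/-- Euclidean six-space, as pairs of an electric and a magnetic vector. -/
abbrev R6 : Type := WithLp 2 (R3 × R3)

/-- The open cuboid `(a₀,b₀) × (a₁,b₁) × (a₂,b₂)`. -/
def cuboid (a b : Fin 3 → ℝ) : Set R3 := {x | ∀ i, x i ∈ Set.Ioo (a i) (b i)}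

/-- Lebesgue measure on the cuboid. -/
abbrev vol (a b : Fin 3 → ℝ) : Measure R3 := volume.restrict (cuboid a b)

/-- The Hilbert space `L²(D)`. -/
abbrev ScalarL2 (a b : Fin 3 → ℝ) : Type := Lp ℝ 2 (vol a b)

/-- The Hilbert space `ℍ = L²(D)³ × L²(D)³ = L²(D)⁶` of electromagnetic fields `u = (E, H)`. -/
abbrev EMField (a b : Fin 3 → ℝ) : Type := Lp R6 2 (vol a b)

instance instMeasurableSpaceEMField (a b : Fin 3 → ℝ) : MeasurableSpace (EMField a b) :=
  borel (EMField a b)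

instance instBorelSpaceEMField (a b : Fin 3 → ℝ) : BorelSpace (EMField a b) := ⟨rfl⟩

/-- `φ ∈ C_c^∞(D; F)`. -/
def IsTestFunction (a b : Fin 3 → ℝ) {F : Type*} [NormedAddCommGroup F] [NormedSpace ℝ F]
    (φ : R3 → F) : Prop :=
  ContDiff ℝ (⊤ : ℕ∞) φ ∧ HasCompactSupport φ ∧ tsupport φ ⊆ cuboid a b

/-- The classical partial derivative `∂ᵢ φ` of a scalar function. -/
def partialDeriv (i : Fin 3) (φ : R3 → ℝ) : R3 → ℝ :=
  fun x => fderiv ℝ φ x (EuclideanSpace.single i 1)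

/-- The classical partial derivative `∂^α φ` for a multi-index `α`. -/
def multiDeriv (α : Fin 3 → ℕ) (φ : R3 → ℝ) : R3 → ℝ :=
  (partialDeriv 0)^[α 0] ((partialDeriv 1)^[α 1] ((partialDeriv 2)^[α 2] φ))

/-- `g` is the weak derivative `∂^α f` in the cuboid. -/
def IsWeakDeriv (a b : Fin 3 → ℝ) (α : Fin 3 → ℕ) (f g : R3 → ℝ) : Prop :=
  ∀ φ : R3 → ℝ, IsTestFunction a b φ →
    ∫ x, f x * multiDeriv α φ x ∂(vol a b) = (-1) ^ (∑ i, α i) * ∫ x, g x * φ x ∂(vol a b)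

/-- `f ∈ W^{1,∞}(D)`. -/
def MemW1Infty (a b : Fin 3 → ℝ) (f : R3 → ℝ) : Prop :=
  MemLp f ∞ (vol a b) ∧
    ∀ i, ∃ g : R3 → ℝ, MemLp g ∞ (vol a b) ∧ IsWeakDeriv a b (Pi.single i 1) f g

/-- The multi-indices of length at most `k`. -/
def multiIndices (k : ℕ) : Finset (Fin 3 → ℕ) :=
  (Fintype.piFinset fun _ : Fin 3 => Finset.range (k + 1)).filter fun α => ∑ i, α i ≤ k

/-- The squared Sobolev–Slobodeckij seminorm of order `θ ∈ (0,1)`; it is set to `0` for `θ = 0`,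
where no fractional part occurs. -/
def gagliardoSq (a b : Fin 3 → ℝ) (θ : ℝ) (g : R3 → ℝ) : ℝ≥0∞ :=
  if θ = 0 then 0 else
    ∫⁻ x, ∫⁻ y, ENNReal.ofReal ((g x - g y) ^ 2 / ‖x - y‖ ^ (3 + 2 * θ)) ∂(vol a b) ∂(vol a b)

/-- The norm of `f` in `H^s(D) = W^{s,2}(D)`, `s ≥ 0` real (Sobolev–Slobodeckij norm when `s` is
not an integer), with value `∞` when `f ∉ H^s(D)`. The infimum runs over all families of weak
derivatives of `f` up to order `⌊s⌋`: there is at most one, and an empty infimum is `∞`. -/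
def sobolevENorm (a b : Fin 3 → ℝ) (s : ℝ) (f : ScalarL2 a b) : ℝ≥0∞ :=
  (⨅ (g : (Fin 3 → ℕ) → ScalarL2 a b)
     (_ : ∀ α ∈ multiIndices ⌊s⌋₊, IsWeakDeriv a b α f (g α)),
    ∑ α ∈ multiIndices ⌊s⌋₊,
      (‖g α‖ₑ ^ 2 +
        if ∑ i, α i = ⌊s⌋₊ then gagliardoSq a b (s - ⌊s⌋₊) (g α) else 0)) ^ (1 / 2 : ℝ)

/-- `T ∈ HS(L²(D), H^s(D))`: the Hilbert–Schmidt norm, computed in the orthonormal basis `q`, is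
finite. -/
def IsHilbertSchmidtInto (a b : Fin 3 → ℝ) (q : HilbertBasis ℕ ℝ (ScalarL2 a b)) (s : ℝ)
    (T : ScalarL2 a b →L[ℝ] ScalarL2 a b) : Prop :=
  (∑' k, sobolevENorm a b s (T (q k)) ^ 2) ≠ ∞

/-! ### The Maxwell operator -/

/-- The classical curl of a vector field. -/
def curl (φ : R3 → R3) : R3 → R3 := fun x =>
  !₂[partialDeriv 1 (fun y => φ y 2) x - partialDeriv 2 (fun y => φ y 1) x,
     partialDeriv 2 (fun y => φ y 0) x - partialDeriv 0 (fun y => φ y 2) x,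
     partialDeriv 0 (fun y => φ y 1) x - partialDeriv 1 (fun y => φ y 0) x]

/-- For `F, G ∈ L²(D)³`: `F ∈ H(curl, D)` and `∇ × F = G`. -/
def HasWeakCurl (a b : Fin 3 → ℝ) (F G : R3 → R3) : Prop :=
  ∀ φ : R3 → R3, IsTestFunction a b φ →
    ∫ x, inner ℝ (F x) (curl φ x) ∂(vol a b) = ∫ x, inner ℝ (G x) (φ x) ∂(vol a b)

/-- For `F, G ∈ L²(D)³`: `F ∈ H₀(curl, D)` and `∇ × F = G`, where `H₀(curl, D)` is the closure of
`C_c^∞(D)³` in the graph norm of the curl (fields in `H(curl, D)` with `n × F = 0` on `∂D`). -/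
def HasWeakCurlZero (a b : Fin 3 → ℝ) (F G : R3 → R3) : Prop :=
  ∀ ε : ℝ, 0 < ε → ∃ φ : R3 → R3, IsTestFunction a b φ ∧
    eLpNorm (fun x => F x - φ x) 2 (vol a b) ≤ ENNReal.ofReal ε ∧
    eLpNorm (fun x => G x - curl φ x) 2 (vol a b) ≤ ENNReal.ofReal ε

/-- `u = (E, H) ∈ 𝒟(M) = H₀(curl, D) × H(curl, D)` and `M u = f`, for the Maxwell operator
`M (E, H) = (∇ × H, -∇ × E)`. -/
def MaxwellEq (a b : Fin 3 → ℝ) (u f : EMField a b) : Prop :=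
  HasWeakCurlZero a b (fun x => (u x).fst) (fun x => -(f x).snd) ∧
  HasWeakCurl a b (fun x => (u x).snd) (fun x => (f x).fst)

/-- The matrix `J = (0, -I₃; I₃, 0)`. -/
def Jmap (v : R6) : R6 := WithLp.toLp 2 (-v.snd, v.fst)

/-! ### The noise -/

/-- `Q` is diagonal in the basis `q` with eigenvalues `η k ≥ 0`, and `Qh = Q^{1/2}` is its
nonnegative square root. -/
structure IsCovarianceWithRoot {a b : Fin 3 → ℝ} (q : HilbertBasis ℕ ℝ (ScalarL2 a b))
    (η : ℕ → ℝ) (Q Qh : ScalarL2 a b →L[ℝ] ScalarL2 a b) : Prop where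
  eigenvalue_nonneg : ∀ k, 0 ≤ η k
  eigen : ∀ k, Q (q k) = η k • q k
  root_positive : Qh.IsPositive
  root_sq : Qh ∘L Qh = Q

/-- A family of independent standard real Brownian motions with respect to the filtration `ℱ`. -/
structure IsBrownianFamily {ι Ω : Type*} {mΩ : MeasurableSpace Ω} (P : Measure Ω)
    (ℱ : Filtration ℝ≥0 mΩ) (β : ι → ℝ≥0 → Ω → ℝ) : Prop where
  brownian : ∀ i, IsBrownianReal (β i) P
  adapted : ∀ i t, Measurable[ℱ t] (β i t)
  indep : iIndepFun (fun i ω t => β i t ω) P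
  indep_past : ∀ s t : ℝ≥0, s ≤ t →
    Indep (MeasurableSpace.comap (fun ω i => β i t ω - β i s ω) inferInstance) (ℱ s) P

/-- The `Q`-Wiener process `W(t) = ∑ₖ √ηₖ qₖ βₖ(t)`; the orthogonal series converges in `L²(D)`
almost surely when `∑ₖ ηₖ < ∞`. -/
def wiener {a b : Fin 3 → ℝ} {Ω : Type*} (q : HilbertBasis ℕ ℝ (ScalarL2 a b)) (η : ℕ → ℝ)
    (β : ℕ → ℝ≥0 → Ω → ℝ) (t : ℝ≥0) (ω : Ω) : ScalarL2 a b :=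
  ∑' k, (√(η k) * β k t ω) • q k

/-- The increment `ΔWⁿ = W(t_{n+1}) - W(t_n)`, `t_n = n Δt`. -/
def wienerIncrement {a b : Fin 3 → ℝ} {Ω : Type*} (q : HilbertBasis ℕ ℝ (ScalarL2 a b))
    (η : ℕ → ℝ) (β : ℕ → ℝ≥0 → Ω → ℝ) (Δt : ℝ≥0) (n : ℕ) (ω : Ω) : ScalarL2 a b :=
  wiener q η β ((n + 1 : ℕ) * Δt) ω - wiener q η β (n * Δt) ω

/-- The truncation level `A_{Δt} = √(2 c |ln Δt|)`. -/
def truncLevel (c : ℝ) (Δt : ℝ≥0) : ℝ := √(2 * c * |Real.log Δt|)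

/-- Truncation of a real number at the levels `± A`. -/
def truncate (A ξ : ℝ) : ℝ := if A < ξ then A else if ξ < -A then -A else ξ

/-- The truncated increment `√Δt ∑ᵢ ζᵢⁿ Q^{1/2} qᵢ`, where `ζᵢⁿ` is the truncation at the levels
`± A_{Δt}` of the standard normal variable `ξᵢⁿ = (βᵢ(t_{n+1}) - βᵢ(t_n)) / √Δt`. -/
def truncatedIncrement {a b : Fin 3 → ℝ} {Ω : Type*} (q : HilbertBasis ℕ ℝ (ScalarL2 a b))
    (Qh : ScalarL2 a b →L[ℝ] ScalarL2 a b) (β : ℕ → ℝ≥0 → Ω → ℝ) (c : ℝ) (Δt : ℝ≥0)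
    (n : ℕ) (ω : Ω) : ScalarL2 a b :=
  √(Δt : ℝ) • ∑' i,
    truncate (truncLevel c Δt) ((β i ((n + 1 : ℕ) * Δt) ω - β i (n * Δt) ω) / √(Δt : ℝ)) • Qh (q i)

/-! ### The temporal semi-discretization -/

/-- One step `u ↦ u'` of the modified midpoint method with noise increments `w₁`, `w₂`: the
midpoint `v = (u' + e^{-σΔt} u) / 2` lies in `𝒟(M)` and
`u' - e^{-σΔt} u = Δt M v + λ₁ J v w₁ + (λ₂, λ₂) w₂`. -/
def IsStep (a b : Fin 3 → ℝ) (σ : R3 → ℝ) (lam₁ : ℝ) (lam₂ : R3) (Δt : ℝ≥0)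
    (w₁ w₂ : ScalarL2 a b) (u u' : EMField a b) : Prop :=
  ∃ v Mv : EMField a b,
    (∀ᵐ x ∂(vol a b), v x = (1 / 2 : ℝ) • (u' x + Real.exp (-(σ x * Δt)) • u x)) ∧
    MaxwellEq a b v Mv ∧
    ∀ᵐ x ∂(vol a b), u' x - Real.exp (-(σ x * Δt)) • u x =
      (Δt : ℝ) • Mv x + (lam₁ * w₁ x) • Jmap (v x) + w₂ x • WithLp.toLp 2 (lam₂, lam₂)

/-- `u = (uⁿ)_{n ∈ ℕ}` is an `{ℱ_{t_n}}`-adapted `ℍ`-valued solution of the temporal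
semi-discretization with noise increments `dW₁`, `dW₂`. -/
structure IsNumericalSolution {Ω : Type*} {mΩ : MeasurableSpace Ω} (P : Measure Ω)
    (ℱ : Filtration ℝ≥0 mΩ) (a b : Fin 3 → ℝ) (σ : R3 → ℝ) (lam₁ : ℝ) (lam₂ : R3) (Δt : ℝ≥0)
    (dW₁ dW₂ : ℕ → Ω → ScalarL2 a b) (u : ℕ → Ω → EMField a b) : Prop where
  adapted : ∀ n : ℕ, Measurable[ℱ (n * Δt)] (u n)
  step : ∀ᵐ ω ∂P, ∀ n : ℕ, IsStep a b σ lam₁ lam₂ Δt (dW₁ n ω) (dW₂ n ω) (u n ω) (u (n + 1) ω)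

/-- `S = (P_n)_{n ∈ ℕ}` is the Markov transition semigroup of the numerical solution: for every
initial value there is a solution, and the law of `uⁿ` is `P_n^* (law of u⁰)`. For a deterministic
initial value `x` this says that `P_n(x, ·)` is the law of `uⁿ`, so `S` is uniquely determined. -/
structure IsTransitionSemigroup {Ω : Type*} {mΩ : MeasurableSpace Ω} (P : Measure Ω)
    (ℱ : Filtration ℝ≥0 mΩ) (a b : Fin 3 → ℝ) (σ : R3 → ℝ) (lam₁ : ℝ) (lam₂ : R3) (Δt : ℝ≥0)
    (dW₁ dW₂ : ℕ → Ω → ScalarL2 a b) (S : ℕ → Kernel (EMField a b) (EMField a b)) : Prop where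
  markov : ∀ n, IsMarkovKernel (S n)
  zero : S 0 = Kernel.id
  add : ∀ m n, S (m + n) = S n ∘ₖ S m
  exists_solution : ∀ u₀ : Ω → EMField a b, Measurable[ℱ 0] u₀ →
    ∃ u, IsNumericalSolution P ℱ a b σ lam₁ lam₂ Δt dW₁ dW₂ u ∧ u 0 = u₀
  law : ∀ u, IsNumericalSolution P ℱ a b σ lam₁ lam₂ Δt dW₁ dW₂ u →
    ∀ n, P.map (u n) = S n ∘ₘ P.map (u 0)

/-! ### Invariant measures, ergodicity, mixing, Wasserstein distance -/

section Ergodicity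

variable {X : Type*} [NormedAddCommGroup X] [MeasurableSpace X]

/-- `π ∈ 𝒫₂(X)`: a probability measure with finite second moment. -/
def MemP2 (π : Measure X) : Prop :=
  IsProbabilityMeasure π ∧ ∫⁻ x, ‖x‖ₑ ^ 2 ∂π ≠ ∞

/-- The probability measure `π` is invariant: `∫ P_n φ dπ = ∫ φ dπ` for bounded Borel `φ`. -/
def IsInvariantMeasure (S : ℕ → Kernel X X) (π : Measure X) : Prop :=
  IsProbabilityMeasure π ∧ ∀ φ : X → ℝ, Measurable φ → (∃ c, ∀ x, |φ x| ≤ c) →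
    ∀ n, ∫ x, (∫ y, φ y ∂(S n x)) ∂π = ∫ x, φ x ∂π

/-- Ergodicity: for all `φ ∈ L²(π)`, the time averages `N⁻¹ ∑_{n < N} P_n φ` converge to `π(φ)`
in `L²(π)`. -/
def IsErgodic (S : ℕ → Kernel X X) (π : Measure X) : Prop :=
  ∀ φ : X → ℝ, MemLp φ 2 π →
    Tendsto (fun N : ℕ => eLpNorm
      (fun x => (N : ℝ)⁻¹ * ∑ n ∈ Finset.range N, (∫ y, φ y ∂(S n x)) - ∫ y, φ y ∂π) 2 π)
      atTop (𝓝 0)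

/-- Exponential mixing along the time grid `t_n = n Δt`. -/
def IsExponentiallyMixing (S : ℕ → Kernel X X) (Δt : ℝ≥0) (π : Measure X) : Prop :=
  ∃ ρ : ℝ, 0 < ρ ∧ ∃ C : X → ℝ, (∀ x, 0 < C x) ∧
    ∀ (φ : X → ℝ) (L : ℝ≥0), (∃ c, ∀ x, |φ x| ≤ c) → LipschitzWith L φ →
      ∀ (n : ℕ) (x : X),
        |(∫ y, φ y ∂(S n x)) - ∫ y, φ y ∂π| ≤ C x * L * Real.exp (-ρ * (n * Δt))

/-- The `L²`-Wasserstein distance: the infimum of `(∫ ‖x - y‖² dγ)^{1/2}` over all couplings. -/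
def wasserstein2 (μ ν : Measure X) : ℝ≥0∞ :=
  (⨅ (γ : Measure (X × X)) (_ : γ.map Prod.fst = μ ∧ γ.map Prod.snd = ν),
    ∫⁻ z, ‖z.1 - z.2‖ₑ ^ 2 ∂γ) ^ (1 / 2 : ℝ)

end Ergodicity

end StochMaxwell

end

open StochMaxwell

/-! One step of the scheme is a random map `u ↦ Φ z u`, where `z` collects the Brownian increments
over one time interval, and every such map contracts, realization by realization, with the same
factor. For two solutions driven by the same increments the additive noise cancels in the
difference. Pairing the difference of the equations with the difference of the midpoints removes the
Maxwell term, because `M` is skew-adjoint, and the multiplicative noise, because `J` is skew. What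
remains is `⟨p + d, p - d⟩ = 0`, with `p` the difference of the new states and `d` the damped
difference of the old ones, so `‖p‖ = ‖d‖ ≤ e^{-σ₀Δt}‖u - y‖` (`norm_sub_eq_of_isStep`).

Everything asymptotic follows for any i.i.d. sequence of uniform contractions with `E‖Φ z 0‖² < ∞`
(`IsContraction`). Compositions in reversed order converge almost surely, and the law of the limit
is invariant with finite second moment. The semigroup contracts Lipschitz constants, which gives
exponential mixing, weak convergence from every point and hence uniqueness. Mean ergodicity follows
by density of bounded continuous functions in `L²(π)`, and the Wasserstein estimate by feeding the
same noise to both components of a coupling.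

Solvability is the analytic part. In terms of the midpoint `v` the step reads `v - (Δt/2) M v = E u
+ ½ λ₁ w J v + ½ w₂ (λ₂, λ₂)`, with `E` the multiplication by `e^{-σΔt}` and `w`, `w₂` the two noise
increments. The resolvent `T` of `M` has norm at most one (`exists_resolvent`), so a Neumann series
gives `v` as soon as `‖½ λ₁ T w J‖ < 1`. Truncation yields `‖w‖_∞ ≤ √Δt A_Δt ∑ ‖Q₁^{1/2} qᵢ‖_∞`,
where the sum is finite by the embedding of `H²` into `L^∞` and `√Δt A_Δt → 0`; this is where `δ`
comes from. The additive noise only needs `∑ η_k < ∞`, which follows from the Hilbert–Schmidt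
condition on `Q₂^{1/2}`. -/

noncomputable section

/-! ### Iterated random contractions and their stationary law. -/

namespace RandomContraction

/-! ### Sequences of independent draws -/

section Sequences

variable {Z : Type*} [MeasurableSpace Z]

/-- The sequence `z, ω 0, ω 1, …`. -/
def consSeq (p : Z × (ℕ → Z)) : ℕ → Z
  | 0 => p.1
  | n + 1 => p.2 n

lemma measurable_consSeq : Measurable (consSeq (Z := Z)) := by
  refine measurable_pi_lambda _ fun n => ?_
  cases n with
  | zero => exact measurable_fst
  | succ n => exact (measurable_pi_apply n).comp measurable_snd

/-- This is the invariance that makes the backward limit stationary. Finite cylinders determine the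
product measure; enlarging their index set to an initial segment by factors `univ` lets coordinate
zero split off. -/
lemma map_consSeq (ν : Measure Z) [IsProbabilityMeasure ν] :
    (ν.prod (Measure.infinitePi fun _ : ℕ => ν)).map consSeq
      = Measure.infinitePi fun _ : ℕ => ν := by
  classical
  refine Measure.eq_infinitePi _ fun s t ht => ?_
  obtain ⟨N, hN⟩ : ∃ N, s ⊆ Finset.range (N + 1) :=
    ⟨s.sup id, fun i hi => Finset.mem_range.2 (Nat.lt_succ_of_le (Finset.le_sup (f := id) hi))⟩
  set t' : ℕ → Set Z := fun i => if i ∈ s then t i else Set.univ with ht'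
  have hmt' : ∀ i, MeasurableSet (t' i) := fun i => by
    by_cases h : i ∈ s
    · simpa [ht', h] using ht i
    · simp [ht', h]
  have h1 : Set.pi (s : Set ℕ) t = Set.pi (Finset.range (N + 1) : Set ℕ) t' := by
    ext x
    simp only [Set.mem_pi, Finset.mem_coe]
    constructor
    · intro h i _
      by_cases hi : i ∈ s
      · simpa [ht', hi] using h i hi
      · simp [ht', hi]
    · intro h i hi
      simpa [ht', hi] using h i (hN hi)
  have h2 : ∏ i ∈ s, ν (t i) = ∏ i ∈ Finset.range (N + 1), ν (t' i) := by
    rw [← Finset.prod_subset hN]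
    · exact Finset.prod_congr rfl fun i hi => by simp [ht', hi]
    · intro i _ hi
      simp [ht', hi]
  have h3 : consSeq ⁻¹' (Set.pi (Finset.range (N + 1) : Set ℕ) t')
      = t' 0 ×ˢ Set.pi (Finset.range N : Set ℕ) (fun i => t' (i + 1)) := by
    ext p
    simp only [Set.mem_preimage, Set.mem_pi, Finset.mem_coe, Finset.mem_range, Set.mem_prod]
    constructor
    · intro h
      exact ⟨h 0 (Nat.succ_pos _), fun i hi => h (i + 1) (by omega)⟩
    · rintro ⟨h0, h⟩ i hi
      cases i with
      | zero => exact h0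
      | succ i => exact h i (by omega)
  rw [h1, h2, Measure.map_apply measurable_consSeq
    (MeasurableSet.pi (Finset.countable_toSet _) fun i _ => hmt' i), h3, Measure.prod_prod,
    Measure.infinitePi_pi _ (fun i _ => hmt' (i + 1)), Finset.prod_range_succ', mul_comm]

end Sequences

/-! ### The transition kernel of a random map -/

variable {X Z : Type*} [MeasurableSpace X] [MeasurableSpace Z]

/-- The law of `Φ z x` when `z` has law `ν`. -/
def kernel (ν : Measure Z) (Φ : Z → X → X) : Kernel X X :=
  (Kernel.id ×ₖ Kernel.const X ν).map fun p : X × Z => Φ p.2 p.1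

section Kernel

variable {ν : Measure Z} [IsProbabilityMeasure ν] {Φ : Z → X → X}
  (hΦ : Measurable fun p : X × Z => Φ p.2 p.1)
include hΦ

lemma isMarkovKernel_kernel : IsMarkovKernel (kernel ν Φ) :=
  Kernel.IsMarkovKernel.map _ hΦ

lemma kernel_apply (x : X) : kernel ν Φ x = ν.map fun z => Φ z x := by
  rw [kernel, Kernel.map_apply _ hΦ, Kernel.prod_apply, Kernel.id_apply, Kernel.const_apply,
    Measure.dirac_prod, Measure.map_map hΦ (by fun_prop)]
  rfl

lemma kernel_comp (μ : Measure X) [IsProbabilityMeasure μ] :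
    kernel ν Φ ∘ₘ μ = (μ.prod ν).map fun p => Φ p.2 p.1 := by
  rw [kernel, ← Measure.map_comp _ _ hΦ]
  congr 1
  rw [← Measure.compProd_eq_comp_prod, Measure.compProd_const]

lemma isMarkovKernel_pow (n : ℕ) : IsMarkovKernel (kernel ν Φ ^ n) := by
  induction n with
  | zero => exact inferInstanceAs (IsMarkovKernel (Kernel.id : Kernel X X))
  | succ n ih =>
    have := isMarkovKernel_kernel (ν := ν) hΦ
    rw [pow_succ]
    exact inferInstanceAs (IsMarkovKernel ((kernel ν Φ ^ n) ∘ₖ kernel ν Φ))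

omit [IsProbabilityMeasure ν] in
lemma measurable_apply (x : X) : Measurable fun z => Φ z x :=
  hΦ.comp (f := fun z : Z => (x, z)) measurable_prodMk_left

lemma integral_kernel_apply (φ : X → ℝ) (hφ : Measurable φ) (x : X) :
    ∫ y, φ y ∂(kernel ν Φ x) = ∫ z, φ (Φ z x) ∂ν := by
  rw [kernel_apply hΦ, integral_map (measurable_apply hΦ x).aemeasurable
    hφ.aestronglyMeasurable]

end Kernel

/-! ### Contractions in mean square -/

/-- The random map `z ↦ Φ z`, with `z` of law `ν`, is a uniform contraction with square integrable
displacement of the origin. -/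
structure IsContraction [NormedAddCommGroup X] (ν : Measure Z) (Φ : Z → X → X) (r : ℝ) : Prop where
  measurable : Measurable fun p : X × Z => Φ p.2 p.1
  nonneg : 0 ≤ r
  lt_one : r < 1
  lipschitz : ∀ z x y, ‖Φ z x - Φ z y‖ ≤ r * ‖x - y‖
  moment : ∫⁻ z, ‖Φ z 0‖ₑ ^ 2 ∂ν ≠ ∞

variable [NormedAddCommGroup X]

/-- Composition of the first `n` maps of a sequence, the first one applied last. -/
def backward (Φ : Z → X → X) : ℕ → (ℕ → Z) → X
  | 0, _ => 0
  | n + 1, ω => Φ (ω 0) (backward Φ n fun k => ω (k + 1))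

/-- The limit of the backward compositions. -/
def backwardLimit (Φ : Z → X → X) (ω : ℕ → Z) : X := limUnder atTop fun n => backward Φ n ω

namespace IsContraction

variable {ν : Measure Z} {Φ : Z → X → X} {r : ℝ}

lemma measurable_backward (h : IsContraction ν Φ r) (n : ℕ) : Measurable (backward Φ n) := by
  induction n with
  | zero => exact measurable_const
  | succ n ih =>
    have h1 : Measurable fun ω : ℕ → Z => (backward Φ n (fun k => ω (k + 1)), ω 0) :=
      (ih.comp (measurable_pi_lambda _ fun k => measurable_pi_apply (k + 1))).prodMk
        (measurable_pi_apply 0)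
    exact h.measurable.comp h1

/-- Two consecutive backward compositions share their `n` outer maps and differ only in the
innermost argument, `Φ (ω n) 0` against `0`. Forward compositions lack this property and do not
converge pathwise. -/
lemma norm_backward_succ_sub_le (h : IsContraction ν Φ r) (n : ℕ) (ω : ℕ → Z) :
    ‖backward Φ (n + 1) ω - backward Φ n ω‖ ≤ r ^ n * ‖Φ (ω n) 0‖ := by
  induction n generalizing ω with
  | zero => simp [backward]
  | succ n ih =>
    calc ‖backward Φ (n + 1 + 1) ω - backward Φ (n + 1) ω‖
        ≤ r * ‖backward Φ (n + 1) (fun k => ω (k + 1)) - backward Φ n fun k => ω (k + 1)‖ :=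
          h.lipschitz _ _ _
      _ ≤ r * (r ^ n * ‖Φ (ω (n + 1)) 0‖) := mul_le_mul_of_nonneg_left (ih _) h.nonneg
      _ = r ^ (n + 1) * ‖Φ (ω (n + 1)) 0‖ := by ring

lemma sq_norm_apply_le (h : IsContraction ν Φ r) (z : Z) (x : X) :
    ‖Φ z x‖ ^ 2 ≤ r * ‖x‖ ^ 2 + (1 - r)⁻¹ * ‖Φ z 0‖ ^ 2 := by
  have h1 : ‖Φ z x‖ ≤ r * ‖x‖ + ‖Φ z 0‖ := by
    have := h.lipschitz z x 0
    rw [sub_zero] at this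
    calc ‖Φ z x‖ = ‖(Φ z x - Φ z 0) + Φ z 0‖ := by rw [sub_add_cancel]
      _ ≤ _ := (norm_add_le _ _).trans (by gcongr)
  have hr : 0 < 1 - r := sub_pos.2 h.lt_one
  -- With this scaling `r‖x‖ + ‖Φ z 0‖` is the convex combination `r‖x‖ + (1 - r) g`, and convexity
  -- of the square finishes.
  set g := (1 - r)⁻¹ * ‖Φ z 0‖ with hg
  have hg' : ‖Φ z 0‖ = (1 - r) * g := by rw [hg]; field_simp
  have h2 : (1 - r)⁻¹ * ‖Φ z 0‖ ^ 2 = (1 - r) * g ^ 2 := by rw [hg]; field_simp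
  rw [h2]
  have h0 := h.nonneg
  calc ‖Φ z x‖ ^ 2 ≤ (r * ‖x‖ + (1 - r) * g) ^ 2 := by
        rw [← hg']; exact pow_le_pow_left₀ (norm_nonneg _) h1 2
    _ ≤ r * ‖x‖ ^ 2 + (1 - r) * g ^ 2 := by
        nlinarith [mul_nonneg (mul_nonneg h0 hr.le) (sq_nonneg (‖x‖ - g))]

lemma sq_enorm_apply_le (h : IsContraction ν Φ r) (z : Z) (x : X) :
    ‖Φ z x‖ₑ ^ 2 ≤ ENNReal.ofReal r * ‖x‖ₑ ^ 2 + ENNReal.ofReal (1 - r)⁻¹ * ‖Φ z 0‖ₑ ^ 2 := by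
  have hr : 0 ≤ (1 - r)⁻¹ := inv_nonneg.2 (sub_pos.2 h.lt_one).le
  have h1 : ∀ y : X, ‖y‖ₑ ^ 2 = ENNReal.ofReal (‖y‖ ^ 2) := fun y => by
    rw [← ofReal_norm, ENNReal.ofReal_pow (norm_nonneg _)]
  rw [h1, h1, h1, ← ENNReal.ofReal_mul h.nonneg, ← ENNReal.ofReal_mul hr, ← ENNReal.ofReal_add
    (mul_nonneg h.nonneg (sq_nonneg _)) (mul_nonneg hr (sq_nonneg _))]
  exact ENNReal.ofReal_le_ofReal (h.sq_norm_apply_le z x)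

variable [IsProbabilityMeasure ν]

lemma lintegral_enorm_ne_top (h : IsContraction ν Φ r) : ∫⁻ z, ‖Φ z 0‖ₑ ∂ν ≠ ∞ := by
  have h1 : ∫⁻ z, ‖Φ z 0‖ₑ ∂ν ≤ ∫⁻ z, (1 + ‖Φ z 0‖ₑ ^ 2) ∂ν := by
    refine lintegral_mono fun z => ?_
    rcases le_total ‖Φ z 0‖ₑ 1 with h1 | h1
    · exact h1.trans le_self_add
    · calc ‖Φ z 0‖ₑ = ‖Φ z 0‖ₑ * 1 := (mul_one _).symm
        _ ≤ ‖Φ z 0‖ₑ * ‖Φ z 0‖ₑ := by gcongr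
        _ = ‖Φ z 0‖ₑ ^ 2 := (sq _).symm
        _ ≤ _ := le_add_self
  refine ne_top_of_le_ne_top ?_ h1
  rw [lintegral_add_left measurable_const]
  simpa using h.moment

variable [BorelSpace X] [SecondCountableTopology X]

-- The expectation of the series is a geometric series times `E‖Φ z 0‖`, so the series is finite
-- almost surely.
omit [SecondCountableTopology X] in
lemma ae_summable (h : IsContraction ν Φ r) :
    ∀ᵐ ω ∂(Measure.infinitePi fun _ : ℕ => ν), Summable fun n => r ^ n * ‖Φ (ω n) 0‖ := by
  have hm : Measurable fun z => ‖Φ z 0‖ₑ := (measurable_apply h.measurable 0).enorm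
  have hmn : ∀ n : ℕ, Measurable fun ω : ℕ → Z => ‖Φ (ω n) 0‖ₑ := fun n =>
    hm.comp (measurable_pi_apply n)
  have h1 : ∫⁻ ω, ∑' n, ENNReal.ofReal r ^ n * ‖Φ (ω n) 0‖ₑ
      ∂(Measure.infinitePi fun _ : ℕ => ν) ≠ ∞ := by
    rw [lintegral_tsum fun n => ((hmn n).const_mul _).aemeasurable]
    have h2 : ∀ n : ℕ, ∫⁻ ω, ENNReal.ofReal r ^ n * ‖Φ (ω n) 0‖ₑ
        ∂(Measure.infinitePi fun _ : ℕ => ν) = ENNReal.ofReal r ^ n * ∫⁻ z, ‖Φ z 0‖ₑ ∂ν := by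
      intro n
      rw [lintegral_const_mul _ (hmn n)]
      congr 1
      conv_rhs => rw [← Measure.infinitePi_map_eval (fun _ : ℕ => ν) n]
      rw [lintegral_map hm (measurable_pi_apply n)]
    simp_rw [h2]
    rw [ENNReal.tsum_mul_right, ENNReal.tsum_geometric]
    refine ENNReal.mul_ne_top ?_ h.lintegral_enorm_ne_top
    rw [ENNReal.inv_ne_top]
    have : ENNReal.ofReal r < 1 := by simpa using h.lt_one
    exact (tsub_pos_of_lt this).ne'
  filter_upwards [ae_lt_top (Measurable.tsum fun n =>
    (hmn n).const_mul _) h1] with ω hω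
  have h3 := ENNReal.summable_toReal hω.ne
  refine h3.congr fun n => ?_
  simp [ENNReal.toReal_mul, ENNReal.toReal_ofReal h.nonneg]

variable [CompleteSpace X]

omit [SecondCountableTopology X] in
lemma ae_tendsto_backward (h : IsContraction ν Φ r) :
    ∀ᵐ ω ∂(Measure.infinitePi fun _ : ℕ => ν),
      Tendsto (fun n => backward Φ n ω) atTop (𝓝 (backwardLimit Φ ω)) := by
  filter_upwards [h.ae_summable] with ω hω
  have : CauchySeq fun n => backward Φ n ω := by
    refine cauchySeq_of_summable_dist (hω.of_nonneg_of_le (fun _ => dist_nonneg) fun n => ?_)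
    rw [dist_comm, dist_eq_norm]
    exact h.norm_backward_succ_sub_le n ω
  exact this.tendsto_limUnder

omit [IsProbabilityMeasure ν] in
lemma measurable_backwardLimit (h : IsContraction ν Φ r) : Measurable (backwardLimit Φ) :=
  (StronglyMeasurable.limUnder fun n => (h.measurable_backward n).stronglyMeasurable).measurable

omit [CompleteSpace X] [SecondCountableTopology X] [IsProbabilityMeasure ν] [BorelSpace X] in
lemma continuous_apply (h : IsContraction ν Φ r) (z : Z) : Continuous (Φ z) :=
  (LipschitzWith.of_dist_le_mul (K := ⟨r, h.nonneg⟩) fun x y => by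
    rw [dist_eq_norm, dist_eq_norm]; exact h.lipschitz z x y).continuous

variable (ν Φ) in
/-- The stationary law. -/
def _root_.RandomContraction.stationary : Measure X :=
  (Measure.infinitePi fun _ : ℕ => ν).map (backwardLimit Φ)

lemma isProbabilityMeasure_stationary (h : IsContraction ν Φ r) :
    IsProbabilityMeasure (stationary ν Φ) :=
  Measure.isProbabilityMeasure_map h.measurable_backwardLimit.aemeasurable

/-- Prepending a fresh draw `z` to `ω` turns the backward limit `L(ω)` into `Φ z (L(ω))`, by
continuity of `Φ z`, and the prolonged sequence has the same law as `ω`. -/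
lemma kernel_comp_stationary (h : IsContraction ν Φ r) :
    kernel ν Φ ∘ₘ stationary ν Φ = stationary ν Φ := by
  have := h.isProbabilityMeasure_stationary
  set I := Measure.infinitePi fun _ : ℕ => ν with hI
  have hL := h.measurable_backwardLimit
  rw [kernel_comp h.measurable]
  have h1 : (stationary ν Φ).prod ν = (ν.prod I).map fun p => (backwardLimit Φ p.2, p.1) := by
    have e := Measure.map_prod_map I ν hL measurable_id
    rw [Measure.map_id] at e
    rw [stationary, e, ← Measure.prod_swap, Measure.map_map (by fun_prop) (by fun_prop)]
    rfl
  rw [h1, Measure.map_map h.measurable (by fun_prop)]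
  conv_rhs => rw [stationary, ← map_consSeq ν, Measure.map_map hL measurable_consSeq]
  refine Measure.map_congr ?_
  have h2 : ∀ᵐ p ∂(ν.prod I), Tendsto (fun n => backward Φ n p.2) atTop
      (𝓝 (backwardLimit Φ p.2)) :=
    Measure.quasiMeasurePreserving_snd.ae h.ae_tendsto_backward
  have h3 : ∀ᵐ p ∂(ν.prod I), Tendsto (fun n => backward Φ n (consSeq p)) atTop
      (𝓝 (backwardLimit Φ (consSeq p))) := by
    have := h.ae_tendsto_backward
    rw [← map_consSeq ν] at this
    exact ae_of_ae_map measurable_consSeq.aemeasurable this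
  filter_upwards [h2, h3] with p hp2 hp3
  refine tendsto_nhds_unique ?_ ((tendsto_add_atTop_iff_nat 1).2 hp3)
  exact ((h.continuous_apply p.1).tendsto _).comp hp2

-- The outermost map uses a draw independent of the inner composition, so the convexity bound
-- `sq_enorm_apply_le` becomes an affine recursion for second moments with ratio `r`.
omit [SecondCountableTopology X] [CompleteSpace X] in
lemma lintegral_backward_le (h : IsContraction ν Φ r) (n : ℕ) :
    ∫⁻ ω, ‖backward Φ n ω‖ₑ ^ 2 ∂(Measure.infinitePi fun _ : ℕ => ν) ≤
      ∑ k ∈ Finset.range n, ENNReal.ofReal r ^ k *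
        (ENNReal.ofReal (1 - r)⁻¹ * ∫⁻ z, ‖Φ z 0‖ₑ ^ 2 ∂ν) := by
  have hm := fun n => ((h.measurable_backward n).enorm.pow_const 2)
  have hm0 : Measurable fun z => ‖Φ z 0‖ₑ ^ 2 := (measurable_apply h.measurable 0).enorm.pow_const 2
  induction n with
  | zero => simp [backward]
  | succ n ih =>
    rw [← map_consSeq ν, lintegral_map (hm _) measurable_consSeq]
    calc ∫⁻ p, ‖backward Φ (n + 1) (consSeq p)‖ₑ ^ 2
          ∂(ν.prod (Measure.infinitePi fun _ : ℕ => ν))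
        ≤ ∫⁻ p, (ENNReal.ofReal r * ‖backward Φ n p.2‖ₑ ^ 2 +
            ENNReal.ofReal (1 - r)⁻¹ * ‖Φ p.1 0‖ₑ ^ 2)
            ∂(ν.prod (Measure.infinitePi fun _ : ℕ => ν)) :=
          lintegral_mono fun p => h.sq_enorm_apply_le _ _
      _ = ENNReal.ofReal r * ∫⁻ ω, ‖backward Φ n ω‖ₑ ^ 2 ∂(Measure.infinitePi fun _ : ℕ => ν) +
            ENNReal.ofReal (1 - r)⁻¹ * ∫⁻ z, ‖Φ z 0‖ₑ ^ 2 ∂ν := by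
          have hm1 : Measurable fun p : Z × (ℕ → Z) => ‖backward Φ n p.2‖ₑ ^ 2 :=
            (hm n).comp measurable_snd
          have hm2 : Measurable fun p : Z × (ℕ → Z) => ‖Φ p.1 0‖ₑ ^ 2 := hm0.comp measurable_fst
          rw [lintegral_add_left (hm1.const_mul _), lintegral_const_mul _ hm1,
            lintegral_const_mul _ hm2]
          congr 2
          · exact (measurePreserving_snd (μ := ν)).lintegral_comp (hm n)
          · exact (measurePreserving_fst (ν := Measure.infinitePi fun _ : ℕ => ν)).lintegral_comp hm0
      _ ≤ _ := by
          rw [Finset.sum_range_succ', pow_zero, one_mul]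
          refine add_le_add_left ((mul_le_mul_right ih _).trans_eq ?_) _
          rw [Finset.mul_sum]
          exact Finset.sum_congr rfl fun k _ => by rw [pow_succ']; ring

/-- Fatou's lemma transfers the uniform second moment bound of the backward compositions to their
limit. -/
lemma memP2_stationary (h : IsContraction ν Φ r) : MemP2 (stationary ν Φ) := by
  refine ⟨h.isProbabilityMeasure_stationary, ?_⟩
  have hL := h.measurable_backwardLimit
  rw [stationary, lintegral_map (measurable_enorm.pow_const 2) hL]
  set C := ENNReal.ofReal (1 - r)⁻¹ * ∫⁻ z, ‖Φ z 0‖ₑ ^ 2 ∂ν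
  have hC : C ≠ ∞ := ENNReal.mul_ne_top ENNReal.ofReal_ne_top h.moment
  have h1 : ∫⁻ ω, ‖backwardLimit Φ ω‖ₑ ^ 2 ∂(Measure.infinitePi fun _ : ℕ => ν) ≤
      liminf (fun n => ∫⁻ ω, ‖backward Φ n ω‖ₑ ^ 2 ∂(Measure.infinitePi fun _ : ℕ => ν)) atTop := by
    refine le_trans (lintegral_mono_ae ?_)
      (lintegral_liminf_le fun n => (h.measurable_backward n).enorm.pow_const 2)
    filter_upwards [h.ae_tendsto_backward] with ω hω
    exact (((ENNReal.continuous_pow 2).comp continuous_enorm).tendsto _ |>.comp hω).liminf_eq.ge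
  have h2 : ∀ n, ∫⁻ ω, ‖backward Φ n ω‖ₑ ^ 2 ∂(Measure.infinitePi fun _ : ℕ => ν) ≤
      (1 - ENNReal.ofReal r)⁻¹ * C := fun n => by
    refine (h.lintegral_backward_le n).trans ?_
    rw [← Finset.sum_mul, ← ENNReal.tsum_geometric]
    gcongr
    exact ENNReal.sum_le_tsum _
  have h3 : (1 - ENNReal.ofReal r)⁻¹ * C ≠ ∞ := by
    refine ENNReal.mul_ne_top ?_ hC
    rw [ENNReal.inv_ne_top]
    have : ENNReal.ofReal r < 1 := by simpa using h.lt_one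
    exact (tsub_pos_of_lt this).ne'
  refine ne_top_of_le_ne_top h3 (h1.trans ?_)
  exact (liminf_le_liminf (Eventually.of_forall h2)).trans (by simp)

end IsContraction

end RandomContraction
end

noncomputable section

/-! ### Mixing, uniqueness, mean ergodicity and Wasserstein contraction. -/

namespace RandomContraction

variable {X Z : Type*} [MeasurableSpace X] [MeasurableSpace Z] [NormedAddCommGroup X]

namespace IsContraction

variable {ν : Measure Z} {Φ : Z → X → X} {r : ℝ} [IsProbabilityMeasure ν]

lemma isMarkovKernel_pow (h : IsContraction ν Φ r) (n : ℕ) : IsMarkovKernel (kernel ν Φ ^ n) :=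
  RandomContraction.isMarkovKernel_pow h.measurable n

omit [MeasurableSpace X] [NormedAddCommGroup X] [IsProbabilityMeasure ν] in
lemma abs_integral_le {Y : Type*} [MeasurableSpace Y] {μ : Measure Y} [IsProbabilityMeasure μ]
    {φ : Y → ℝ} {c : ℝ} (hc : ∀ x, |φ x| ≤ c) : |∫ x, φ x ∂μ| ≤ c := by
  have := norm_integral_le_of_norm_le_const (μ := μ) (f := φ) (Eventually.of_forall hc)
  simpa using this

omit [NormedAddCommGroup X] in
lemma integrable_of_bounded {μ : Measure X} [IsProbabilityMeasure μ] {φ : X → ℝ}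
    (hφ : Measurable φ) (hb : ∃ c, ∀ x, |φ x| ≤ c) : Integrable φ μ := by
  obtain ⟨c, hc⟩ := hb
  exact Integrable.of_bound hφ.aestronglyMeasurable c (Eventually.of_forall hc)

variable [BorelSpace X] [SecondCountableTopology X]

omit [SecondCountableTopology X] in
/-- The semigroup contracts Lipschitz constants. -/
lemma abs_integral_pow_sub_le (h : IsContraction ν Φ r) (n : ℕ) (φ : X → ℝ) (L : ℝ≥0)
    (hb : ∃ c, ∀ x, |φ x| ≤ c) (hL : LipschitzWith L φ) (x y : X) :
    |(∫ w, φ w ∂((kernel ν Φ ^ n) x)) - ∫ w, φ w ∂((kernel ν Φ ^ n) y)| ≤ L * r ^ n * ‖x - y‖ := by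
  induction n generalizing φ L with
  | zero =>
    have e : ∀ x, ∫ w, φ w ∂((kernel ν Φ ^ 0) x) = φ x := fun x => by
      rw [pow_zero]
      exact integral_dirac' φ x hL.continuous.stronglyMeasurable
    rw [e, e]
    simpa [← Real.dist_eq, ← dist_eq_norm] using hL.dist_le_mul x y
  | succ n ih =>
    -- The induction runs over the observable: one transition replaces a bounded `L`-Lipschitz `φ`
    -- by a bounded `L r`-Lipschitz `ψ`.
    set ψ : X → ℝ := fun x => ∫ w, φ w ∂(kernel ν Φ x) with hψ
    have := isMarkovKernel_kernel (ν := ν) h.measurable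
    have hmn := h.isMarkovKernel_pow n
    have hmn1 := h.isMarkovKernel_pow (n + 1)
    have e : ∀ x, ∫ w, φ w ∂((kernel ν Φ ^ (n + 1)) x) = ∫ w, ψ w ∂((kernel ν Φ ^ n) x) := by
      intro x
      have hi : Integrable φ ((kernel ν Φ ^ (n + 1)) x) :=
        integrable_of_bounded hL.continuous.measurable hb
      rw [pow_succ'] at hi ⊢
      exact Kernel.integral_comp hi
    have hψe : ∀ x, ψ x = ∫ z, φ (Φ z x) ∂ν := fun x =>
      integral_kernel_apply h.measurable φ hL.continuous.measurable x
    have hint : ∀ x, Integrable (fun z => φ (Φ z x)) ν := fun x => by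
      obtain ⟨c, hc⟩ := hb
      exact Integrable.of_bound (hL.continuous.measurable.comp
        (measurable_apply h.measurable x)).aestronglyMeasurable c
        (Eventually.of_forall fun z => hc _)
    have hψL : LipschitzWith (L * ⟨r, h.nonneg⟩) ψ := by
      refine LipschitzWith.of_dist_le_mul fun x y => ?_
      rw [Real.dist_eq, hψe, hψe, ← integral_sub (hint x) (hint y), dist_eq_norm]
      refine abs_integral_le fun z => ?_
      change _ ≤ L * r * ‖x - y‖
      calc ‖φ (Φ z x) - φ (Φ z y)‖ ≤ L * ‖Φ z x - Φ z y‖ := by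
            simpa [dist_eq_norm] using hL.dist_le_mul (Φ z x) (Φ z y)
        _ ≤ L * (r * ‖x - y‖) := by gcongr; exact h.lipschitz z x y
        _ = _ := by ring
    have hψb : ∃ c, ∀ x, |ψ x| ≤ c := by
      obtain ⟨c, hc⟩ := hb
      exact ⟨c, fun x => abs_integral_le hc⟩
    rw [e, e]
    refine (ih ψ _ hψb hψL).trans_eq ?_
    change L * r * r ^ n * ‖x - y‖ = _
    ring

omit [IsProbabilityMeasure ν] [BorelSpace X] [SecondCountableTopology X] [NormedAddCommGroup X] in
lemma pow_comp_eq_self {μ : Measure X} (hμ : kernel ν Φ ∘ₘ μ = μ) (n : ℕ) :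
    (kernel ν Φ ^ n) ∘ₘ μ = μ := by
  induction n with
  | zero =>
    rw [pow_zero]
    exact Measure.bind_dirac
  | succ n ih =>
    rw [pow_succ']
    change (kernel ν Φ ∘ₖ (kernel ν Φ ^ n)) ∘ₘ μ = μ
    rw [← Measure.comp_assoc, ih, hμ]

omit [BorelSpace X] [SecondCountableTopology X] [NormedAddCommGroup X] in
lemma integral_integral_of_comp_eq {K : Kernel X X} {μ : Measure X} {φ : X → ℝ}
    (hμ : K ∘ₘ μ = μ) (hφ : Integrable φ μ) : ∫ x, (∫ y, φ y ∂(K x)) ∂μ = ∫ x, φ x ∂μ := by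
  conv_rhs => rw [← hμ]
  rw [Measure.comp_eq_comp_const_apply] at hμ ⊢
  rw [Kernel.integral_comp (by rwa [hμ]), Kernel.const_apply]

variable [CompleteSpace X]

lemma pow_comp_stationary (h : IsContraction ν Φ r) (n : ℕ) :
    (kernel ν Φ ^ n) ∘ₘ stationary ν Φ = stationary ν Φ :=
  pow_comp_eq_self h.kernel_comp_stationary n

lemma isInvariantMeasure_stationary (h : IsContraction ν Φ r) :
    IsInvariantMeasure (fun n => kernel ν Φ ^ n) (stationary ν Φ) := by
  have := h.isProbabilityMeasure_stationary
  exact ⟨this, fun φ hφ hb n => integral_integral_of_comp_eq (h.pow_comp_stationary n)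
    (integrable_of_bounded hφ hb)⟩

lemma integrable_norm_stationary (h : IsContraction ν Φ r) :
    Integrable (fun x => ‖x‖) (stationary ν Φ) := by
  obtain ⟨h1, h2⟩ := h.memP2_stationary
  have : MemLp (fun x : X => x) 2 (stationary ν Φ) := by
    refine ⟨aestronglyMeasurable_id, ?_⟩
    rw [eLpNorm_lt_top_iff_lintegral_rpow_enorm_lt_top (by simp) (by simp)]
    simpa using h2.lt_top
  exact (this.integrable (by simp)).norm

/-- By invariance the stationary mean is the average over `y` of `P_n φ(y)`, so the Lipschitz
estimate can be integrated in `y`. The summand `1` only serves to make the mixing constant strictly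
positive. -/
lemma abs_integral_pow_sub_stationary_le (h : IsContraction ν Φ r) (n : ℕ) (φ : X → ℝ) (L : ℝ≥0)
    (hb : ∃ c, ∀ x, |φ x| ≤ c) (hL : LipschitzWith L φ) (x : X) :
    |(∫ w, φ w ∂((kernel ν Φ ^ n) x)) - ∫ w, φ w ∂(stationary ν Φ)| ≤
      (1 + ∫ y, ‖x - y‖ ∂(stationary ν Φ)) * L * r ^ n := by
  have := h.isProbabilityMeasure_stationary
  have hmn := h.isMarkovKernel_pow n
  have hφm := hL.continuous.measurable
  have hi : Integrable (fun y => ‖x - y‖) (stationary ν Φ) := by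
    refine ((integrable_const ‖x‖).add h.integrable_norm_stationary).mono'
      (by fun_prop) (Eventually.of_forall fun y => ?_)
    simpa using norm_sub_le x y
  have hPi : Integrable (fun y => ∫ w, φ w ∂((kernel ν Φ ^ n) y)) (stationary ν Φ) := by
    refine integrable_of_bounded hφm.stronglyMeasurable.integral_kernel.measurable ?_
    obtain ⟨c, hc⟩ := hb
    exact ⟨c, fun x => abs_integral_le hc⟩
  rw [← integral_integral_of_comp_eq (h.pow_comp_stationary n) (integrable_of_bounded hφm hb)]
  have e : ∫ w, φ w ∂((kernel ν Φ ^ n) x) =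
      ∫ y, (∫ w, φ w ∂((kernel ν Φ ^ n) x)) ∂(stationary ν Φ) := by simp
  rw [e, ← integral_sub (integrable_const _) hPi]
  have h0 := h.nonneg
  calc |∫ y, ((∫ w, φ w ∂((kernel ν Φ ^ n) x)) - ∫ w, φ w ∂((kernel ν Φ ^ n) y)) ∂(stationary ν Φ)|
      ≤ ∫ y, L * r ^ n * ‖x - y‖ ∂(stationary ν Φ) :=
by
        rw [← Real.norm_eq_abs]
        exact norm_integral_le_of_norm_le (hi.const_mul _) (Eventually.of_forall fun y =>
          h.abs_integral_pow_sub_le n φ L hb hL x y)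
    _ = (∫ y, ‖x - y‖ ∂(stationary ν Φ)) * L * r ^ n := by rw [integral_const_mul]; ring
    _ ≤ _ := by gcongr; simp

lemma isExponentiallyMixing (h : IsContraction ν Φ r) {Δt : ℝ≥0} {ρ : ℝ} (hρ : 0 < ρ)
    (hr : r = Real.exp (-ρ * Δt)) :
    IsExponentiallyMixing (fun n => kernel ν Φ ^ n) Δt (stationary ν Φ) := by
  refine ⟨ρ, hρ, fun x => 1 + ∫ y, ‖x - y‖ ∂(stationary ν Φ), fun x => ?_, fun φ L hb hL n x => ?_⟩
  · have : 0 ≤ ∫ y, ‖x - y‖ ∂(stationary ν Φ) := integral_nonneg fun _ => norm_nonneg _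
    positivity
  · refine (h.abs_integral_pow_sub_stationary_le n φ L hb hL x).trans_eq ?_
    rw [hr, ← Real.exp_nat_mul]
    congr 2
    ring

lemma tendsto_integral_pow (h : IsContraction ν Φ r) (φ : X → ℝ) (L : ℝ≥0)
    (hb : ∃ c, ∀ x, |φ x| ≤ c) (hL : LipschitzWith L φ) (x : X) :
    Tendsto (fun n => ∫ w, φ w ∂((kernel ν Φ ^ n) x)) atTop (𝓝 (∫ w, φ w ∂(stationary ν Φ))) := by
  rw [tendsto_iff_norm_sub_tendsto_zero]
  refine squeeze_zero (fun _ => norm_nonneg _)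
    (fun n => h.abs_integral_pow_sub_stationary_le n φ L hb hL x) ?_
  simpa using (tendsto_pow_atTop_nhds_zero_of_lt_one h.nonneg h.lt_one).const_mul
    ((1 + ∫ y, ‖x - y‖ ∂(stationary ν Φ)) * L)

/-- The transition probabilities converge weakly to the stationary law. -/
lemma tendsto_integral_pow_of_continuous (h : IsContraction ν Φ r)
    (φ : BoundedContinuousFunction X ℝ) (x : X) :
    Tendsto (fun n => ∫ w, φ w ∂((kernel ν Φ ^ n) x)) atTop (𝓝 (∫ w, φ w ∂(stationary ν Φ))) := by
  have := h.isProbabilityMeasure_stationary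
  have hM := h.isMarkovKernel_pow
  let μs : ℕ → ProbabilityMeasure X := fun n => ⟨(kernel ν Φ ^ n) x, inferInstance⟩
  let π₀ : ProbabilityMeasure X := ⟨stationary ν Φ, this⟩
  have key : Tendsto μs atTop (𝓝 π₀) := by
    -- Weak convergence may be tested on bounded Lipschitz functions. Here boundedness means bounded
    -- oscillation, whence the bound `|f 0| + C`.
    rw [tendsto_iff_forall_lipschitz_integral_tendsto]
    rintro f ⟨C, hC⟩ ⟨L, hL⟩
    refine h.tendsto_integral_pow f L ⟨|f 0| + C, fun y => ?_⟩ hL x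
    have := hC y 0
    rw [Real.dist_eq] at this
    linarith [abs_sub_abs_le_abs_sub (f y) (f 0)]
  rw [ProbabilityMeasure.tendsto_iff_forall_integral_tendsto] at key
  exact key φ

/-- Averaging the weak convergence of `P_n(x, ·)` over an invariant law leaves the left side
constant in `n`. Dominated convergence needs only bounded observables, so the competing law may have
infinite moments. -/
lemma eq_stationary_of_isInvariantMeasure (h : IsContraction ν Φ r) {π' : Measure X}
    (hπ' : IsInvariantMeasure (fun n => kernel ν Φ ^ n) π') : π' = stationary ν Φ := by
  have := h.isProbabilityMeasure_stationary
  obtain ⟨hp, hinv⟩ := hπ'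
  have hM := h.isMarkovKernel_pow
  have key : ∀ φ : BoundedContinuousFunction X ℝ, ∫ x, φ x ∂π' = ∫ x, φ x ∂(stationary ν Φ) := by
    intro φ
    have hm := φ.continuous.measurable
    have hc : ∀ x, |φ x| ≤ ‖φ‖ := φ.norm_coe_le_norm
    have h1 : Tendsto (fun n => ∫ x, (∫ w, φ w ∂((kernel ν Φ ^ n) x)) ∂π') atTop
        (𝓝 (∫ _, (∫ w, φ w ∂(stationary ν Φ)) ∂π')) := by
      refine tendsto_integral_of_dominated_convergence (fun _ => ‖φ‖)
        (fun n => hm.stronglyMeasurable.integral_kernel.aestronglyMeasurable)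
        (integrable_const _) (fun n => Eventually.of_forall fun x => ?_)
        (Eventually.of_forall fun x => h.tendsto_integral_pow_of_continuous φ x)
      exact abs_integral_le hc
    simp_rw [fun n => hinv φ hm ⟨_, hc⟩ n] at h1
    simpa using tendsto_nhds_unique tendsto_const_nhds h1
  exact ext_of_forall_integral_eq_of_IsFiniteMeasure key

/-! ### Mean ergodicity -/

omit [CompleteSpace X] [SecondCountableTopology X] [BorelSpace X] [NormedAddCommGroup X] in
/-- Markov kernels contract the `L²` norm of an invariant measure. -/
lemma eLpNorm_integral_le {K : Kernel X X} [IsMarkovKernel K] {μ : Measure X} [IsProbabilityMeasure μ]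
    (hμ : K ∘ₘ μ = μ) {φ : X → ℝ} (hφ : StronglyMeasurable φ) :
    eLpNorm (fun x => ∫ y, φ y ∂(K x)) 2 μ ≤ eLpNorm φ 2 μ := by
  have h2 : ∀ (μ' : Measure X) (f : X → ℝ),
      eLpNorm f 2 μ' = (∫⁻ x, ‖f x‖ₑ ^ 2 ∂μ') ^ (1 / 2 : ℝ) := fun μ' f => by
    rw [eLpNorm_eq_lintegral_rpow_enorm_toReal (by simp) (by simp)]
    simp
  rw [h2, h2]
  refine ENNReal.rpow_le_rpow ?_ (by norm_num)
  have hm : Measurable fun y => ‖φ y‖ₑ ^ 2 := hφ.measurable.enorm.pow_const 2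
  conv_rhs => rw [← hμ, Measure.lintegral_bind K.aemeasurable hm.aemeasurable]
  refine lintegral_mono fun x => ?_
  -- Jensen's inequality, in the form `L¹ ≤ L²` for the probability measure `K x`.
  have h3 : ‖∫ y, φ y ∂(K x)‖ₑ ≤ eLpNorm φ 2 (K x) :=
    (enorm_integral_le_lintegral_enorm _).trans (by
      rw [← eLpNorm_one_eq_lintegral_enorm]
      exact eLpNorm_le_eLpNorm_of_exponent_le (by simp) hφ.aestronglyMeasurable)
  calc ‖∫ y, φ y ∂(K x)‖ₑ ^ 2 ≤ eLpNorm φ 2 (K x) ^ 2 := by gcongr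
    _ = _ := by rw [h2, ← ENNReal.rpow_natCast, ← ENNReal.rpow_mul]; simp

/-- The semigroup converges in `L²` of the stationary law on bounded continuous functions. -/
lemma tendsto_eLpNorm_integral_pow_sub_of_continuous (h : IsContraction ν Φ r)
    (ψ : BoundedContinuousFunction X ℝ) :
    Tendsto (fun n => eLpNorm (fun x => (∫ y, ψ y ∂((kernel ν Φ ^ n) x)) -
      ∫ y, ψ y ∂(stationary ν Φ)) 2 (stationary ν Φ)) atTop (𝓝 0) := by
  have hp := h.isProbabilityMeasure_stationary
  have hM := h.isMarkovKernel_pow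
  have hψm : StronglyMeasurable (ψ : X → ℝ) := ψ.continuous.stronglyMeasurable
  have h2 : ∀ (f : X → ℝ), eLpNorm f 2 (stationary ν Φ) =
      (∫⁻ x, ‖f x‖ₑ ^ 2 ∂(stationary ν Φ)) ^ (1 / 2 : ℝ) := fun f => by
    rw [eLpNorm_eq_lintegral_rpow_enorm_toReal (by simp) (by simp)]
    simp
  simp_rw [h2]
  have key : Tendsto (fun n => ∫⁻ x, ‖(∫ y, ψ y ∂((kernel ν Φ ^ n) x)) -
      ∫ y, ψ y ∂(stationary ν Φ)‖ₑ ^ 2 ∂(stationary ν Φ)) atTop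
      (𝓝 (∫⁻ _, 0 ∂(stationary ν Φ))) := by
    refine tendsto_lintegral_of_dominated_convergence
      (fun _ => ENNReal.ofReal (‖ψ‖ + ‖ψ‖) ^ 2) (fun n => ?_) (fun n => ?_) (by simp) ?_
    · exact (hψm.integral_kernel.measurable.sub measurable_const).enorm.pow_const 2
    · refine Eventually.of_forall fun x => ?_
      simp only
      gcongr
      rw [← ofReal_norm]
      refine ENNReal.ofReal_le_ofReal ((norm_sub_le _ _).trans (add_le_add ?_ ?_)) <;>
      exact abs_integral_le ψ.norm_coe_le_norm
    · refine Eventually.of_forall fun x => ?_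
      have h1 := tendsto_iff_edist_tendsto_0.1 (h.tendsto_integral_pow_of_continuous ψ x)
      simp_rw [edist_eq_enorm_sub] at h1
      simpa [Function.comp_def] using ((ENNReal.continuous_pow 2).tendsto _).comp h1
  simpa using key.ennrpow_const (1 / 2 : ℝ)

/-- The semigroup converges strongly in `L²` of the stationary law. -/
lemma tendsto_eLpNorm_integral_pow_sub (h : IsContraction ν Φ r) {φ : X → ℝ}
    (hφm : StronglyMeasurable φ) (hφ : MemLp φ 2 (stationary ν Φ)) :
    Tendsto (fun n => eLpNorm (fun x => (∫ y, φ y ∂((kernel ν Φ ^ n) x)) -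
      ∫ y, φ y ∂(stationary ν Φ)) 2 (stationary ν Φ)) atTop (𝓝 0) := by
  have hp := h.isProbabilityMeasure_stationary
  have hM := h.isMarkovKernel_pow
  set π := stationary ν Φ with hπ
  rw [ENNReal.tendsto_nhds_zero]
  intro ε hε
  rcases eq_or_ne ε ∞ with rfl | hεt
  · simp
  have hε3 : ε / 3 ≠ 0 := by simpa using hε.ne'
  obtain ⟨ψ, hψ, hψL⟩ := hφ.exists_boundedContinuous_eLpNorm_sub_le (by simp) hε3
  have hψm : StronglyMeasurable (ψ : X → ℝ) := ψ.continuous.stronglyMeasurable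
  -- convergence for the bounded continuous approximation
  have hconv := h.tendsto_eLpNorm_integral_pow_sub_of_continuous ψ
  rw [← hπ] at hconv
  have hdiff : eLpNorm (fun x => φ x - ψ x) 2 π ≤ ε / 3 := hψ
  have hmean : ‖(∫ y, φ y ∂π) - ∫ y, ψ y ∂π‖ₑ ≤ ε / 3 := by
    rw [← integral_sub (hφ.integrable (by simp)) (hψL.integrable (by simp))]
    refine (enorm_integral_le_lintegral_enorm _).trans (le_trans ?_ hdiff)
    rw [← eLpNorm_one_eq_lintegral_enorm]
    exact eLpNorm_le_eLpNorm_of_exponent_le (by simp) (hφm.sub hψm).aestronglyMeasurable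
  filter_upwards [(ENNReal.tendsto_nhds_zero.1 hconv) (ε / 3) (pos_iff_ne_zero.2 hε3)] with n hn
  -- The three terms are `P_n(φ - ψ)`, `P_n ψ - π(ψ)` and `π(φ) - π(ψ)`. The identity holds only
  -- almost everywhere because `φ` need not be integrable under every `P_n(x, ·)`.
  have hsplit : (fun x => (∫ y, φ y ∂((kernel ν Φ ^ n) x)) - ∫ y, φ y ∂π) =ᵐ[π]
      ((fun x => ∫ y, (φ y - ψ y) ∂((kernel ν Φ ^ n) x)) +
        fun x => (∫ y, ψ y ∂((kernel ν Φ ^ n) x)) - ∫ y, ψ y ∂π) -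
        fun _ => (∫ y, φ y ∂π) - ∫ y, ψ y ∂π := by
    have hi : Integrable φ ((kernel ν Φ ^ n : Kernel X X) ∘ₘ π) := by
      rw [h.pow_comp_stationary n]; exact hφ.integrable (by simp)
    filter_upwards [Measure.ae_integrable_of_integrable_comp hi] with x hx
    have hψi : Integrable ψ ((kernel ν Φ ^ n) x) := ψ.integrable _
    simp only [Pi.sub_apply, Pi.add_apply]
    rw [integral_sub hx hψi]
    ring
  rw [eLpNorm_congr_ae hsplit]
  have m1 := (hφm.sub hψm).integral_kernel (κ := kernel ν Φ ^ n)
  have m2 : StronglyMeasurable fun x => (∫ y, ψ y ∂((kernel ν Φ ^ n) x)) - ∫ y, ψ y ∂π :=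
    hψm.integral_kernel.sub stronglyMeasurable_const
  refine (eLpNorm_sub_le (m1.add m2).aestronglyMeasurable
    aestronglyMeasurable_const (by norm_num)).trans ?_
  refine (add_le_add_left (eLpNorm_add_le m1.aestronglyMeasurable m2.aestronglyMeasurable
    (by norm_num)) _).trans ?_
  have e3 : ε = ε / 3 + ε / 3 + ε / 3 := (ENNReal.add_thirds ε).symm
  conv_rhs => rw [e3]
  refine add_le_add (add_le_add ?_ hn) ?_
  · exact (eLpNorm_integral_le (h.pow_comp_stationary n) (hφm.sub hψm)).trans hdiff
  · rw [eLpNorm_const _ (by simp) (IsProbabilityMeasure.ne_zero π)]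
    simpa using hmean

lemma isErgodic (h : IsContraction ν Φ r) :
    IsErgodic (fun n => kernel ν Φ ^ n) (stationary ν Φ) := by
  intro φ₀ hφ₀
  have hp := h.isProbabilityMeasure_stationary
  have hM := h.isMarkovKernel_pow
  set π := stationary ν Φ with hπ
  set φ := hφ₀.1.mk φ₀ with hφd
  have hφm : StronglyMeasurable φ := hφ₀.1.stronglyMeasurable_mk
  have hae : φ₀ =ᵐ[π] φ := hφ₀.1.ae_eq_mk
  have hφ : MemLp φ 2 π := (memLp_congr_ae hae).1 hφ₀
  -- Invariance makes a `π`-null set null under `P_n(x, ·)` for almost every `x`, so a strongly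
  -- measurable representative may be used.
  have hae' : ∀ᵐ x ∂π, ∀ n : ℕ, ∫ y, φ₀ y ∂((kernel ν Φ ^ n) x) = ∫ y, φ y ∂((kernel ν Φ ^ n) x) := by
    rw [ae_all_iff]
    intro n
    have h1 : ∀ᵐ y ∂((kernel ν Φ ^ n : Kernel X X) ∘ₘ π), φ₀ y = φ y := by rw [h.pow_comp_stationary n]; exact hae
    filter_upwards [Measure.ae_ae_of_ae_comp h1] with x hx
    exact integral_congr_ae hx
  set a : ℕ → ℝ≥0∞ := fun n => eLpNorm (fun x => (∫ y, φ y ∂((kernel ν Φ ^ n) x)) - ∫ y, φ y ∂π) 2 π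
    with ha
  have hlim : Tendsto a atTop (𝓝 0) := h.tendsto_eLpNorm_integral_pow_sub hφm hφ
  have hmeas : ∀ n, StronglyMeasurable fun x => (∫ y, φ y ∂((kernel ν Φ ^ n) x)) - ∫ y, φ y ∂π :=
    fun n => hφm.integral_kernel.sub stronglyMeasurable_const
  have hfin : ∀ n, a n ≠ ∞ := by
    intro n
    have h1 : MemLp (fun x => ∫ y, φ y ∂((kernel ν Φ ^ n) x)) 2 π :=
      ⟨hφm.integral_kernel.aestronglyMeasurable,
        (eLpNorm_integral_le (h.pow_comp_stationary n) hφm).trans_lt hφ.2⟩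
    exact (h1.sub (memLp_const (∫ y, φ y ∂π))).2.ne
  have hces : Tendsto (fun N : ℕ => ENNReal.ofReal ((N : ℝ)⁻¹ * ∑ n ∈ Finset.range N, (a n).toReal))
      atTop (𝓝 0) := by
    have h1 : Tendsto (fun n => (a n).toReal) atTop (𝓝 0) := by
      simpa [Function.comp_def] using (ENNReal.tendsto_toReal ENNReal.zero_ne_top).comp hlim
    simpa using ENNReal.tendsto_ofReal h1.cesaro
  refine tendsto_of_tendsto_of_tendsto_of_le_of_le' tendsto_const_nhds hces
    (Eventually.of_forall fun _ => zero_le) ?_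
  filter_upwards [eventually_gt_atTop 0] with N hN
  have hN' : (N : ℝ) ≠ 0 := by exact_mod_cast hN.ne'
  have e1 : (fun x => (N : ℝ)⁻¹ * ∑ n ∈ Finset.range N, (∫ y, φ₀ y ∂((kernel ν Φ ^ n) x)) -
      ∫ y, φ₀ y ∂π) =ᵐ[π] (N : ℝ)⁻¹ • ∑ n ∈ Finset.range N,
        fun x => (∫ y, φ y ∂((kernel ν Φ ^ n) x)) - ∫ y, φ y ∂π := by
    filter_upwards [hae'] with x hx
    simp only [Pi.smul_apply, Finset.sum_apply, Finset.sum_sub_distrib, hx, smul_eq_mul,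
      Finset.sum_const, Finset.card_range, nsmul_eq_mul, integral_congr_ae hae]
    field_simp
  rw [eLpNorm_congr_ae e1, eLpNorm_const_smul, ENNReal.ofReal_mul (by positivity),
    ENNReal.ofReal_sum_of_nonneg fun _ _ => ENNReal.toReal_nonneg]
  rw [← ofReal_norm, Real.norm_of_nonneg (by positivity)]
  gcongr
  refine (eLpNorm_sum_le (fun n _ => (hmeas n).aestronglyMeasurable) (by norm_num)).trans ?_
  exact Finset.sum_le_sum fun n _ => (ENNReal.ofReal_toReal (hfin n)).ge

/-! ### Contraction of the Wasserstein distance -/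

-- Synchronous coupling: both components of an arbitrary coupling are moved by the same draw `z`,
-- which multiplies the transport cost by at most `r²`.
omit [CompleteSpace X] in
lemma wasserstein2_kernel_le (h : IsContraction ν Φ r) (hr : 0 < r) (μ μ' : Measure X)
    [IsProbabilityMeasure μ] [IsProbabilityMeasure μ'] :
    wasserstein2 (kernel ν Φ ∘ₘ μ) (kernel ν Φ ∘ₘ μ') ≤ ENNReal.ofReal r * wasserstein2 μ μ' := by
  have hr2 : ENNReal.ofReal r = (ENNReal.ofReal r ^ 2) ^ (1 / 2 : ℝ) := by
    rw [← ENNReal.rpow_natCast, ← ENNReal.rpow_mul]; simp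
  have hr0 : ENNReal.ofReal r ^ 2 ≠ 0 := by simpa using hr
  have hrt : ENNReal.ofReal r ^ 2 ≠ ∞ := ENNReal.pow_ne_top ENNReal.ofReal_ne_top
  unfold wasserstein2
  rw [hr2, ← ENNReal.mul_rpow_of_nonneg _ _ (by norm_num)]
  refine ENNReal.rpow_le_rpow ?_ (by norm_num)
  -- Pulling the factor through the infimum requires it to be nonzero and finite; this is the role
  -- of `0 < r`.
  simp_rw [ENNReal.mul_iInf_of_ne hr0 hrt]
  refine le_iInf₂ fun γ hγ => ?_
  have : IsProbabilityMeasure γ := by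
    refine ⟨?_⟩
    have := measure_univ (μ := μ)
    rw [← hγ.1, Measure.map_apply measurable_fst MeasurableSet.univ] at this
    simpa using this
  have hf1 : Measurable fun p : (X × X) × Z => Φ p.2 p.1.1 :=
    h.measurable.comp (f := fun p : (X × X) × Z => (p.1.1, p.2)) (by fun_prop)
  have hf2 : Measurable fun p : (X × X) × Z => Φ p.2 p.1.2 :=
    h.measurable.comp (f := fun p : (X × X) × Z => (p.1.2, p.2)) (by fun_prop)
  have hproj : ∀ g : X × X → X, Measurable g → (γ.prod ν).map (fun p => Φ p.2 (g p.1)) =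
      kernel ν Φ ∘ₘ γ.map g := by
    intro g hg
    have : IsProbabilityMeasure (γ.map g) := Measure.isProbabilityMeasure_map hg.aemeasurable
    rw [kernel_comp h.measurable]
    have e := Measure.map_prod_map γ ν hg measurable_id
    rw [Measure.map_id] at e
    rw [e, Measure.map_map h.measurable (by fun_prop)]
    rfl
  refine (iInf₂_le ((γ.prod ν).map fun p => (Φ p.2 p.1.1, Φ p.2 p.1.2)) ⟨?_, ?_⟩).trans ?_
  · have hm : Measurable fun z : X × X => ‖z.1 - z.2‖ₑ ^ 2 :=
      (measurable_fst.sub measurable_snd).enorm.pow_const 2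
    rw [lintegral_map hm (hf1.prodMk hf2), ← lintegral_const_mul _ hm]
    calc ∫⁻ p, ‖Φ p.2 p.1.1 - Φ p.2 p.1.2‖ₑ ^ 2 ∂(γ.prod ν)
        ≤ ∫⁻ p, ENNReal.ofReal r ^ 2 * ‖p.1.1 - p.1.2‖ₑ ^ 2 ∂(γ.prod ν) := by
          refine lintegral_mono fun p => ?_
          rw [← mul_pow]
          gcongr
          rw [← ofReal_norm, ← ofReal_norm, ← ENNReal.ofReal_mul h.nonneg]
          exact ENNReal.ofReal_le_ofReal (h.lipschitz _ _ _)
      _ = ∫⁻ z, ENNReal.ofReal r ^ 2 * ‖z.1 - z.2‖ₑ ^ 2 ∂γ :=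
          (measurePreserving_fst (ν := ν)).lintegral_comp (hm.const_mul _)
  · rw [Measure.map_map measurable_fst (hf1.prodMk hf2), ← hγ.1]
    exact hproj Prod.fst measurable_fst
  · rw [Measure.map_map measurable_snd (hf1.prodMk hf2), ← hγ.2]
    exact hproj Prod.snd measurable_snd

lemma wasserstein2_pow_le (h : IsContraction ν Φ r) (hr : 0 < r) (μ : Measure X)
    [IsProbabilityMeasure μ] (n : ℕ) :
    wasserstein2 ((kernel ν Φ ^ n) ∘ₘ μ) (stationary ν Φ) ≤
      ENNReal.ofReal (r ^ n) * wasserstein2 μ (stationary ν Φ) := by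
  have := h.isProbabilityMeasure_stationary
  have hM := h.isMarkovKernel_pow
  induction n with
  | zero =>
    have e : (kernel ν Φ ^ 0 : Kernel X X) ∘ₘ μ = μ := by rw [pow_zero]; exact Measure.bind_dirac
    rw [e]
    simp
  | succ n ih =>
    have e : (kernel ν Φ ^ (n + 1) : Kernel X X) ∘ₘ μ =
        kernel ν Φ ∘ₘ ((kernel ν Φ ^ n : Kernel X X) ∘ₘ μ) := by
      rw [pow_succ', Measure.comp_assoc]; rfl
    rw [e]
    -- The stationary law is written as its own image, so that the one-step contraction applies to
    -- both arguments.
    conv_lhs => rw [← h.kernel_comp_stationary]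
    refine (h.wasserstein2_kernel_le hr _ _).trans ?_
    rw [pow_succ', ENNReal.ofReal_mul hr.le, mul_assoc]
    gcongr

end IsContraction
end RandomContraction
end

noncomputable section

/-! ### The Sobolev embedding of `H²` into `L^∞` on a cuboid. -/

namespace CuboidSobolev

open scoped Convolution
open ContinuousLinearMap (mul)

/-! ### Partial derivatives -/

lemma contDiff_partialDeriv {φ : R3 → ℝ} (hφ : ContDiff ℝ (⊤ : ℕ∞) φ) (i : Fin 3) :
    ContDiff ℝ (⊤ : ℕ∞) (partialDeriv i φ) :=
  (hφ.fderiv_right (m := (⊤ : ℕ∞)) (by simp)).clm_apply contDiff_const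

lemma hasCompactSupport_partialDeriv {φ : R3 → ℝ} (hφ : HasCompactSupport φ) (i : Fin 3) :
    HasCompactSupport (partialDeriv i φ) :=
  hφ.fderiv_apply ℝ _

lemma partialDeriv_comm {φ : R3 → ℝ} (hφ : ContDiff ℝ (⊤ : ℕ∞) φ) (i j : Fin 3) :
    partialDeriv i (partialDeriv j φ) = partialDeriv j (partialDeriv i φ) := by
  have h2 : ContDiff ℝ 2 φ := hφ.of_le (WithTop.coe_le_coe.2 (le_top : (2 : ℕ∞) ≤ ⊤))
  have hd : Differentiable ℝ (fderiv ℝ φ) :=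
    (h2.fderiv_right (m := 1) (by norm_num)).differentiable (by simp)
  have e : ∀ (i j : Fin 3) x, partialDeriv i (partialDeriv j φ) x =
      fderiv ℝ (fderiv ℝ φ) x (EuclideanSpace.single i 1) (EuclideanSpace.single j 1) := by
    intro i j x
    unfold partialDeriv
    rw [fderiv_clm_apply hd.differentiableAt (differentiableAt_const _)]
    simp
  ext x
  rw [e, e]
  exact (h2.contDiffAt.isSymmSndFDerivAt (by simp)) _ _

lemma partialDeriv_comp_sub {φ : R3 → ℝ} (hφ : ContDiff ℝ (⊤ : ℕ∞) φ) (i : Fin 3) (x : R3) :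
    partialDeriv i (fun t => φ (x - t)) = fun t => -partialDeriv i φ (x - t) := by
  ext t
  have h : HasFDerivAt (fun t => φ (x - t)) _ t := ((hφ.differentiable (by simp)) (x - t)).hasFDerivAt.comp t
    ((hasFDerivAt_id t).const_sub x)
  unfold partialDeriv
  rw [h.fderiv]
  simp

lemma contDiff_iterate_partialDeriv {φ : R3 → ℝ} (hφ : ContDiff ℝ (⊤ : ℕ∞) φ) (i : Fin 3) (k : ℕ) :
    ContDiff ℝ (⊤ : ℕ∞) ((partialDeriv i)^[k] φ) := by
  induction k generalizing φ with
  | zero => exact hφ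
  | succ k ih => exact ih (contDiff_partialDeriv hφ i)

lemma iterate_partialDeriv_comp_sub {φ : R3 → ℝ} (hφ : ContDiff ℝ (⊤ : ℕ∞) φ) (i : Fin 3) (x : R3) (k : ℕ) (c : ℝ) :
    (partialDeriv i)^[k] (fun t => c * φ (x - t)) =
      fun t => (-1) ^ k * c * (partialDeriv i)^[k] φ (x - t) := by
  induction k generalizing φ c with
  | zero => simp
  | succ k ih =>
    rw [Function.iterate_succ_apply, Function.iterate_succ_apply]
    have : partialDeriv i (fun t => c * φ (x - t)) = fun t => (-c) * partialDeriv i φ (x - t) := by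
      have h := partialDeriv_comp_sub (φ := c • φ) (contDiff_const.smul hφ) i x
      simp only [Pi.smul_apply, smul_eq_mul] at h
      rw [h]
      ext t
      unfold partialDeriv
      rw [fderiv_const_smul_field]
      simp
    rw [this, ih (contDiff_partialDeriv hφ i)]
    ext t
    ring

lemma multiDeriv_comp_sub {φ : R3 → ℝ} (hφ : ContDiff ℝ (⊤ : ℕ∞) φ) (α : Fin 3 → ℕ) (x : R3) :
    multiDeriv α (fun t => φ (x - t)) = fun t => (-1) ^ (∑ i, α i) * multiDeriv α φ (x - t) := by
  have h2 := contDiff_iterate_partialDeriv hφ 2 (α 2)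
  have h1 := contDiff_iterate_partialDeriv h2 1 (α 1)
  have h := iterate_partialDeriv_comp_sub hφ 2 x (α 2) 1
  simp only [one_mul, mul_one] at h
  unfold multiDeriv
  rw [h, iterate_partialDeriv_comp_sub h2, iterate_partialDeriv_comp_sub h1]
  ext t
  rw [Fin.sum_univ_three]
  ring

/-! ### Mollification -/

lemma iterate_partialDeriv_convolution {f g : R3 → ℝ} (hf : LocallyIntegrable f)
    (i : Fin 3) (k : ℕ) (hg : ContDiff ℝ (⊤ : ℕ∞) g) (hgc : HasCompactSupport g) :
    (partialDeriv i)^[k] (f ⋆[mul ℝ ℝ] g) = f ⋆[mul ℝ ℝ] ((partialDeriv i)^[k] g) ∧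
      ContDiff ℝ (⊤ : ℕ∞) ((partialDeriv i)^[k] g) ∧
      HasCompactSupport ((partialDeriv i)^[k] g) := by
  induction k generalizing g with
  | zero => exact ⟨rfl, hg, hgc⟩
  | succ k ih =>
    have h1 : partialDeriv i (f ⋆[mul ℝ ℝ] g) = f ⋆[mul ℝ ℝ] (partialDeriv i g) := by
      ext x
      have h := hgc.hasFDerivAt_convolution_right (mul ℝ ℝ) hf (hg.of_le (by exact_mod_cast le_top)) x
      rw [partialDeriv, h.fderiv, convolution_precompR_apply _ hf (hgc.fderiv ℝ)
        (hg.continuous_fderiv (by simp))]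
      rfl
    rw [Function.iterate_succ_apply, Function.iterate_succ_apply, h1]
    exact ih (contDiff_partialDeriv hg i) (hasCompactSupport_partialDeriv hgc i)

lemma multiDeriv_convolution {f g : R3 → ℝ} (hf : LocallyIntegrable f)
    (α : Fin 3 → ℕ) (hg : ContDiff ℝ (⊤ : ℕ∞) g) (hgc : HasCompactSupport g) :
    multiDeriv α (f ⋆[mul ℝ ℝ] g) = f ⋆[mul ℝ ℝ] (multiDeriv α g) := by
  obtain ⟨h1, h2, h3⟩ := iterate_partialDeriv_convolution hf 2 (α 2) hg hgc
  obtain ⟨h4, h5, h6⟩ := iterate_partialDeriv_convolution hf 1 (α 1) h2 h3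
  obtain ⟨h7, -, -⟩ := iterate_partialDeriv_convolution hf 0 (α 0) h5 h6
  unfold multiDeriv
  rw [h1, h4, h7]

variable {a b : Fin 3 → ℝ}

lemma isOpen_cuboid (a b : Fin 3 → ℝ) : IsOpen (cuboid a b) := by
  have : cuboid a b = ⋂ i, (fun x : R3 => x i) ⁻¹' Set.Ioo (a i) (b i) := by
    ext x; simp [cuboid]
  rw [this]
  exact isOpen_iInter_of_finite fun i => isOpen_Ioo.preimage (by fun_prop)

lemma measurableSet_cuboid (a b : Fin 3 → ℝ) : MeasurableSet (cuboid a b) :=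
  (isOpen_cuboid a b).measurableSet

lemma convex_cuboid (a b : Fin 3 → ℝ) : Convex ℝ (cuboid a b) := by
  intro x hx y hy s t hs ht hst i
  exact convex_Ioo (a i) (b i) (hx i) (hy i) hs ht hst

lemma isBounded_cuboid (a b : Fin 3 → ℝ) : Bornology.IsBounded (cuboid a b) := by
  refine (Metric.isBounded_Icc a b |>.isCompact_closure.image
    (EuclideanSpace.equiv (Fin 3) ℝ).symm.continuous).isBounded.subset ?_
  intro x hx
  refine ⟨fun i => x i, subset_closure ⟨fun i => (hx i).1.le, fun i => (hx i).2.le⟩, ?_⟩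
  rfl

lemma volume_cuboid_lt_top (a b : Fin 3 → ℝ) : volume (cuboid a b) < ∞ :=
  (isBounded_cuboid a b).measure_lt_top

instance isFiniteMeasure_vol (a b : Fin 3 → ℝ) : IsFiniteMeasure (vol a b) :=
  ⟨by rw [Measure.restrict_apply_univ]; exact volume_cuboid_lt_top a b⟩

/-- Mollification of a function on the cuboid, extended by zero. -/
def mollify (a b : Fin 3 → ℝ) (ρ g : R3 → ℝ) : R3 → ℝ :=
  (cuboid a b).indicator g ⋆[mul ℝ ℝ] ρ

lemma integrable_indicator (g : ScalarL2 a b) : Integrable ((cuboid a b).indicator g) := by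
  rw [integrable_indicator_iff (measurableSet_cuboid a b)]
  exact (Lp.memLp g).integrable (by norm_num)

/-- At points far enough from the boundary `t ↦ ρ (x - t)` is an admissible test function. The sign
from differentiating the reflection cancels the sign in the definition of the weak derivative. -/
lemma multiDeriv_mollify_eq {ρ : R3 → ℝ} (hρ : ContDiff ℝ (⊤ : ℕ∞) ρ) (hρc : HasCompactSupport ρ)
    {α : Fin 3 → ℕ} {f g : ScalarL2 a b} (h : IsWeakDeriv a b α f g) {x : R3}
    (hx : ∀ t, x - t ∈ tsupport ρ → t ∈ cuboid a b) :
    multiDeriv α (mollify a b ρ f) x = mollify a b ρ g x := by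
  unfold mollify
  rw [multiDeriv_convolution (integrable_indicator f).locallyIntegrable α hρ hρc]
  have hcont : Continuous fun t : R3 => x - t := by fun_prop
  have htest : IsTestFunction a b (fun t => ρ (x - t)) := by
    have hs : tsupport (fun t => ρ (x - t)) ⊆ (fun t => x - t) ⁻¹' tsupport ρ :=
      tsupport_comp_subset_preimage ρ hcont
    refine ⟨hρ.comp (contDiff_const.sub contDiff_id), ?_, fun t ht => hx t (hs ht)⟩
    exact hρc.comp_homeomorph (Homeomorph.subLeft x)
  have h1 := h _ htest
  rw [multiDeriv_comp_sub hρ] at h1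
  have key : ∀ (u v : R3 → ℝ), ((cuboid a b).indicator u ⋆[mul ℝ ℝ] v) x =
      ∫ t, u t * v (x - t) ∂(vol a b) := by
    intro u v
    rw [convolution_def, ← integral_indicator (measurableSet_cuboid a b)]
    refine integral_congr_ae (Eventually.of_forall fun t => ?_)
    by_cases ht : t ∈ cuboid a b <;> simp [ht]
  rw [key, key]
  have h2 : ∫ t, f t * ((-1) ^ (∑ i, α i) * multiDeriv α ρ (x - t)) ∂(vol a b) =
      (-1) ^ (∑ i, α i) * ∫ t, f t * multiDeriv α ρ (x - t) ∂(vol a b) := by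
    rw [← integral_const_mul]
    refine integral_congr_ae (Eventually.of_forall fun t => ?_)
    simp only
    ring
  rw [h2] at h1
  exact mul_left_cancel₀ (pow_ne_zero _ (by norm_num)) h1

end CuboidSobolev
end

noncomputable section

namespace CuboidSobolev

open scoped Convolution
open ContinuousLinearMap (mul)

variable {a b : Fin 3 → ℝ}

/-! ### Taylor's formula along segments -/

lemma hasDerivAt_comp_segment {F : R3 → ℝ} (hF : ContDiff ℝ (⊤ : ℕ∞) F) (x v : R3) (t : ℝ) :
    HasDerivAt (fun t : ℝ => F (x + t • v)) (∑ i, v i * partialDeriv i F (x + t • v)) t := by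
  have h1 : HasDerivAt (fun t : ℝ => x + t • v) v t := by
    simpa using ((hasDerivAt_id t).smul_const v).const_add x
  have h2 := ((hF.differentiable (by simp)) (x + t • v)).hasFDerivAt.comp_hasDerivAt t h1
  have e : v = ∑ i, v i • EuclideanSpace.single i (1 : ℝ) := by
    ext j
    simp [Finset.sum_apply, Pi.single_apply]
  have e2 : fderiv ℝ F (x + t • v) v = ∑ i, v i * partialDeriv i F (x + t • v) := by
    have : ∀ A : R3 →L[ℝ] ℝ, A v = ∑ i, v i * A (EuclideanSpace.single i 1) := fun A => by
      conv_lhs => rw [e, map_sum]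
      simp only [map_smul, smul_eq_mul]
    exact this _
  rwa [e2] at h2

/-- Taylor's formula with base point `x + v`, evaluated at `x`. Its remainder carries the weight
`t`, small near `x`, which later offsets the singularity created by shrinking the domain towards
`x`. It comes from integrating the derivative of `t ↦ t h1(t) - F(x + t v)`. -/
lemma taylor_segment {F : R3 → ℝ} (hF : ContDiff ℝ (⊤ : ℕ∞) F) (x v : R3) :
    F x = F (x + v) - (∑ i, v i * partialDeriv i F (x + v)) +
      ∫ t in (0 : ℝ)..1, t * ∑ i, v i * ∑ j, v j * partialDeriv j (partialDeriv i F) (x + t • v) := by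
  have hF1 := fun i => contDiff_partialDeriv hF i
  have hF2 := fun i j => contDiff_partialDeriv (hF1 i) j
  set h1 : ℝ → ℝ := fun t => ∑ i, v i * partialDeriv i F (x + t • v) with hh1
  set h2 : ℝ → ℝ := fun t => ∑ i, v i * ∑ j, v j * partialDeriv j (partialDeriv i F) (x + t • v)
    with hh2
  have d1 : ∀ t, HasDerivAt (fun t : ℝ => F (x + t • v)) (h1 t) t := hasDerivAt_comp_segment hF x v
  have d2 : ∀ t, HasDerivAt h1 (h2 t) t := fun t =>
    HasDerivAt.fun_sum fun i _ => (hasDerivAt_comp_segment (hF1 i) x v t).const_mul (v i)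
  have hc : Continuous h2 := by
    have := fun i j => (hF2 i j).continuous
    fun_prop
  have d3 : ∀ t ∈ Set.uIcc (0 : ℝ) 1, HasDerivAt (fun t => t * h1 t - F (x + t • v)) (t * h2 t) t := by
    intro t _
    have := ((hasDerivAt_id t).mul (d2 t)).sub (d1 t)
    rwa [one_mul, add_sub_cancel_left] at this
  have := intervalIntegral.integral_eq_sub_of_hasDerivAt d3
    ((continuous_id.mul hc).intervalIntegrable _ _)
  rw [this]
  simp only [hh1, one_smul, zero_smul, add_zero, one_mul, zero_mul]
  ring

lemma abs_apply_le_norm (v : R3) (i : Fin 3) : |v i| ≤ ‖v‖ := by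
  simpa using PiLp.norm_apply_le v i

lemma enorm_le_taylor {F : R3 → ℝ} (hF : ContDiff ℝ (⊤ : ℕ∞) F) (x v : R3) {d : ℝ≥0} (hv : ‖v‖ ≤ d) :
    ‖F x‖ₑ ≤ ‖F (x + v)‖ₑ + d * ∑ i, ‖partialDeriv i F (x + v)‖ₑ +
      d ^ 2 * ∑ i, ∑ j, ∫⁻ t in Set.Ioc (0 : ℝ) 1,
        ENNReal.ofReal t * ‖partialDeriv j (partialDeriv i F) (x + t • v)‖ₑ := by
  have hF2 := fun i j => (contDiff_partialDeriv (contDiff_partialDeriv hF i) j).continuous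
  have hvi : ∀ i, ‖v i‖ₑ ≤ d := fun i => by
    rw [← ofReal_norm, ← ENNReal.ofReal_coe_nnreal]
    exact ENNReal.ofReal_le_ofReal ((abs_apply_le_norm v i).trans hv)
  conv_lhs => rw [taylor_segment hF x v]
  refine (enorm_add_le _ _).trans (add_le_add ((enorm_sub_le).trans (add_le_add le_rfl ?_)) ?_)
  · rw [Finset.mul_sum]
    refine (enorm_sum_le _ _).trans (Finset.sum_le_sum fun i _ => ?_)
    rw [enorm_mul]
    gcongr
    exact hvi i
  · rw [intervalIntegral.integral_of_le zero_le_one]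
    refine (enorm_integral_le_lintegral_enorm _).trans ?_
    have hm : ∀ i j, Measurable fun t : ℝ =>
        ENNReal.ofReal t * ‖partialDeriv j (partialDeriv i F) (x + t • v)‖ₑ := fun i j => by
      have := hF2 i j
      exact ENNReal.measurable_ofReal.mul (Continuous.measurable (by fun_prop)).enorm
    simp_rw [Finset.mul_sum (s := Finset.univ) (a := (d : ℝ≥0∞) ^ 2), ← lintegral_const_mul _ (hm _ _)]
    simp_rw [← lintegral_finsetSum _ fun j _ => ((hm _ j).const_mul _)]
    rw [← lintegral_finsetSum _ fun i _ => Finset.measurable_sum _ fun j _ => ((hm i j).const_mul _)]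
    refine setLIntegral_mono_ae' measurableSet_Ioc (Eventually.of_forall fun t ht => ?_)
    rw [enorm_mul, Real.enorm_of_nonneg ht.1.le]
    refine (mul_le_mul_right (enorm_sum_le _ _) _).trans ?_
    rw [Finset.mul_sum]
    refine Finset.sum_le_sum fun i _ => ?_
    rw [← Finset.mul_sum, enorm_mul]
    refine (mul_le_mul_right (mul_le_mul' (hvi i) (enorm_sum_le _ _)) _).trans ?_
    simp_rw [Finset.mul_sum]
    refine Finset.sum_le_sum fun j _ => ?_
    rw [enorm_mul]
    calc ENNReal.ofReal t * (d * (‖v j‖ₑ * ‖partialDeriv j (partialDeriv i F) (x + t • v)‖ₑ))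
        ≤ ENNReal.ofReal t * (d * (d * ‖partialDeriv j (partialDeriv i F) (x + t • v)‖ₑ)) := by
          gcongr
          exact hvi j
      _ = _ := by ring

/-! ### Mollifications on rays -/

lemma lintegral_comp_affine {h : R3 → ℝ≥0∞} (hh : Measurable h) {t : ℝ} (ht : 0 < t) (c : R3) :
    ∫⁻ y, h (c + t • y) = ENNReal.ofReal (t ^ 3)⁻¹ * ∫⁻ y, h y := by
  have h1 : ∫⁻ y : R3, h (c + t • y) = ∫⁻ y, h (c + y) ∂(Measure.map (t • ·) volume) := by
    have hm : Measurable fun y => h (c + y) := hh.comp (measurable_const_add c)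
    rw [lintegral_map hm (measurable_const_smul t)]
  rw [h1, Measure.map_addHaar_smul volume ht.ne', lintegral_smul_measure,
    lintegral_add_left_eq_self]
  simp [abs_of_pos ht]

lemma enorm_mollify_le {ρ : R3 → ℝ} (g : R3 → ℝ) (p : R3) :
    ‖mollify a b ρ g p‖ₑ ≤ ∫⁻ s, ‖ρ s‖ₑ * ‖(cuboid a b).indicator g (p - s)‖ₑ := by
  unfold mollify
  rw [convolution_def]
  refine (enorm_integral_le_lintegral_enorm _).trans_eq ?_
  simp only [ContinuousLinearMap.mul_apply', enorm_mul]
  have := lintegral_sub_left_eq_self (μ := (volume : Measure R3))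
    (fun s => ‖ρ s‖ₑ * ‖(cuboid a b).indicator g (p - s)‖ₑ) p
  rw [← this]
  simp [mul_comm]

/-- Cauchy–Schwarz on `S` reduces to an `L²` norm along the dilation `y ↦ x + t(y - x)`. In
dimension three its Jacobian contributes `t⁻³` to the squared norm, hence the factor `t^{-3/2}`;
mollification costs nothing since `ρ` has mass one. -/
lemma lintegral_mollify_le {ρ : R3 → ℝ} (hρm : Measurable ρ) (hρ1 : ∫⁻ s, ‖ρ s‖ₑ = 1)
    (g : ScalarL2 a b) (S : Set R3) (x : R3) {t : ℝ} (ht : 0 < t) :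
    ∫⁻ y in S, ‖mollify a b ρ g (x + t • (y - x))‖ₑ ≤
      volume S ^ (1 / 2 : ℝ) * (ENNReal.ofReal (t ^ (-(3 / 2) : ℝ)) * ‖g‖ₑ) := by
  have hgm : Measurable ((cuboid a b).indicator g) :=
    (Lp.stronglyMeasurable g).measurable.indicator (measurableSet_cuboid a b)
  have hg2 : ∫⁻ y, ‖(cuboid a b).indicator g y‖ₑ ^ 2 = ‖g‖ₑ ^ 2 := by
    rw [Lp.enorm_def, eLpNorm_eq_lintegral_rpow_enorm_toReal (by simp) (by simp)]
    rw [← ENNReal.rpow_natCast, ← ENNReal.rpow_mul]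
    simp only [ENNReal.toReal_ofNat, ENNReal.rpow_ofNat]
    norm_num
    rw [← lintegral_indicator (measurableSet_cuboid a b)]
    refine lintegral_congr fun y => ?_
    by_cases hy : y ∈ cuboid a b <;> simp [hy]
  calc ∫⁻ y in S, ‖mollify a b ρ g (x + t • (y - x))‖ₑ
      ≤ ∫⁻ y in S, ∫⁻ s, ‖ρ s‖ₑ * ‖(cuboid a b).indicator g (x + t • (y - x) - s)‖ₑ :=
        lintegral_mono fun y => enorm_mollify_le g _
    _ = ∫⁻ s, ∫⁻ y in S, ‖ρ s‖ₑ * ‖(cuboid a b).indicator g (x + t • (y - x) - s)‖ₑ := by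
        refine lintegral_lintegral_swap (Measurable.aemeasurable ?_)
        exact (hρm.enorm.comp measurable_snd).mul
          (hgm.comp (f := fun p : R3 × R3 => x + t • (p.1 - x) - p.2) (by fun_prop)).enorm
    _ ≤ ∫⁻ s, ‖ρ s‖ₑ *
          (volume S ^ (1 / 2 : ℝ) * (ENNReal.ofReal (t ^ (-(3 / 2) : ℝ)) * ‖g‖ₑ)) := by
        refine lintegral_mono fun s => ?_
        have hm : Measurable fun y => ‖(cuboid a b).indicator g (x + t • (y - x) - s)‖ₑ :=
          (hgm.comp (f := fun y : R3 => x + t • (y - x) - s) (by fun_prop)).enorm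
        rw [lintegral_const_mul _ hm]
        refine mul_le_mul_right ?_ _
        have hcs := ENNReal.lintegral_mul_le_Lp_mul_Lq (volume.restrict S) (Real.HolderConjugate.two_two)
          (f := fun _ => 1) aemeasurable_const hm.aemeasurable
        simp only [Pi.mul_apply, one_mul, ENNReal.one_rpow, lintegral_one,
          Measure.restrict_apply_univ] at hcs
        refine hcs.trans (mul_le_mul_right ?_ _)
        calc (∫⁻ y in S, ‖(cuboid a b).indicator g (x + t • (y - x) - s)‖ₑ ^ (2 : ℝ)) ^ (1 / 2 : ℝ)
            ≤ (∫⁻ y, ‖(cuboid a b).indicator g ((x - t • x - s) + t • y)‖ₑ ^ 2) ^ (1 / 2 : ℝ) := by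
              refine ENNReal.rpow_le_rpow ((setLIntegral_le_lintegral _ _).trans_eq ?_) (by norm_num)
              refine lintegral_congr fun y => ?_
              rw [show x + t • (y - x) - s = (x - t • x - s) + t • y by rw [smul_sub]; abel]
              simp
          _ = (ENNReal.ofReal (t ^ 3)⁻¹ * ‖g‖ₑ ^ 2) ^ (1 / 2 : ℝ) := by
              rw [lintegral_comp_affine (h := fun y => ‖(cuboid a b).indicator g y‖ₑ ^ 2)
                (hgm.enorm.pow_const 2) ht, hg2]
          _ = ENNReal.ofReal (t ^ (-(3 / 2) : ℝ)) * ‖g‖ₑ := by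
              rw [ENNReal.mul_rpow_of_nonneg _ _ (by norm_num),
                ENNReal.ofReal_rpow_of_nonneg (by positivity) (by norm_num)]
              congr 2
              · rw [← Real.rpow_natCast, ← Real.rpow_neg ht.le, ← Real.rpow_mul ht.le]
                norm_num
              · rw [← ENNReal.rpow_natCast, ← ENNReal.rpow_mul]
                norm_num
    _ = _ := by rw [lintegral_mul_const _ hρm.enorm, hρ1, one_mul]

end CuboidSobolev
end

noncomputable section

namespace CuboidSobolev

open scoped Convolution
open ContinuousLinearMap (mul)

variable {a b : Fin 3 → ℝ}

lemma multiDeriv_single (φ : R3 → ℝ) (i : Fin 3) :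
    multiDeriv (Pi.single i 1) φ = partialDeriv i φ := by
  fin_cases i <;> simp [multiDeriv]

lemma multiDeriv_single_add_single {φ : R3 → ℝ} (hφ : ContDiff ℝ (⊤ : ℕ∞) φ) (i j : Fin 3) :
    multiDeriv (Pi.single i 1 + Pi.single j 1) φ = partialDeriv j (partialDeriv i φ) := by
  fin_cases i <;> fin_cases j <;>
    simp [multiDeriv, partialDeriv_comm hφ 1 0, partialDeriv_comm hφ 2 0, partialDeriv_comm hφ 2 1]

lemma zero_mem_multiIndices (k : ℕ) : 0 ∈ multiIndices k := by
  simp [multiIndices]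

lemma mem_multiIndices {α : Fin 3 → ℕ} {k : ℕ} (h : ∑ i, α i ≤ k) : α ∈ multiIndices k := by
  simp only [multiIndices, Finset.mem_filter, Fintype.mem_piFinset, Finset.mem_range]
  exact ⟨fun i => Nat.lt_succ_of_le
    ((Finset.single_le_sum (fun _ _ => Nat.zero_le _) (Finset.mem_univ i)).trans h), h⟩

lemma multiIndices_mono {k l : ℕ} (h : k ≤ l) : multiIndices k ⊆ multiIndices l := by
  intro α hα
  exact mem_multiIndices ((Finset.mem_filter.1 hα).2.trans h)

lemma single_mem_multiIndices (i : Fin 3) : Pi.single i 1 ∈ multiIndices 2 :=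
  mem_multiIndices (by fin_cases i <;> simp)

lemma single_add_single_mem_multiIndices (i j : Fin 3) :
    Pi.single i 1 + Pi.single j 1 ∈ multiIndices 2 :=
  mem_multiIndices (by fin_cases i <;> fin_cases j <;> simp [Fin.sum_univ_three])

/-- The cuboid shrunk by `δ` on every side. -/
def innerCuboid (a b : Fin 3 → ℝ) (δ : ℝ) : Set R3 := cuboid (fun i => a i + δ) fun i => b i - δ

lemma mem_cuboid_of_mem_innerCuboid {δ : ℝ} {x y : R3} (hx : x ∈ innerCuboid a b δ)
    (h : ‖x - y‖ ≤ δ) : y ∈ cuboid a b := by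
  intro i
  have h1 := (abs_apply_le_norm (x - y) i).trans h
  rw [PiLp.sub_apply, abs_le] at h1
  have h2 := hx i
  simp only [Set.mem_Ioo] at h2 ⊢
  constructor <;> linarith

lemma innerCuboid_anti {δ δ' : ℝ} (h : δ ≤ δ') : innerCuboid a b δ' ⊆ innerCuboid a b δ := by
  intro x hx i
  have := hx i
  simp only [Set.mem_Ioo] at this ⊢
  constructor <;> linarith

/-- The constant of the moment integral in Taylor's formula. -/
def taylorMoment : ℝ≥0∞ :=
  ∫⁻ t in Set.Ioc (0 : ℝ) 1, ENNReal.ofReal t * ENNReal.ofReal (t ^ (-(3 / 2) : ℝ))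

/-- The integrand is `t · t^{-3/2} = t^{-1/2}`, integrable at zero. This is where order two of
differentiability suffices in dimension three. -/
lemma taylorMoment_ne_top : taylorMoment ≠ ∞ := by
  have h : IntervalIntegrable (fun t : ℝ => t ^ (-(1 / 2) : ℝ)) volume 0 1 :=
    intervalIntegral.intervalIntegrable_rpow' (by norm_num)
  rw [intervalIntegrable_iff_integrableOn_Ioc_of_le zero_le_one] at h
  have h2 := h.2
  rw [hasFiniteIntegral_iff_enorm] at h2
  refine ne_top_of_le_ne_top h2.ne ?_
  refine setLIntegral_mono_ae' measurableSet_Ioc (Eventually.of_forall fun t ht => ?_)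
  have ht0 : 0 < t := ht.1
  rw [← ENNReal.ofReal_mul ht0.le, Real.enorm_of_nonneg (by positivity)]
  refine ENNReal.ofReal_le_ofReal (le_of_eq ?_)
  conv_lhs => rw [← Real.rpow_one t, ← Real.rpow_mul ht0.le, ← Real.rpow_add ht0]
  norm_num

/-- Taylor's formula from `x` to `y` is averaged over `y` in a fixed inner cuboid. By convexity the
segments stay where derivatives of the mollification are mollified weak derivatives, so only `L²`
norms enter. The bound depends neither on the mollifier nor on `x`; the counts `3` and `9` are those
of first and second partial derivatives. -/
lemma enorm_mollify_mul_volume_le {ρ : R3 → ℝ} (hρ : ContDiff ℝ (⊤ : ℕ∞) ρ)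
    (hρc : HasCompactSupport ρ) (hρ1 : ∫⁻ s, ‖ρ s‖ₑ = 1) {δ δ₀ : ℝ} (hδ : δ ≤ δ₀)
    (hρs : tsupport ρ ⊆ Metric.closedBall 0 δ) {d : ℝ≥0}
    (hd : ∀ x ∈ cuboid a b, ∀ y ∈ cuboid a b, ‖y - x‖ ≤ d) (hδ0 : 0 ≤ δ)
    {f : ScalarL2 a b} {g : (Fin 3 → ℕ) → ScalarL2 a b}
    (hg : ∀ α ∈ multiIndices 2, IsWeakDeriv a b α f (g α)) {N : ℝ≥0∞}
    (hN : ∀ α ∈ multiIndices 2, ‖g α‖ₑ ≤ N) {x : R3} (hx : x ∈ innerCuboid a b δ) :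
    volume (innerCuboid a b δ₀) * ‖mollify a b ρ f x‖ₑ ≤
      volume (innerCuboid a b δ₀) ^ (1 / 2 : ℝ) * (1 + d * 3 + d ^ 2 * 9 * taylorMoment) * N := by
  set F := mollify a b ρ f with hF
  set K := innerCuboid a b δ₀ with hK
  have hKm : MeasurableSet K := measurableSet_cuboid _ _
  have hFs : ContDiff ℝ (⊤ : ℕ∞) F :=
    hρc.contDiff_convolution_right _ (integrable_indicator f).locallyIntegrable hρ
  have hF2 := fun i j => (contDiff_partialDeriv (contDiff_partialDeriv hFs i) j).continuous
  have hF1 := fun i => (contDiff_partialDeriv hFs i).continuous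
  have hsub : ∀ p ∈ innerCuboid a b δ, ∀ t, p - t ∈ tsupport ρ → t ∈ cuboid a b := by
    intro p hp t ht
    refine mem_cuboid_of_mem_innerCuboid hp ?_
    simpa using hρs ht
  have hD : innerCuboid a b δ ⊆ cuboid a b := fun p hp =>
    mem_cuboid_of_mem_innerCuboid hp (by simpa using hδ0)
  have e0 : ∀ p ∈ innerCuboid a b δ, F p = mollify a b ρ (g 0) p := fun p hp =>
    multiDeriv_mollify_eq hρ hρc (hg 0 (zero_mem_multiIndices 2)) (hsub p hp)
  have e1 : ∀ i, ∀ p ∈ innerCuboid a b δ,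
      partialDeriv i F p = mollify a b ρ (g (Pi.single i 1)) p := fun i p hp => by
    rw [← multiDeriv_single]
    exact multiDeriv_mollify_eq hρ hρc (hg _ (single_mem_multiIndices i)) (hsub p hp)
  have e2 : ∀ i j, ∀ p ∈ innerCuboid a b δ, partialDeriv j (partialDeriv i F) p =
      mollify a b ρ (g (Pi.single i 1 + Pi.single j 1)) p := fun i j p hp => by
    rw [← multiDeriv_single_add_single hFs]
    exact multiDeriv_mollify_eq hρ hρc (hg _ (single_add_single_mem_multiIndices i j)) (hsub p hp)
  have hmem : ∀ y ∈ K, ∀ t ∈ Set.Ioc (0 : ℝ) 1, x + t • (y - x) ∈ innerCuboid a b δ := by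
    intro y hy t ht
    exact (convex_cuboid _ _).add_smul_sub_mem hx (innerCuboid_anti hδ hy) ⟨ht.1.le, ht.2⟩
  have bound : ∀ α ∈ multiIndices 2, ∀ t : ℝ, 0 < t →
      ∫⁻ y in K, ‖mollify a b ρ (g α) (x + t • (y - x))‖ₑ ≤
        volume K ^ (1 / 2 : ℝ) * (ENNReal.ofReal (t ^ (-(3 / 2) : ℝ)) * N) := by
    intro α hα t ht
    refine (lintegral_mollify_le hρ.continuous.measurable hρ1 (g α) K x ht).trans ?_
    gcongr
    exact hN α hα
  have bound1 : ∀ α ∈ multiIndices 2,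
      ∫⁻ y in K, ‖mollify a b ρ (g α) y‖ₑ ≤ volume K ^ (1 / 2 : ℝ) * N := by
    intro α hα
    simpa using bound α hα 1 one_pos
  have hy1 : ∀ y ∈ K, y ∈ innerCuboid a b δ := fun y hy => innerCuboid_anti hδ hy
  have b0 : ∫⁻ y in K, ‖F y‖ₑ ≤ volume K ^ (1 / 2 : ℝ) * N := by
    refine (setLIntegral_congr_fun hKm fun y hy => ?_).trans_le (bound1 _ (zero_mem_multiIndices 2))
    simp only [e0 y (hy1 y hy)]
  have b1 : ∀ i, ∫⁻ y in K, ‖partialDeriv i F y‖ₑ ≤ volume K ^ (1 / 2 : ℝ) * N := fun i => by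
    refine (setLIntegral_congr_fun hKm fun y hy => ?_).trans_le (bound1 _ (single_mem_multiIndices i))
    simp only [e1 i y (hy1 y hy)]
  have hm2 : ∀ i j, Measurable fun p : R3 × ℝ =>
      ENNReal.ofReal p.2 * ‖partialDeriv j (partialDeriv i F) (x + p.2 • (p.1 - x))‖ₑ := by
    intro i j
    have := hF2 i j
    exact (ENNReal.measurable_ofReal.comp measurable_snd).mul
      (Continuous.measurable (by fun_prop)).enorm
  have b2 : ∀ i j, ∫⁻ y in K, ∫⁻ t in Set.Ioc (0 : ℝ) 1,
      ENNReal.ofReal t * ‖partialDeriv j (partialDeriv i F) (x + t • (y - x))‖ₑ ≤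
        volume K ^ (1 / 2 : ℝ) * taylorMoment * N := by
    intro i j
    rw [lintegral_lintegral_swap (hm2 i j).aemeasurable]
    have h1 : ∫⁻ t in Set.Ioc (0 : ℝ) 1, ∫⁻ y in K,
        ENNReal.ofReal t * ‖partialDeriv j (partialDeriv i F) (x + t • (y - x))‖ₑ ≤
        ∫⁻ t in Set.Ioc (0 : ℝ) 1, (ENNReal.ofReal t * ENNReal.ofReal (t ^ (-(3 / 2) : ℝ))) *
          (volume K ^ (1 / 2 : ℝ) * N) := by
      refine setLIntegral_mono_ae' measurableSet_Ioc (Eventually.of_forall fun t ht => ?_)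
      have hm : Measurable fun y => ‖partialDeriv j (partialDeriv i F) (x + t • (y - x))‖ₑ := by
        have := hF2 i j
        exact (Continuous.measurable (by fun_prop)).enorm
      rw [lintegral_const_mul _ hm]
      have h2 : ∫⁻ y in K, ‖partialDeriv j (partialDeriv i F) (x + t • (y - x))‖ₑ ≤ _ :=
        (setLIntegral_congr_fun hKm fun y hy => by simp only [e2 i j _ (hmem y hy t ht)]).trans_le
          (bound _ (single_add_single_mem_multiIndices i j) t ht.1)
      exact (mul_le_mul_right h2 _).trans_eq (by ring)
    refine h1.trans_eq ?_
    rw [lintegral_mul_const _ (by fun_prop)]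
    change taylorMoment * _ = _
    ring
  calc volume K * ‖F x‖ₑ = ∫⁻ y in K, ‖F x‖ₑ := by rw [setLIntegral_const, mul_comm]
    _ ≤ ∫⁻ y in K, (‖F y‖ₑ + d * ∑ i, ‖partialDeriv i F y‖ₑ +
      d ^ 2 * ∑ i, ∑ j, ∫⁻ t in Set.Ioc (0 : ℝ) 1,
        ENNReal.ofReal t * ‖partialDeriv j (partialDeriv i F) (x + t • (y - x))‖ₑ) := by
        refine setLIntegral_mono_ae' hKm (Eventually.of_forall fun y hy => ?_)
        simpa using enorm_le_taylor hFs x (y - x) (hd x (hD hx) y (hD (hy1 y hy)))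
    _ = (∫⁻ y in K, ‖F y‖ₑ) + d * ∑ i, (∫⁻ y in K, ‖partialDeriv i F y‖ₑ) +
      d ^ 2 * ∑ i, ∑ j, ∫⁻ y in K, ∫⁻ t in Set.Ioc (0 : ℝ) 1,
        ENNReal.ofReal t * ‖partialDeriv j (partialDeriv i F) (x + t • (y - x))‖ₑ := by
        have m0 : Measurable fun y => ‖F y‖ₑ := hFs.continuous.measurable.enorm
        have m1 : ∀ i, Measurable fun y => ‖partialDeriv i F y‖ₑ := fun i => (hF1 i).measurable.enorm
        have m2 : ∀ i j, Measurable fun y => ∫⁻ t in Set.Ioc (0 : ℝ) 1,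
            ENNReal.ofReal t * ‖partialDeriv j (partialDeriv i F) (x + t • (y - x))‖ₑ :=
          fun i j => (hm2 i j).lintegral_prod_right'
        have m3 := fun i => Finset.measurable_fun_sum Finset.univ fun j _ => m2 i j
        have m4 := Finset.measurable_fun_sum Finset.univ fun i _ => m3 i
        have m5 := Finset.measurable_fun_sum Finset.univ fun i _ => m1 i
        have m6 : Measurable fun y => ‖F y‖ₑ + d * ∑ i, ‖partialDeriv i F y‖ₑ :=
          m0.add (m5.const_mul _)
        rw [lintegral_add_left m6, lintegral_add_left m0,
          lintegral_const_mul _ m5, lintegral_const_mul _ m4, lintegral_finsetSum _ fun i _ => m1 i,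
          lintegral_finsetSum _ fun i _ => m3 i]
        simp_rw [lintegral_finsetSum _ fun j _ => m2 _ j]
    _ ≤ volume K ^ (1 / 2 : ℝ) * N + d * ∑ _i : Fin 3, volume K ^ (1 / 2 : ℝ) * N +
      d ^ 2 * ∑ _i : Fin 3, ∑ _j : Fin 3, volume K ^ (1 / 2 : ℝ) * taylorMoment * N := by
        gcongr with i _ i _ j _
        · exact b1 i
        · exact b2 i j
    _ = _ := by
        simp only [Finset.sum_const, Finset.card_univ, Fintype.card_fin, nsmul_eq_mul]
        push_cast
        ring

lemma exists_mem_innerCuboid {x : R3} (hx : x ∈ cuboid a b) : ∃ δ : ℝ, 0 < δ ∧ x ∈ innerCuboid a b δ := by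
  have h := (isOpen_cuboid a b).mem_nhds hx
  have hpos : ∀ i, 0 < min (x i - a i) (b i - x i) := fun i =>
    lt_min (sub_pos.2 (hx i).1) (sub_pos.2 (hx i).2)
  obtain ⟨j, -, hj⟩ := Finset.exists_min_image Finset.univ
    (fun i => min (x i - a i) (b i - x i)) Finset.univ_nonempty
  refine ⟨min (x j - a j) (b j - x j) / 2, half_pos (hpos j), fun i => ?_⟩
  have h1 := hj i (Finset.mem_univ i)
  have h2 := hpos j
  have h3 := min_le_left (x i - a i) (b i - x i)
  have h4 := min_le_right (x i - a i) (b i - x i)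
  simp only [Set.mem_Ioo]
  constructor <;> linarith

/-- A shrinking sequence of smooth bumps. -/
def bump (n : ℕ) : ContDiffBump (0 : R3) where
  rIn := 1 / (2 * ((n : ℝ) + 1))
  rOut := 1 / ((n : ℝ) + 1)
  rIn_pos := by positivity
  rIn_lt_rOut := by
    refine one_div_lt_one_div_of_lt (by positivity) ?_
    have : (0 : ℝ) < n + 1 := by positivity
    linarith

lemma tendsto_bump_rOut : Tendsto (fun n => (bump n).rOut) atTop (𝓝 0) :=
  tendsto_one_div_add_atTop_nhds_zero_nat

lemma ae_tendsto_mollify (f : ScalarL2 a b) :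
    ∀ᵐ x ∂(vol a b), Tendsto (fun n => mollify a b ((bump n).normed volume) f x) atTop (𝓝 (f x)) := by
  have h := ContDiffBump.ae_convolution_tendsto_right_of_locallyIntegrable (K := 2) (φ := bump)
    tendsto_bump_rOut (Eventually.of_forall fun n => by
      change 1 / ((n : ℝ) + 1) ≤ 2 * (1 / (2 * ((n : ℝ) + 1)))
      field_simp
      rfl) (integrable_indicator f).locallyIntegrable
  filter_upwards [ae_restrict_of_ae h, ae_restrict_mem (measurableSet_cuboid a b)] with x hx hxD
  rw [Set.indicator_of_mem hxD] at hx
  refine hx.congr fun n => ?_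
  unfold mollify
  rw [convolution_eq_swap, convolution_def]
  refine integral_congr_ae (Eventually.of_forall fun t => ?_)
  simp [mul_comm]

/-- The Sobolev embedding `H²(D) ⊆ L^∞(D)`. -/
theorem exists_enorm_le_of_isWeakDeriv (hab : ∀ i, a i < b i) :
    ∃ C : ℝ≥0∞, C ≠ ∞ ∧ ∀ (f : ScalarL2 a b) (g : (Fin 3 → ℕ) → ScalarL2 a b),
      (∀ α ∈ multiIndices 2, IsWeakDeriv a b α f (g α)) → ∀ N : ℝ≥0∞,
      (∀ α ∈ multiIndices 2, ‖g α‖ₑ ≤ N) → ∀ᵐ x ∂(vol a b), ‖f x‖ₑ ≤ C * N := by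
  obtain ⟨x₀, hx₀⟩ : ∃ x₀ : R3, x₀ ∈ cuboid a b :=
    ⟨WithLp.toLp 2 fun i => (a i + b i) / 2, fun i => by
      have := hab i
      simp only [Set.mem_Ioo]
      constructor <;> linarith⟩
  -- The averaging set is fixed once, with positive volume, so that the constant is uniform in `x`
  -- and `f`.
  obtain ⟨δ₀, hδ₀, hx₀'⟩ := exists_mem_innerCuboid hx₀
  set V := volume (innerCuboid a b δ₀) with hV
  have hV0 : V ≠ 0 := ((isOpen_cuboid _ _).measure_pos volume ⟨x₀, hx₀'⟩).ne'
  have hVt : V ≠ ∞ := (volume_cuboid_lt_top _ _).ne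
  obtain ⟨d', hd'⟩ := Metric.isBounded_iff.1 (isBounded_cuboid a b)
  set d : ℝ≥0 := d'.toNNReal
  have hd : ∀ x ∈ cuboid a b, ∀ y ∈ cuboid a b, ‖y - x‖ ≤ d := fun x hx y hy => by
    rw [← dist_eq_norm]
    exact (hd' hy hx).trans (Real.le_coe_toNNReal d')
  set A := V ^ (1 / 2 : ℝ) * (1 + d * 3 + d ^ 2 * 9 * taylorMoment) with hA
  have hAt : A ≠ ∞ := by
    refine ENNReal.mul_ne_top (ENNReal.rpow_ne_top_of_nonneg (by norm_num) hVt) ?_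
    have := taylorMoment_ne_top
    finiteness
  refine ⟨V⁻¹ * A, ENNReal.mul_ne_top (ENNReal.inv_ne_top.2 hV0) hAt, fun f g hg N hN => ?_⟩
  filter_upwards [ae_tendsto_mollify f, ae_restrict_mem (measurableSet_cuboid a b)] with x hx hxD
  obtain ⟨δ, hδ, hxδ⟩ := exists_mem_innerCuboid hxD
  have key : ∀ᶠ n in atTop, V * ‖mollify a b ((bump n).normed volume) f x‖ₑ ≤ A * N := by
    -- The mollification radius must be below both the margin of `x` and that of the averaging set.
    have h1 := tendsto_bump_rOut.eventually (gt_mem_nhds (lt_min hδ hδ₀))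
    filter_upwards [h1] with n hn
    have hρ1 : ∫⁻ s, ‖(bump n).normed volume s‖ₑ = 1 := by
      have h2 := (bump n).integral_normed (μ := (volume : Measure R3))
      have h3 : ∫⁻ s, ‖(bump n).normed volume s‖ₑ =
          ∫⁻ s, ENNReal.ofReal ((bump n).normed volume s) :=
        lintegral_congr fun s => Real.enorm_of_nonneg ((bump n).nonneg_normed s)
      rw [h3, ← ofReal_integral_eq_lintegral_ofReal (bump n).integrable_normed
        (Eventually.of_forall (bump n).nonneg_normed), h2, ENNReal.ofReal_one]
    exact enorm_mollify_mul_volume_le (bump n).contDiff_normed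
      (bump n).hasCompactSupport_normed hρ1 (hn.le.trans (min_le_right _ _))
      (bump n).tsupport_normed_eq.subset hd (bump n).rOut_pos.le hg hN
      (innerCuboid_anti (hn.le.trans (min_le_left _ _)) hxδ)
  have hlim : Tendsto (fun n => V * ‖mollify a b ((bump n).normed volume) f x‖ₑ) atTop
      (𝓝 (V * ‖f x‖ₑ)) :=
    ENNReal.Tendsto.const_mul ((continuous_enorm.tendsto _).comp hx) (Or.inr hVt)
  have h4 := le_of_tendsto hlim key
  calc ‖f x‖ₑ = V⁻¹ * (V * ‖f x‖ₑ) := by rw [← mul_assoc, ENNReal.inv_mul_cancel hV0 hVt, one_mul]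
    _ ≤ V⁻¹ * (A * N) := by gcongr
    _ = _ := by ring

/-- The Sobolev embedding `H^s(D) ⊆ L^∞(D)` for `s ≥ 2`. -/
theorem exists_eLpNorm_le_sobolevENorm (hab : ∀ i, a i < b i) :
    ∃ C : ℝ≥0∞, C ≠ ∞ ∧ ∀ s : ℝ, 2 ≤ s → ∀ f : ScalarL2 a b,
      eLpNorm f ∞ (vol a b) ≤ C * sobolevENorm a b s f := by
  obtain ⟨C, hC, h⟩ := exists_enorm_le_of_isWeakDeriv hab
  -- Adding `1` makes the constant nonzero, so that its square passes through the infimum in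
  -- `sobolevENorm`.
  refine ⟨C + 1, by finiteness, fun s hs f => ?_⟩
  have hs' : 2 ≤ ⌊s⌋₊ := Nat.le_floor (by exact_mod_cast hs)
  have hC0 : (C + 1) ^ 2 ≠ 0 := by simp
  have hCt : (C + 1) ^ 2 ≠ ∞ := by finiteness
  have hsq : ∀ z : ℝ≥0∞, z = (z ^ 2) ^ (1 / 2 : ℝ) := fun z => by
    rw [← ENNReal.rpow_natCast, ← ENNReal.rpow_mul]; simp
  unfold sobolevENorm
  rw [hsq (C + 1), ← ENNReal.mul_rpow_of_nonneg _ _ (by norm_num), hsq (eLpNorm f ∞ (vol a b))]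
  refine ENNReal.rpow_le_rpow ?_ (by norm_num)
  simp_rw [ENNReal.mul_iInf_of_ne hC0 hCt]
  refine le_iInf₂ fun g hg => ?_
  set T := ∑ α ∈ multiIndices ⌊s⌋₊, (‖g α‖ₑ ^ 2 +
        if ∑ i, α i = ⌊s⌋₊ then gagliardoSq a b (s - ⌊s⌋₊) (g α) else 0) with hT
  have hle : ∀ α ∈ multiIndices 2, ‖g α‖ₑ ≤ T ^ (1 / 2 : ℝ) := fun α hα => by
    rw [hsq ‖g α‖ₑ]
    refine ENNReal.rpow_le_rpow (le_trans ?_ (Finset.single_le_sum (fun _ _ => zero_le)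
      (multiIndices_mono hs' hα))) (by norm_num)
    exact le_self_add
  have h1 := h f g (fun α hα => hg α (multiIndices_mono hs' hα)) _ hle
  have h2 : eLpNorm f ∞ (vol a b) ≤ C * T ^ (1 / 2 : ℝ) := by
    rw [eLpNorm_exponent_top]
    exact eLpNormEssSup_le_of_ae_enorm_bound h1
  calc eLpNorm f ∞ (vol a b) ^ 2 ≤ ((C + 1) * T ^ (1 / 2 : ℝ)) ^ 2 := by
        gcongr
        exact h2.trans (by gcongr; exact le_self_add)
    _ = (C + 1) ^ 2 * T := by
        rw [mul_pow, ← ENNReal.rpow_natCast (T ^ (1 / 2 : ℝ)), ← ENNReal.rpow_mul]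
        simp

end CuboidSobolev
end

/-! ### Skew-adjoint block operators and their resolvents. -/

noncomputable section

/-! ### Block operators built from a closed graph and its adjoint -/

namespace GraphOperator

variable {H : Type*} [NormedAddCommGroup H] [InnerProductSpace ℝ H]

/-- A complementary pair of orthogonal projections. -/
structure IsSplitting (p₁ p₂ : H →L[ℝ] H) : Prop where
  add : ∀ u, p₁ u + p₂ u = u
  one_one : ∀ u, p₁ (p₁ u) = p₁ u
  one_two : ∀ u, p₁ (p₂ u) = 0
  two_one : ∀ u, p₂ (p₁ u) = 0
  two_two : ∀ u, p₂ (p₂ u) = p₂ u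
  symm_one : ∀ u v, inner ℝ (p₁ u) v = inner ℝ u (p₁ v)
  symm_two : ∀ u v, inner ℝ (p₂ u) v = inner ℝ u (p₂ v)

/-- The skew-adjoint relation `f = M u` of the graph `G` and its adjoint. -/
def Rel (p₁ p₂ : H →L[ℝ] H) (G : Submodule ℝ H) (u f : H) : Prop :=
  p₁ u - p₂ f ∈ G ∧ p₂ u - p₁ f ∈ Gᗮ

variable {p₁ p₂ : H →L[ℝ] H} {G : Submodule ℝ H}

lemma Rel.sub {u f u' f' : H} (h : Rel p₁ p₂ G u f) (h' : Rel p₁ p₂ G u' f') :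
    Rel p₁ p₂ G (u - u') (f - f') := by
  refine ⟨?_, ?_⟩
  · convert G.sub_mem h.1 h'.1 using 1
    simp only [map_sub]; abel
  · convert Gᗮ.sub_mem h.2 h'.2 using 1
    simp only [map_sub]; abel

/-- Skewness is the orthogonality of the two memberships in `Rel`: the pairing of `p₁ u - p₂ f` with
`p₂ u - p₁ f` expands to `-⟨u, f⟩`. -/
lemma Rel.inner_eq_zero (hs : IsSplitting p₁ p₂) {u f : H} (h : Rel p₁ p₂ G u f) :
    inner ℝ u f = 0 := by
  have h0 : inner ℝ (p₁ u - p₂ f) (p₂ u - p₁ f) = 0 := (Submodule.mem_orthogonal _ _).1 h.2 _ h.1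
  rw [inner_sub_left, inner_sub_right, inner_sub_right, hs.symm_one, hs.symm_one, hs.symm_two,
    hs.symm_two, hs.one_two, hs.one_one, hs.two_two, hs.two_one, inner_zero_right,
    inner_zero_right] at h0
  have h1 : inner ℝ u f = inner ℝ u (p₁ f) + inner ℝ u (p₂ f) := by
    rw [← inner_add_right, hs.add]
  have h2 : inner ℝ f (p₂ u) = inner ℝ u (p₂ f) := by
    rw [← hs.symm_two, real_inner_comm]
  linarith

variable [CompleteSpace H]

/-- The resolvent of the block operator. -/
theorem exists_resolvent (hs : IsSplitting p₁ p₂) (hG : IsClosed (G : Set H)) {τ : ℝ} (hτ : 0 < τ) :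
    ∃ T : H →L[ℝ] H, ‖T‖ ≤ 1 ∧ ∀ g, Rel p₁ p₂ G (T g) (τ⁻¹ • (T g - g)) := by
  -- Solving `u - τ M u = g` is an orthogonal decomposition. Let `K` be the graph with second
  -- component stretched by `τ`, and `p` the projection onto it. The first component of `u` is that
  -- of `p g`, the second that of `g - p g`; membership in `K` and orthogonality to `K` are the two
  -- halves of `Rel`.
  set S : H →L[ℝ] H := p₁ + τ⁻¹ • p₂ with hS
  set K : Submodule ℝ H := G.comap (S : H →ₗ[ℝ] H) with hK
  have hKc : IsClosed (K : Set H) := hG.preimage S.continuous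
  have : CompleteSpace K := hKc.completeSpace_coe
  set p : H →L[ℝ] H := K.starProjection with hp
  set T : H →L[ℝ] H := p₁ ∘L p + p₂ ∘L (ContinuousLinearMap.id ℝ H - p) with hT
  have hTapp : ∀ g, T g = p₁ (p g) + p₂ (g - p g) := fun g => by simp [hT]
  have hrel : ∀ g, Rel p₁ p₂ G (T g) (τ⁻¹ • (T g - g)) := by
    intro g
    have h1 : p₁ (T g) = p₁ (p g) := by rw [hTapp, map_add, hs.one_one, hs.one_two, add_zero]
    have h2 : p₂ (T g) = p₂ (g - p g) := by rw [hTapp, map_add, hs.two_one, hs.two_two, zero_add]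
    have h3 : p₁ (τ⁻¹ • (T g - g)) = -(τ⁻¹ • p₁ (g - p g)) := by
      rw [map_smul, map_sub, h1, map_sub, ← smul_neg, neg_sub]
    have h4 : p₂ (τ⁻¹ • (T g - g)) = -(τ⁻¹ • p₂ (p g)) := by
      rw [map_smul, map_sub, h2, map_sub, ← smul_neg]
      congr 1
      abel
    refine ⟨?_, ?_⟩
    · rw [h1, h4, sub_neg_eq_add]
      have : p g ∈ K := K.starProjection_apply_mem g
      simpa [hK, hS] using this
    · rw [h2, h3, sub_neg_eq_add, Submodule.mem_orthogonal']
      intro w hw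
      have hw' : p₁ w + τ • p₂ w ∈ K := by
        simp only [hK, hS, Submodule.mem_comap, ContinuousLinearMap.coe_coe,
          add_apply, smul_apply, map_add, map_smul,
          hs.one_one, hs.one_two, hs.two_one, hs.two_two, smul_zero, add_zero, zero_add]
        rwa [smul_smul, mul_inv_cancel₀ hτ.ne', one_smul, hs.add]
      have h5 : inner ℝ (g - p g) (p₁ w + τ • p₂ w) = 0 :=
        K.starProjection_inner_eq_zero g _ hw'
      rw [inner_add_right, inner_smul_right, ← hs.symm_one, ← hs.symm_two] at h5
      rw [inner_add_left, real_inner_smul_left]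
      have : inner ℝ (p₁ (g - p g)) w = -(τ * inner ℝ (p₂ (g - p g)) w) := by linarith
      rw [this]
      field_simp
      ring
  refine ⟨T, ContinuousLinearMap.opNorm_le_bound _ zero_le_one fun g => ?_, hrel⟩
  -- Skewness gives `‖T g‖² = ⟨T g, g⟩`, hence `‖T g‖ ≤ ‖g‖`.
  have h0 := (hrel g).inner_eq_zero hs
  rw [real_inner_smul_right, inner_sub_right, real_inner_self_eq_norm_sq] at h0
  have h1 : ‖T g‖ ^ 2 = inner ℝ (T g) g := by
    have := (mul_eq_zero.1 h0).resolve_left (inv_ne_zero hτ.ne')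
    linarith
  rw [one_mul]
  have h2 := real_inner_le_norm (T g) g
  by_contra! hlt
  nlinarith [norm_nonneg g, norm_nonneg (T g)]

end GraphOperator

end

noncomputable section

namespace Maxwell

/-! ### The Maxwell operator as a skew-adjoint block operator. -/

open CuboidSobolev GraphOperator

variable {a b : Fin 3 → ℝ}

/-! ### Pointwise linear maps on electromagnetic fields -/

lemma R6_ext {v w : R6} (h1 : v.fst = w.fst) (h2 : v.snd = w.snd) : v = w :=
  WithLp.ofLp_injective 2 (Prod.ext h1 h2)

/-- The pairing map. -/
def pairMap : R3 × R3 →L[ℝ] R6 := (WithLp.prodContinuousLinearEquiv 2 ℝ R3 R3).symm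

/-- The electric component. -/
def electricMap : R6 →L[ℝ] R6 :=
  pairMap ∘L ContinuousLinearMap.inl ℝ R3 R3 ∘L WithLp.fstL 2 ℝ R3 R3

/-- The magnetic component. -/
def magneticMap : R6 →L[ℝ] R6 :=
  pairMap ∘L ContinuousLinearMap.inr ℝ R3 R3 ∘L WithLp.sndL 2 ℝ R3 R3

/-- The matrix `J` as a continuous linear map. -/
def rotationMap : R6 →L[ℝ] R6 :=
  pairMap ∘L (-WithLp.sndL 2 ℝ R3 R3).prod (WithLp.fstL 2 ℝ R3 R3)

lemma rotationMap_apply (v : R6) : rotationMap v = Jmap v := rfl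

lemma inner_R6 (v w : R6) : inner ℝ v w = inner ℝ v.fst w.fst + inner ℝ v.snd w.snd :=
  WithLp.prod_inner_apply v w

lemma inner_rotationMap (v : R6) : inner ℝ v (rotationMap v) = 0 := by
  rw [inner_R6, rotationMap_apply, Jmap]
  simp [real_inner_comm]

variable (a b) in
/-- The electric part of a field. -/
def electricPart : EMField a b →L[ℝ] EMField a b := electricMap.compLpL 2 (vol a b)

variable (a b) in
/-- The magnetic part of a field. -/
def magneticPart : EMField a b →L[ℝ] EMField a b := magneticMap.compLpL 2 (vol a b)

lemma electricPart_ae (u : EMField a b) :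
    electricPart a b u =ᵐ[vol a b] fun x => WithLp.toLp 2 ((u x).fst, 0) :=
  electricMap.coeFn_compLpL u

lemma magneticPart_ae (u : EMField a b) :
    magneticPart a b u =ᵐ[vol a b] fun x => WithLp.toLp 2 (0, (u x).snd) :=
  magneticMap.coeFn_compLpL u

lemma isSplitting : IsSplitting (electricPart a b) (magneticPart a b) where
  add u := by
    refine Lp.ext ?_
    filter_upwards [Lp.coeFn_add (electricPart a b u) (magneticPart a b u), electricPart_ae u,
      magneticPart_ae u] with x h1 h2 h3
    rw [h1, Pi.add_apply, h2, h3]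
    exact R6_ext (by simp) (by simp)
  one_one u := by
    refine Lp.ext ?_
    filter_upwards [electricPart_ae (electricPart a b u), electricPart_ae u] with x h1 h2
    rw [h1, h2]
    rfl
  one_two u := by
    refine Lp.ext ?_
    filter_upwards [electricPart_ae (magneticPart a b u), magneticPart_ae u,
      Lp.coeFn_zero R6 2 (vol a b)] with x h1 h2 h3
    rw [h1, h2, h3]
    rfl
  two_one u := by
    refine Lp.ext ?_
    filter_upwards [magneticPart_ae (electricPart a b u), electricPart_ae u,
      Lp.coeFn_zero R6 2 (vol a b)] with x h1 h2 h3
    rw [h1, h2, h3]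
    rfl
  two_two u := by
    refine Lp.ext ?_
    filter_upwards [magneticPart_ae (magneticPart a b u), magneticPart_ae u] with x h1 h2
    rw [h1, h2]
    rfl
  symm_one u v := by
    rw [L2.inner_def, L2.inner_def]
    refine integral_congr_ae ?_
    filter_upwards [electricPart_ae u, electricPart_ae v] with x h1 h2
    rw [h1, h2, inner_R6, inner_R6]
    simp
  symm_two u v := by
    rw [L2.inner_def, L2.inner_def]
    refine integral_congr_ae ?_
    filter_upwards [magneticPart_ae u, magneticPart_ae v] with x h1 h2
    rw [h1, h2, inner_R6, inner_R6]
    simp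

/-! ### The graph of the curl -/

lemma partialDeriv_add {φ ψ : R3 → ℝ} (hφ : Differentiable ℝ φ) (hψ : Differentiable ℝ ψ) (i : Fin 3)
    (x : R3) : partialDeriv i (fun y => φ y + ψ y) x = partialDeriv i φ x + partialDeriv i ψ x := by
  unfold partialDeriv
  rw [fderiv_fun_add hφ.differentiableAt hψ.differentiableAt]
  rfl

lemma partialDeriv_const_mul (c : ℝ) (φ : R3 → ℝ) (i : Fin 3) (x : R3) :
    partialDeriv i (fun y => c * φ y) x = c * partialDeriv i φ x := by
  unfold partialDeriv
  have := fderiv_const_smul_field (𝕜 := ℝ) (f := φ) c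
  rw [show (fun y => c * φ y) = c • φ from rfl, this]
  rfl

lemma _root_.StochMaxwell.IsTestFunction.contDiff_coord {φ : R3 → R3} (hφ : IsTestFunction a b φ)
    (j : Fin 3) : ContDiff ℝ (⊤ : ℕ∞) fun y => φ y j :=
  (contDiff_euclidean.1 hφ.1) j

lemma _root_.StochMaxwell.IsTestFunction.differentiable_coord {φ : R3 → R3}
    (hφ : IsTestFunction a b φ) (j : Fin 3) : Differentiable ℝ fun y => φ y j :=
  (hφ.contDiff_coord j).differentiable (by simp)

lemma curl_add {φ ψ : R3 → R3} (hφ : IsTestFunction a b φ) (hψ : IsTestFunction a b ψ) (x : R3) :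
    curl (fun y => φ y + ψ y) x = curl φ x + curl ψ x := by
  have h := fun i j => partialDeriv_add (hφ.differentiable_coord j) (hψ.differentiable_coord j) i x
  ext k
  fin_cases k <;> simp [curl, h] <;> ring

lemma curl_smul (c : ℝ) (φ : R3 → R3) (x : R3) : curl (fun y => c • φ y) x = c • curl φ x := by
  have h := fun i j => partialDeriv_const_mul c (fun y => φ y j) i x
  ext k
  fin_cases k <;> simp [curl, h] <;> ring

lemma _root_.StochMaxwell.IsTestFunction.add {φ ψ : R3 → R3} (hφ : IsTestFunction a b φ)
    (hψ : IsTestFunction a b ψ) : IsTestFunction a b fun x => φ x + ψ x :=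
  ⟨hφ.1.add hψ.1, hφ.2.1.add hψ.2.1, (tsupport_add φ ψ).trans (Set.union_subset hφ.2.2 hψ.2.2)⟩

lemma _root_.StochMaxwell.IsTestFunction.const_smul {φ : R3 → R3} (hφ : IsTestFunction a b φ)
    (c : ℝ) : IsTestFunction a b fun x => c • φ x :=
  ⟨hφ.1.const_smul c, hφ.2.1.smul_left (f := fun _ => c),
    (tsupport_smul_subset_right (fun _ => c) φ).trans hφ.2.2⟩

lemma _root_.StochMaxwell.IsTestFunction.continuous_curl {φ : R3 → R3} (hφ : IsTestFunction a b φ) :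
    Continuous (curl φ) := by
  have h := fun i j => (contDiff_partialDeriv (hφ.contDiff_coord j) i).continuous
  unfold curl
  refine (PiLp.continuous_toLp 2 _).comp (continuous_pi fun k => ?_)
  fin_cases k <;> simp <;> fun_prop

lemma _root_.StochMaxwell.IsTestFunction.hasCompactSupport_curl {φ : R3 → R3}
    (hφ : IsTestFunction a b φ) : HasCompactSupport (curl φ) := by
  refine hφ.2.1.mono' fun x hx => ?_
  by_contra hxs
  refine hx ?_
  have h0 : ∀ i j, partialDeriv i (fun y => φ y j) x = 0 := by
    intro i j
    have h1 : (fun y => φ y j) =ᶠ[𝓝 x] fun _ => 0 := by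
      filter_upwards [notMem_tsupport_iff_eventuallyEq.1 hxs] with y hy
      simp [hy]
    rw [partialDeriv, h1.fderiv_eq]
    simp
  ext k
  fin_cases k <;> simp [curl, h0]

/-- The pair of a test function and its curl. -/
def curlPair (φ : R3 → R3) (x : R3) : R6 := WithLp.toLp 2 (φ x, curl φ x)

lemma memLp_curlPair {φ : R3 → R3} (hφ : IsTestFunction a b φ) : MemLp (curlPair φ) 2 (vol a b) := by
  have hc : Continuous (curlPair φ) :=
    (WithLp.prod_continuous_toLp 2 R3 R3).comp (hφ.1.continuous.prodMk hφ.continuous_curl)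
  refine hc.memLp_of_hasCompactSupport ?_
  refine (hφ.2.1.isCompact.union hφ.hasCompactSupport_curl.isCompact).of_isClosed_subset
    (isClosed_tsupport _) (closure_minimal (fun x hx => ?_)
      ((isClosed_tsupport _).union (isClosed_tsupport _)))
  by_contra hxs
  rw [Set.mem_union, not_or] at hxs
  refine hx ?_
  rw [curlPair, image_eq_zero_of_notMem_tsupport hxs.1, image_eq_zero_of_notMem_tsupport hxs.2]
  rfl

variable (a b) in
/-- The graph of the curl on test functions. -/
def curlGraph : Submodule ℝ (EMField a b) where
  carrier := {w | ∃ φ, IsTestFunction a b φ ∧ w =ᵐ[vol a b] curlPair φ}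
  add_mem' := by
    rintro w w' ⟨φ, hφ, h⟩ ⟨ψ, hψ, h'⟩
    refine ⟨_, hφ.add hψ, ?_⟩
    filter_upwards [Lp.coeFn_add w w', h, h'] with x h1 h2 h3
    rw [h1, Pi.add_apply, h2, h3]
    refine R6_ext rfl ?_
    exact (curl_add hφ hψ x).symm
  zero_mem' := by
    refine ⟨fun _ => 0, ⟨contDiff_const, HasCompactSupport.zero, by simp [tsupport]⟩, ?_⟩
    filter_upwards [Lp.coeFn_zero R6 2 (vol a b)] with x h1
    have h2 := curl_smul 0 (fun _ => 0) x
    simp only [smul_zero, zero_smul] at h2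
    rw [h1, curlPair, h2]
    rfl
  smul_mem' := by
    rintro c w ⟨φ, hφ, h⟩
    refine ⟨_, hφ.const_smul c, ?_⟩
    filter_upwards [Lp.coeFn_smul c w, h] with x h1 h2
    rw [h1, Pi.smul_apply, h2]
    refine R6_ext rfl ?_
    exact (curl_smul c φ x).symm

end Maxwell
end

noncomputable section

namespace Maxwell

open CuboidSobolev GraphOperator

variable {a b : Fin 3 → ℝ}

/-! ### The Maxwell operator as a block operator -/

lemma sub_ae (u f : EMField a b) : electricPart a b u - magneticPart a b f =ᵐ[vol a b]
    fun x => WithLp.toLp 2 ((u x).fst, -(f x).snd) := by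
  filter_upwards [Lp.coeFn_sub (electricPart a b u) (magneticPart a b f), electricPart_ae u,
    magneticPart_ae f] with x h1 h2 h3
  rw [h1, Pi.sub_apply, h2, h3]
  exact R6_ext (by simp) (by simp)

lemma norm_le_fst_add_snd (v : R6) : ‖v‖ ≤ ‖v.fst‖ + ‖v.snd‖ := by
  rw [WithLp.prod_norm_eq_of_L2]
  refine Real.sqrt_le_iff.2 ⟨by positivity, ?_⟩
  nlinarith [norm_nonneg v.fst, norm_nonneg v.snd]

lemma norm_fst_le (v : R6) : ‖v.fst‖ ≤ ‖v‖ := by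
  rw [WithLp.prod_norm_eq_of_L2]
  exact Real.le_sqrt_of_sq_le (by nlinarith [norm_nonneg v.snd])

lemma norm_snd_le (v : R6) : ‖v.snd‖ ≤ ‖v‖ := by
  rw [WithLp.prod_norm_eq_of_L2]
  exact Real.le_sqrt_of_sq_le (by nlinarith [norm_nonneg v.fst])

lemma hasWeakCurlZero_iff (u f : EMField a b) :
    HasWeakCurlZero a b (fun x => (u x).fst) (fun x => -(f x).snd) ↔
      electricPart a b u - magneticPart a b f ∈ (curlGraph a b).topologicalClosure := by
  rw [← SetLike.mem_coe, Submodule.topologicalClosure_coe, Metric.mem_closure_iff]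
  have hms : ∀ φ : R3 → R3, IsTestFunction a b φ →
      AEStronglyMeasurable (fun x => (u x).fst - φ x) (vol a b) ∧
      AEStronglyMeasurable (fun x => -(f x).snd - curl φ x) (vol a b) := by
    intro φ hφ
    have h1 : AEStronglyMeasurable (fun x => (u x).fst) (vol a b) :=
      (WithLp.fstL 2 ℝ R3 R3).continuous.comp_aestronglyMeasurable (Lp.aestronglyMeasurable u)
    have h2 : AEStronglyMeasurable (fun x => (f x).snd) (vol a b) :=
      (WithLp.sndL 2 ℝ R3 R3).continuous.comp_aestronglyMeasurable (Lp.aestronglyMeasurable f)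
    exact ⟨h1.sub hφ.1.continuous.aestronglyMeasurable,
      h2.neg.sub hφ.continuous_curl.aestronglyMeasurable⟩
  constructor
  · intro h ε hε
    -- Two components with error `ε / 3` each leave room for the strict inequality `2ε/3 < ε`.
    obtain ⟨φ, hφ, h1, h2⟩ := h (ε / 3) (by positivity)
    set w' : EMField a b := (memLp_curlPair hφ).toLp with hw'
    have hw'ae : w' =ᵐ[vol a b] curlPair φ := (memLp_curlPair hφ).coeFn_toLp
    refine ⟨w', ⟨φ, hφ, hw'ae⟩, ?_⟩
    rw [Lp.dist_def]
    have hae := sub_ae u f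
    generalize electricPart a b u - magneticPart a b f = w at hae ⊢
    have h3 : eLpNorm (⇑w - ⇑w') 2 (vol a b) ≤
        ENNReal.ofReal (2 * (ε / 3)) := by
      calc _ ≤ eLpNorm (fun x => ‖(u x).fst - φ x‖ + ‖-(f x).snd - curl φ x‖) 2 (vol a b) := by
            refine eLpNorm_mono_ae_real ?_
            filter_upwards [hae, hw'ae] with x h3 h4
            rw [Pi.sub_apply, h3, h4]
            exact norm_le_fst_add_snd _
        _ ≤ eLpNorm (fun x => ‖(u x).fst - φ x‖) 2 (vol a b) +
              eLpNorm (fun x => ‖-(f x).snd - curl φ x‖) 2 (vol a b) :=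
            eLpNorm_add_le (hms φ hφ).1.norm (hms φ hφ).2.norm (by norm_num)
        _ ≤ ENNReal.ofReal (ε / 3) + ENNReal.ofReal (ε / 3) := by
            rw [eLpNorm_norm, eLpNorm_norm]
            exact add_le_add h1 h2
        _ = _ := by rw [← ENNReal.ofReal_add (by positivity) (by positivity)]; ring_nf
    calc _ ≤ 2 * (ε / 3) := ENNReal.toReal_le_of_le_ofReal (by positivity) h3
      _ < ε := by linarith
  · intro h ε hε
    have hae := sub_ae u f
    generalize electricPart a b u - magneticPart a b f = w at h hae
    obtain ⟨w', ⟨φ, hφ, hw'⟩, hd⟩ := h ε hε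
    rw [Lp.dist_def] at hd
    have hfin : eLpNorm (⇑w - ⇑w') 2 (vol a b) ≠ ∞ :=
      ((Lp.memLp w).sub (Lp.memLp w')).eLpNorm_ne_top
    have hd' := ((ENNReal.lt_ofReal_iff_toReal_lt hfin).2 hd).le
    refine ⟨φ, hφ, le_trans (eLpNorm_mono_ae ?_) hd', le_trans (eLpNorm_mono_ae ?_) hd'⟩
    · filter_upwards [hae, hw'] with x h3 h4
      rw [Pi.sub_apply, h3, h4]
      exact norm_fst_le (WithLp.toLp 2 ((u x).fst, -(f x).snd) - curlPair φ x : R6)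
    · filter_upwards [hae, hw'] with x h3 h4
      rw [Pi.sub_apply, h3, h4]
      exact norm_snd_le (WithLp.toLp 2 ((u x).fst, -(f x).snd) - curlPair φ x : R6)

lemma inner_magneticPart {φ : R3 → R3} {w : EMField a b} (hw : w =ᵐ[vol a b] curlPair φ)
    (u : EMField a b) :
    inner ℝ w (magneticPart a b u) = ∫ x, inner ℝ (u x).snd (curl φ x) ∂(vol a b) := by
  rw [L2.inner_def]
  refine integral_congr_ae ?_
  filter_upwards [hw, magneticPart_ae u] with x h1 h2
  rw [h1, h2, inner_R6, curlPair]
  simp [real_inner_comm]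

lemma inner_electricPart {φ : R3 → R3} {w : EMField a b} (hw : w =ᵐ[vol a b] curlPair φ)
    (u : EMField a b) :
    inner ℝ w (electricPart a b u) = ∫ x, inner ℝ (u x).fst (φ x) ∂(vol a b) := by
  rw [L2.inner_def]
  refine integral_congr_ae ?_
  filter_upwards [hw, electricPart_ae u] with x h1 h2
  rw [h1, h2, inner_R6, curlPair]
  simp [real_inner_comm]

/-- Testing against all pairs `(φ, ∇ × φ)` is orthogonality to the graph, hence to its closure. The
curl on `H(curl)` thus appears as the adjoint of the curl on `H₀(curl)`. -/
lemma hasWeakCurl_iff (u f : EMField a b) :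
    HasWeakCurl a b (fun x => (u x).snd) (fun x => (f x).fst) ↔
      magneticPart a b u - electricPart a b f ∈ (curlGraph a b).topologicalClosureᗮ := by
  rw [Submodule.orthogonal_closure, Submodule.mem_orthogonal]
  constructor
  · rintro h w ⟨φ, hφ, hw⟩
    rw [inner_sub_right, inner_magneticPart hw, inner_electricPart hw, sub_eq_zero]
    exact h φ hφ
  · intro h φ hφ
    have hw := (memLp_curlPair hφ).coeFn_toLp
    have h0 := h _ ⟨φ, hφ, hw⟩
    rw [inner_sub_right, inner_magneticPart hw, inner_electricPart hw, sub_eq_zero] at h0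
    exact h0

lemma maxwellEq_iff (u f : EMField a b) : MaxwellEq a b u f ↔
    Rel (electricPart a b) (magneticPart a b) (curlGraph a b).topologicalClosure u f :=
  and_congr (hasWeakCurlZero_iff u f) (hasWeakCurl_iff u f)

lemma _root_.StochMaxwell.MaxwellEq.sub {u f u' f' : EMField a b} (h : MaxwellEq a b u f)
    (h' : MaxwellEq a b u' f') : MaxwellEq a b (u - u') (f - f') := by
  rw [maxwellEq_iff] at *
  exact h.sub h'

lemma _root_.StochMaxwell.MaxwellEq.inner_eq_zero {u f : EMField a b} (h : MaxwellEq a b u f) :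
    inner ℝ u f = 0 :=
  ((maxwellEq_iff u f).1 h).inner_eq_zero isSplitting

variable (a b) in
theorem exists_maxwell_resolvent {τ : ℝ} (hτ : 0 < τ) : ∃ T : EMField a b →L[ℝ] EMField a b,
    ‖T‖ ≤ 1 ∧ ∀ g, MaxwellEq a b (T g) (τ⁻¹ • (T g - g)) := by
  obtain ⟨T, hT, h⟩ := exists_resolvent (isSplitting (a := a) (b := b))
    (curlGraph a b).isClosed_topologicalClosure hτ
  exact ⟨T, hT, fun g => (maxwellEq_iff _ _).2 (h g)⟩

end Maxwell
end

noncomputable section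

/-! ### Solvability and stability of one midpoint step. -/

namespace MidpointStep

open CuboidSobolev Maxwell

variable {a b : Fin 3 → ℝ}

/-! ### Multiplication operators -/

variable (a b) in
/-- Multiplication of a field by an essentially bounded function. -/
def mulField : Lp ℝ ∞ (vol a b) →L[ℝ] EMField a b →L[ℝ] EMField a b :=
  (ContinuousLinearMap.lsmul ℝ ℝ : ℝ →L[ℝ] R6 →L[ℝ] R6).holderL (vol a b) ∞ 2 2

lemma mulField_ae (w : Lp ℝ ∞ (vol a b)) (u : EMField a b) :
    mulField a b w u =ᵐ[vol a b] fun x => w x • u x :=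
  (ContinuousLinearMap.lsmul ℝ ℝ : ℝ →L[ℝ] R6 →L[ℝ] R6).coeFn_holder w u

variable (a b) in
/-- Rotation of a field by the matrix `J`. -/
def rotateField : EMField a b →L[ℝ] EMField a b := rotationMap.compLpL 2 (vol a b)

lemma rotateField_ae (u : EMField a b) : rotateField a b u =ᵐ[vol a b] fun x => Jmap (u x) :=
  rotationMap.coeFn_compLpL u

variable (a b) in
/-- The multiplicative noise operator `u ↦ lam₁ w J u`. -/
def noiseOp (lam₁ : ℝ) (w : Lp ℝ ∞ (vol a b)) : EMField a b →L[ℝ] EMField a b :=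
  lam₁ • (mulField a b w ∘L rotateField a b)

lemma noiseOp_ae (lam₁ : ℝ) (w : Lp ℝ ∞ (vol a b)) (u : EMField a b) :
    noiseOp a b lam₁ w u =ᵐ[vol a b] fun x => (lam₁ * w x) • Jmap (u x) := by
  have h : noiseOp a b lam₁ w u = lam₁ • mulField a b w (rotateField a b u) := rfl
  rw [h]
  filter_upwards [Lp.coeFn_smul lam₁ (mulField a b w (rotateField a b u)),
    mulField_ae w (rotateField a b u), rotateField_ae u] with x h1 h2 h3
  rw [h1, Pi.smul_apply, h2, h3, smul_smul]

lemma inner_noiseOp (lam₁ : ℝ) (w : Lp ℝ ∞ (vol a b)) (u : EMField a b) :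
    inner ℝ u (noiseOp a b lam₁ w u) = 0 := by
  rw [L2.inner_def]
  refine (integral_congr_ae ?_).trans (integral_zero _ _)
  filter_upwards [noiseOp_ae lam₁ w u] with x h1
  rw [h1, real_inner_smul_right, ← rotationMap_apply, inner_rotationMap, mul_zero]

lemma noiseOp_sub (lam₁ : ℝ) (w : Lp ℝ ∞ (vol a b)) (u v : EMField a b) :
    noiseOp a b lam₁ w (u - v) = noiseOp a b lam₁ w u - noiseOp a b lam₁ w v := map_sub _ _ _

lemma exists_norm_noiseOp_le (lam₁ : ℝ) : ∃ K : ℝ, 0 ≤ K ∧ ∀ w : Lp ℝ ∞ (vol a b),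
    ‖noiseOp a b lam₁ w‖ ≤ K * ‖w‖ := by
  refine ⟨|lam₁| * (‖mulField a b‖ * ‖rotateField a b‖), by positivity, fun w => ?_⟩
  calc ‖noiseOp a b lam₁ w‖ ≤ |lam₁| * (‖mulField a b w‖ * ‖rotateField a b‖) := by
        rw [noiseOp, norm_smul, Real.norm_eq_abs]
        gcongr
        exact ContinuousLinearMap.opNorm_comp_le _ _
    _ ≤ |lam₁| * (‖mulField a b‖ * ‖w‖ * ‖rotateField a b‖) := by
        gcongr
        exact (mulField a b).le_opNorm w
    _ = _ := by ring

lemma continuous_noiseOp (lam₁ : ℝ) : Continuous (noiseOp a b lam₁) := by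
  unfold noiseOp
  fun_prop

variable (a b) in
/-- The additive noise field `w (lam₂, lam₂)`. -/
def noiseField (lam₂ : R3) : ScalarL2 a b →L[ℝ] EMField a b :=
  ((ContinuousLinearMap.lsmul ℝ ℝ : ℝ →L[ℝ] R6 →L[ℝ] R6).flip (WithLp.toLp 2 (lam₂, lam₂))).compLpL 2 (vol a b)

lemma noiseField_ae (lam₂ : R3) (w : ScalarL2 a b) :
    noiseField a b lam₂ w =ᵐ[vol a b] fun x => w x • (WithLp.toLp 2 (lam₂, lam₂) : R6) :=
  ((ContinuousLinearMap.lsmul ℝ ℝ : ℝ →L[ℝ] R6 →L[ℝ] R6).flip (WithLp.toLp 2 (lam₂, lam₂))).coeFn_compLpL w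

/-! ### The damping operator -/

lemma exists_damping {σ : R3 → ℝ} (hσ : MemW1Infty a b σ) {σ₀ : ℝ}
    (hσσ₀ : ∀ᵐ x ∂(vol a b), σ₀ ≤ σ x) (Δt : ℝ≥0) :
    ∃ E : EMField a b →L[ℝ] EMField a b,
      (∀ u, E u =ᵐ[vol a b] fun x => Real.exp (-(σ x * Δt)) • u x) ∧
      ∀ u, ‖E u‖ ≤ Real.exp (-σ₀ * Δt) * ‖u‖ := by
  have hle : ∀ᵐ x ∂(vol a b), ‖Real.exp (-(σ x * Δt))‖ ≤ Real.exp (-σ₀ * Δt) := by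
    filter_upwards [hσσ₀] with x hx
    rw [Real.norm_eq_abs, Real.abs_exp, Real.exp_le_exp]
    nlinarith [Δt.2, mul_le_mul_of_nonneg_right hx Δt.2]
  have hm : AEStronglyMeasurable (fun x => Real.exp (-(σ x * Δt))) (vol a b) :=
    Real.continuous_exp.comp_aestronglyMeasurable (hσ.1.1.mul_const (Δt : ℝ)).neg
  have hLp : MemLp (fun x => Real.exp (-(σ x * Δt))) ∞ (vol a b) := memLp_top_of_bound hm _ hle
  have hE : ∀ u, mulField a b hLp.toLp u =ᵐ[vol a b] fun x => Real.exp (-(σ x * Δt)) • u x := by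
    intro u
    filter_upwards [mulField_ae hLp.toLp u, hLp.coeFn_toLp] with x h1 h2
    rw [h1, h2]
  refine ⟨mulField a b hLp.toLp, hE, fun u => Lp.norm_le_mul_norm_of_ae_le_mul ?_⟩
  filter_upwards [hE u, hle] with x h1 h2
  rw [h1, norm_smul]
  gcongr

/-! ### Existence and stability of one step -/

variable {σ : R3 → ℝ} {lam₁ : ℝ} {lam₂ : R3} {Δt : ℝ≥0} {E T : EMField a b →L[ℝ] EMField a b}

lemma isStep_iff (hE : ∀ u, E u =ᵐ[vol a b] fun x => Real.exp (-(σ x * Δt)) • u x)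
    {w : Lp ℝ ∞ (vol a b)} {w₁ w₂ : ScalarL2 a b} (hw : w₁ =ᵐ[vol a b] w) (u u' : EMField a b) :
    IsStep a b σ lam₁ lam₂ Δt w₁ w₂ u u' ↔ ∃ v f : EMField a b, v = (1 / 2 : ℝ) • (u' + E u) ∧
      MaxwellEq a b v f ∧
      u' - E u = (Δt : ℝ) • f + noiseOp a b lam₁ w v + noiseField a b lam₂ w₂ := by
  refine exists_congr fun v => exists_congr fun f => and_congr ?_ (and_congr Iff.rfl ?_)
  · rw [Lp.ext_iff]
    have h : ((1 / 2 : ℝ) • (u' + E u) : EMField a b) =ᵐ[vol a b]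
        fun x => (1 / 2 : ℝ) • (u' x + Real.exp (-(σ x * Δt)) • u x) := by
      filter_upwards [Lp.coeFn_smul (1 / 2 : ℝ) (u' + E u), Lp.coeFn_add u' (E u), hE u]
        with x h1 h2 h3
      rw [h1, Pi.smul_apply, h2, Pi.add_apply, h3]
    exact ⟨fun hv => EventuallyEq.trans hv h.symm, fun hv => hv.trans h⟩
  · rw [Lp.ext_iff]
    have hl : (u' - E u : EMField a b) =ᵐ[vol a b]
        fun x => u' x - Real.exp (-(σ x * Δt)) • u x := by
      filter_upwards [Lp.coeFn_sub u' (E u), hE u] with x h2 h3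
      rw [h2, Pi.sub_apply, h3]
    have hr : ((Δt : ℝ) • f + noiseOp a b lam₁ w v + noiseField a b lam₂ w₂ : EMField a b)
        =ᵐ[vol a b] fun x => (Δt : ℝ) • f x + (lam₁ * w₁ x) • Jmap (v x) +
          w₂ x • WithLp.toLp 2 (lam₂, lam₂) := by
      filter_upwards [Lp.coeFn_add ((Δt : ℝ) • f + noiseOp a b lam₁ w v) (noiseField a b lam₂ w₂),
        Lp.coeFn_add ((Δt : ℝ) • f) (noiseOp a b lam₁ w v), Lp.coeFn_smul (Δt : ℝ) f,
        noiseOp_ae lam₁ w v, noiseField_ae lam₂ w₂, hw] with x h1 h2 h3 h4 h5 h6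
      rw [h1, Pi.add_apply, h2, Pi.add_apply, h3, Pi.smul_apply, h4, h5, h6]
    exact ⟨fun h => hl.trans (EventuallyEq.trans h hr.symm),
      fun h => hl.symm.trans (EventuallyEq.trans h hr)⟩

/-- The contraction mechanism. The increment of the difference is orthogonal to its midpoint, since
the Maxwell and rotation terms are skew and the additive noise has cancelled. Applied to `u = y` it
also gives uniqueness of the step. -/
lemma norm_sub_eq_of_isStep (hE : ∀ u, E u =ᵐ[vol a b] fun x => Real.exp (-(σ x * Δt)) • u x)
    {w : Lp ℝ ∞ (vol a b)} {w₁ w₂ : ScalarL2 a b} (hw : w₁ =ᵐ[vol a b] w) {u u' y y' : EMField a b}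
    (hu : IsStep a b σ lam₁ lam₂ Δt w₁ w₂ u u') (hy : IsStep a b σ lam₁ lam₂ Δt w₁ w₂ y y') :
    ‖u' - y'‖ = ‖E (u - y)‖ := by
  obtain ⟨v, f, hv, hvf, hu⟩ := (isStep_iff hE hw u u').1 hu
  obtain ⟨v', f', hv', hvf', hy⟩ := (isStep_iff hE hw y y').1 hy
  set d := E (u - y)
  have hz : v - v' = (1 / 2 : ℝ) • ((u' - y') + d) := by
    rw [hv, hv', ← smul_sub, show d = E u - E y from map_sub E u y]
    congr 1
    abel
  have hd : (u' - y') - d = (Δt : ℝ) • (f - f') + noiseOp a b lam₁ w (v - v') := by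
    rw [show d = E u - E y from map_sub E u y,
      show u' - y' - (E u - E y) = (u' - E u) - (y' - E y) by abel, hu, hy, noiseOp_sub, smul_sub]
    abel
  have h0 : inner ℝ (v - v') ((u' - y') - d) = 0 := by
    rw [hd, inner_add_right, real_inner_smul_right, (hvf.sub hvf').inner_eq_zero, inner_noiseOp,
      mul_zero, add_zero]
  rw [hz, real_inner_smul_left] at h0
  have h1 := (mul_eq_zero.1 h0).resolve_left (by norm_num)
  exact (real_inner_add_sub_eq_zero_iff _ _).1 h1

variable (lam₁ lam₂ E T) in
/-- The map performing one step of the midpoint method. -/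
def stepMap (w : Lp ℝ ∞ (vol a b)) (w₂ : ScalarL2 a b) (u : EMField a b) : EMField a b :=
  (2 : ℝ) • (∑' n : ℕ, ((1 / 2 : ℝ) • (T ∘L noiseOp a b lam₁ w)) ^ n)
    (T (E u + (1 / 2 : ℝ) • noiseField a b lam₂ w₂)) - E u

/-- Substituting `u' = 2v - E u` turns the scheme into a resolvent equation for the midpoint with
parameter `Δt / 2`, and then into `(1 - N) v = T (E u + ½ noise)`, solved by a Neumann series. -/
lemma isStep_stepMap (hE : ∀ u, E u =ᵐ[vol a b] fun x => Real.exp (-(σ x * Δt)) • u x)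
    (hΔt : 0 < Δt) (hT : ∀ g, MaxwellEq a b (T g) ((Δt / 2 : ℝ)⁻¹ • (T g - g)))
    {w : Lp ℝ ∞ (vol a b)} {w₁ w₂ : ScalarL2 a b} (hw : w₁ =ᵐ[vol a b] w)
    (hn : ‖(1 / 2 : ℝ) • (T ∘L noiseOp a b lam₁ w)‖ < 1) (u : EMField a b) :
    IsStep a b σ lam₁ lam₂ Δt w₁ w₂ u (stepMap lam₁ lam₂ E T w w₂ u) := by
  rw [isStep_iff hE hw]
  set N := (1 / 2 : ℝ) • (T ∘L noiseOp a b lam₁ w) with hN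
  set v := (∑' n : ℕ, N ^ n) (T (E u + (1 / 2 : ℝ) • noiseField a b lam₂ w₂)) with hv
  have hs : stepMap lam₁ lam₂ E T w w₂ u = (2 : ℝ) • v - E u := rfl
  have h1 : v - N v = T (E u + (1 / 2 : ℝ) • noiseField a b lam₂ w₂) := by
    have := DFunLike.congr_fun (mul_neg_geom_series N hn)
      (T (E u + (1 / 2 : ℝ) • noiseField a b lam₂ w₂))
    exact this
  set g := E u + (1 / 2 : ℝ) • noiseField a b lam₂ w₂ + (1 / 2 : ℝ) • noiseOp a b lam₁ w v with hg
  have h2 : v = T g := by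
    rw [hg, map_add, ← h1, map_smul]
    exact (sub_add_cancel _ _).symm
  refine ⟨v, (Δt / 2 : ℝ)⁻¹ • (v - g), ?_, ?_, ?_⟩
  · rw [hs, sub_add_cancel, smul_smul]; norm_num
  · rw [h2]
    convert hT g using 3
  · have h3 : (Δt : ℝ) ≠ 0 := by exact_mod_cast hΔt.ne'
    rw [hs, smul_smul, show (Δt : ℝ) * (Δt / 2 : ℝ)⁻¹ = 2 by field_simp, hg]
    module

end MidpointStep
end

noncomputable section

/-! ### Gaussian and truncated noise series. -/

namespace NoiseSeries

/-! ### Gaussian series in a Hilbert space -/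

section Orthonormal

variable {H : Type*} [NormedAddCommGroup H] [InnerProductSpace ℝ H]

lemma norm_sq_sum_smul {v : ℕ → H} (hv : Orthonormal ℝ v) (c : ℕ → ℝ) (s : Finset ℕ) :
    ‖∑ k ∈ s, c k • v k‖ ^ 2 = ∑ k ∈ s, c k ^ 2 := by
  simpa using hv.orthogonalFamily.norm_sum c s

lemma summable_smul_iff [CompleteSpace H] {v : ℕ → H} (hv : Orthonormal ℝ v) (c : ℕ → ℝ) :
    (Summable fun k => c k • v k) ↔ Summable fun k => c k ^ 2 := by
  simpa using hv.orthogonalFamily.summable_iff_norm_sq_summable c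

lemma sq_enorm_le_tsum {v : ℕ → H} (hv : Orthonormal ℝ v) {c : ℕ → ℝ} {w : H}
    (h : Tendsto (fun N => ∑ k ∈ Finset.range N, c k • v k) atTop (𝓝 w)) :
    ‖w‖ₑ ^ 2 ≤ ∑' k, ‖c k‖ₑ ^ 2 := by
  refine le_of_tendsto (((ENNReal.continuous_pow 2).comp continuous_enorm).tendsto w |>.comp h) (.of_forall fun N => ?_)
  refine le_trans (le_of_eq ?_) (ENNReal.sum_le_tsum (Finset.range N))
  simp only [Function.comp_apply]
  rw [← ofReal_norm, ← ENNReal.ofReal_pow (norm_nonneg _), norm_sq_sum_smul hv,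
    ENNReal.ofReal_sum_of_nonneg fun _ _ => sq_nonneg _]
  refine Finset.sum_congr rfl fun k _ => ?_
  rw [← ofReal_norm, ← ENNReal.ofReal_pow (norm_nonneg _), Real.norm_eq_abs, sq_abs]

/-- The sum of the series `∑ √ηₖ zₖ vₖ`, as a limit of partial sums. -/
def gaussianSeries [Nonempty H] (v : ℕ → H) (η : ℕ → ℝ) (z : ℕ → ℝ) : H :=
  limUnder atTop fun N => ∑ k ∈ Finset.range N, (√(η k) * z k) • v k

/-- A limit along partial sums is measurable on the whole sequence space, with no reference to the
set where the series converges. -/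
lemma stronglyMeasurable_gaussianSeries [CompleteSpace H]
    (v : ℕ → H) (η : ℕ → ℝ) : StronglyMeasurable (gaussianSeries v η) := by
  refine StronglyMeasurable.limUnder fun N => ?_
  refine Finset.stronglyMeasurable_fun_sum _ fun k _ => ?_
  exact ((measurable_pi_apply k).const_mul _).stronglyMeasurable.smul_const _

lemma gaussianSeries_eq_tsum {v : ℕ → H} {η z : ℕ → ℝ}
    (h : Summable fun k => (√(η k) * z k) • v k) :
    gaussianSeries v η z = ∑' k, (√(η k) * z k) • v k :=
  h.hasSum.tendsto_sum_nat.limUnder_eq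

end Orthonormal

section Gaussian

variable {Ω : Type*} {mΩ : MeasurableSpace Ω} {P : Measure Ω} {X : ℕ → Ω → ℝ} {t : ℝ≥0} {η : ℕ → ℝ}

lemma lintegral_sq_gaussianReal_ne_top (t : ℝ≥0) : ∫⁻ x, ‖x‖ₑ ^ 2 ∂(gaussianReal 0 t) ≠ ∞ := by
  have h := (memLp_id_gaussianReal (μ := 0) (v := t) 2).eLpNorm_lt_top
  rw [eLpNorm_lt_top_iff_lintegral_rpow_enorm_lt_top (by norm_num) (by norm_num)] at h
  simpa using h.ne

/-- Only the common second moment enters; independence of the coordinates plays no role. -/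
lemma lintegral_tsum_ne_top (hX : ∀ k, HasLaw (X k) (gaussianReal 0 t) P) (hη0 : ∀ k, 0 ≤ η k)
    (hη : Summable η) : ∫⁻ ω, ∑' k, ‖√(η k) * X k ω‖ₑ ^ 2 ∂P ≠ ∞ := by
  have hm : ∀ k, AEMeasurable (fun ω => ‖√(η k) * X k ω‖ₑ ^ 2) P := fun k =>
    ((hX k).aemeasurable.const_mul _).enorm.pow_const 2
  rw [lintegral_tsum hm]
  have h : ∀ k, ∫⁻ ω, ‖√(η k) * X k ω‖ₑ ^ 2 ∂P =
      ENNReal.ofReal (η k) * ∫⁻ x, ‖x‖ₑ ^ 2 ∂(gaussianReal 0 t) := by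
    intro k
    rw [← (hX k).map_eq, lintegral_map' (by fun_prop) (hX k).aemeasurable,
      ← lintegral_const_mul'' _ ((hX k).aemeasurable.enorm.pow_const 2)]
    refine lintegral_congr fun ω => ?_
    rw [enorm_mul, mul_pow, ← ofReal_norm (√(η k)), ← ENNReal.ofReal_pow (norm_nonneg _),
      Real.norm_eq_abs, sq_abs, Real.sq_sqrt (hη0 k)]
  simp_rw [h]
  rw [ENNReal.tsum_mul_right]
  exact ENNReal.mul_ne_top hη.tsum_ofReal_ne_top (lintegral_sq_gaussianReal_ne_top t)

lemma ae_summable_sq (hX : ∀ k, HasLaw (X k) (gaussianReal 0 t) P) (hη0 : ∀ k, 0 ≤ η k)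
    (hη : Summable η) : ∀ᵐ ω ∂P, Summable fun k => (√(η k) * X k ω) ^ 2 := by
  have hm : AEMeasurable (fun ω => ∑' k, ‖√(η k) * X k ω‖ₑ ^ 2) P :=
    AEMeasurable.tsum fun k => ((hX k).aemeasurable.const_mul _).enorm.pow_const 2
  filter_upwards [ae_lt_top' hm (lintegral_tsum_ne_top hX hη0 hη)] with ω hω
  have := ENNReal.summable_toReal hω.ne
  refine this.congr fun k => ?_
  rw [ENNReal.toReal_pow, toReal_enorm, Real.norm_eq_abs, sq_abs]

lemma ae_summable_smul {H : Type*} [NormedAddCommGroup H] [InnerProductSpace ℝ H] [CompleteSpace H]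
    {v : ℕ → H} (hv : Orthonormal ℝ v)
    (hX : ∀ k, HasLaw (X k) (gaussianReal 0 t) P) (hη0 : ∀ k, 0 ≤ η k)
    (hη : Summable η) : ∀ᵐ ω ∂P, Summable fun k => (√(η k) * X k ω) • v k := by
  filter_upwards [ae_summable_sq hX hη0 hη] with ω hω
  exact (summable_smul_iff hv _).2 hω

lemma lintegral_sq_gaussianSeries_ne_top {H : Type*} [NormedAddCommGroup H] [InnerProductSpace ℝ H]
    [CompleteSpace H] {v : ℕ → H} (hv : Orthonormal ℝ v)
    (hX : ∀ k, HasLaw (X k) (gaussianReal 0 t) P) (hη0 : ∀ k, 0 ≤ η k)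
    (hη : Summable η) : ∫⁻ ω, ‖gaussianSeries v η fun k => X k ω‖ₑ ^ 2 ∂P ≠ ∞ := by
  refine ne_top_of_le_ne_top (lintegral_tsum_ne_top hX hη0 hη) (lintegral_mono_ae ?_)
  filter_upwards [ae_summable_smul hv hX hη0 hη] with ω hω
  rw [gaussianSeries_eq_tsum hω]
  exact sq_enorm_le_tsum hv hω.hasSum.tendsto_sum_nat

end Gaussian

/-! ### Truncated series -/

section Truncated

variable {F : Type*} [NormedAddCommGroup F] [NormedSpace ℝ F]

lemma abs_truncate_le {A : ℝ} (hA : 0 ≤ A) (ξ : ℝ) : |truncate A ξ| ≤ A := by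
  unfold truncate
  split_ifs <;> rw [abs_le] <;> constructor <;> linarith

lemma measurable_truncate (A : ℝ) : Measurable (truncate A) := by
  unfold truncate
  refine Measurable.ite measurableSet_Ioi measurable_const ?_
  exact Measurable.ite measurableSet_Iio measurable_const measurable_id

/-- The series `s ∑ truncate A (zᵢ / s) fᵢ`. -/
def truncatedSeries (A s : ℝ) (f : ℕ → F) (z : ℕ → ℝ) : F :=
  s • ∑' i, truncate A (z i / s) • f i

variable {A s : ℝ} {f : ℕ → F}

lemma norm_truncate_smul_le (hA : 0 ≤ A) (z : ℕ → ℝ) (i : ℕ) :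
    ‖truncate A (z i / s) • f i‖ ≤ A * ‖f i‖ := by
  rw [norm_smul]
  gcongr
  exact abs_truncate_le hA _

lemma norm_truncatedSeries_le (hA : 0 ≤ A) (hs : 0 ≤ s) (hf : Summable fun i => ‖f i‖)
    (z : ℕ → ℝ) : ‖truncatedSeries A s f z‖ ≤ s * A * ∑' i, ‖f i‖ := by
  rw [truncatedSeries, norm_smul, Real.norm_of_nonneg hs, mul_assoc, ← tsum_mul_left]
  gcongr
  exact tsum_of_norm_bounded (hf.mul_left A).hasSum (norm_truncate_smul_le hA z)

variable [CompleteSpace F]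

lemma summable_truncate_smul (hA : 0 ≤ A) (hf : Summable fun i => ‖f i‖) (z : ℕ → ℝ) :
    Summable fun i => truncate A (z i / s) • f i :=
  Summable.of_norm_bounded (hf.mul_left A) (norm_truncate_smul_le hA z)

/-- `L^∞(D)` and operator spaces are not separable, so strong measurability is carried through
limits of finite sums rather than deduced from measurability. -/
lemma stronglyMeasurable_truncatedSeries (hA : 0 ≤ A) (hf : Summable fun i => ‖f i‖) :
    StronglyMeasurable (truncatedSeries A s f) := by
  refine StronglyMeasurable.const_smul ?_ s
  refine stronglyMeasurable_of_tendsto atTop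
    (f := fun N z => ∑ i ∈ Finset.range N, truncate A (z i / s) • f i) (fun N => ?_) ?_
  · refine Finset.stronglyMeasurable_fun_sum _ fun k _ => ?_
    have : Measurable fun z : ℕ → ℝ => truncate A (z k / s) :=
      (measurable_truncate A).comp (by fun_prop)
    exact this.stronglyMeasurable.smul_const _
  · exact tendsto_pi_nhds.2 fun z => (summable_truncate_smul hA hf z).hasSum.tendsto_sum_nat

lemma map_truncatedSeries {G : Type*} [NormedAddCommGroup G] [NormedSpace ℝ G] (L : F →L[ℝ] G)
    (hA : 0 ≤ A) (hf : Summable fun i => ‖f i‖) (z : ℕ → ℝ) :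
    L (truncatedSeries A s f z) = truncatedSeries A s (fun i => L (f i)) z := by
  rw [truncatedSeries, truncatedSeries, map_smul, L.map_tsum (summable_truncate_smul hA hf z)]
  simp_rw [map_smul]

end Truncated

lemma stronglyMeasurable_tsum_pow {R Z : Type*} [NormedRing R] [HasSummableGeomSeries R]
    [MeasurableSpace Z] {N : Z → R} (hN : StronglyMeasurable N) (hn : ∀ z, ‖N z‖ < 1) :
    StronglyMeasurable fun z => ∑' n : ℕ, N z ^ n := by
  refine stronglyMeasurable_of_tendsto atTop (f := fun m z => ∑ n ∈ Finset.range m, N z ^ n)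
    (fun m => Finset.stronglyMeasurable_fun_sum _ fun n _ => hN.pow n) ?_
  exact tendsto_pi_nhds.2 fun z => (summable_geometric_of_norm_lt_one (hn z)).hasSum.tendsto_sum_nat

lemma stronglyMeasurable_clm_apply {F Z : Type*} [NormedAddCommGroup F] [NormedSpace ℝ F]
    [MeasurableSpace Z] {L : Z → F →L[ℝ] F} {x : Z → F} (hL : StronglyMeasurable L)
    (hx : StronglyMeasurable x) : StronglyMeasurable fun z => L z (x z) :=
  (isBoundedBilinearMap_apply (𝕜 := ℝ) (E := F) (F := F)).continuous.comp_stronglyMeasurable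
    (hL.prodMk hx)

end NoiseSeries
end

noncomputable section

namespace MidpointStep

/-! ### The step as a random contraction. -/

open CuboidSobolev Maxwell NoiseSeries RandomContraction

variable {a b : Fin 3 → ℝ}

instance secondCountableTopology_EMField : SecondCountableTopology (EMField a b) := by
  have : Fact ((2 : ℝ≥0∞) ≠ ∞) := ⟨by norm_num⟩
  infer_instance

variable (a b) in
/-- The inclusion of `L^∞(D)` into `L²(D)`. -/
def inclusion : Lp ℝ ∞ (vol a b) →L[ℝ] ScalarL2 a b :=
  ((ContinuousLinearMap.lsmul ℝ ℝ : ℝ →L[ℝ] ℝ →L[ℝ] ℝ).holderL (vol a b) ∞ 2 2).flip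
    (memLp_const (1 : ℝ)).toLp

lemma inclusion_ae (w : Lp ℝ ∞ (vol a b)) : inclusion a b w =ᵐ[vol a b] w := by
  have h := (ContinuousLinearMap.lsmul ℝ ℝ : ℝ →L[ℝ] ℝ →L[ℝ] ℝ).coeFn_holder (r := 2) w
    ((memLp_const (1 : ℝ)).toLp : Lp ℝ 2 (vol a b))
  have h1 : ((memLp_const (1 : ℝ)).toLp : Lp ℝ 2 (vol a b)) =ᵐ[vol a b] fun _ => (1 : ℝ) :=
    (memLp_const (1 : ℝ)).coeFn_toLp
  filter_upwards [h, h1] with x hx hx1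
  refine hx.trans ?_
  rw [hx1]
  simp

variable {σ : R3 → ℝ} {lam₁ : ℝ} {lam₂ : R3} {Δt : ℝ≥0} {E T : EMField a b →L[ℝ] EMField a b}

/-- From the zero state the midpoint is `u' / 2`, so pairing with it leaves `‖u'‖² = ⟨u', noise⟩`.
This bounds the displacement of the origin by the additive noise alone. -/
lemma norm_le_of_isStep_zero (hE : ∀ u, E u =ᵐ[vol a b] fun x => Real.exp (-(σ x * Δt)) • u x)
    {w : Lp ℝ ∞ (vol a b)} {w₁ w₂ : ScalarL2 a b} (hw : w₁ =ᵐ[vol a b] w) {u' : EMField a b}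
    (hu : IsStep a b σ lam₁ lam₂ Δt w₁ w₂ 0 u') : ‖u'‖ ≤ ‖noiseField a b lam₂ w₂‖ := by
  obtain ⟨v, f, hv, hvf, h⟩ := (isStep_iff hE hw 0 u').1 hu
  rw [map_zero, add_zero] at hv
  rw [map_zero, sub_zero] at h
  have h0 : inner ℝ v u' = inner ℝ v (noiseField a b lam₂ w₂) := by
    conv_lhs => rw [h]
    rw [inner_add_right, inner_add_right, real_inner_smul_right, hvf.inner_eq_zero, inner_noiseOp]
    ring
  rw [hv, real_inner_smul_left, real_inner_smul_left, real_inner_self_eq_norm_sq] at h0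
  have h1 := real_inner_le_norm u' (noiseField a b lam₂ w₂)
  by_contra! hlt
  nlinarith [norm_nonneg (noiseField a b lam₂ w₂)]

lemma stronglyMeasurable_stepMap {Z : Type*} [MeasurableSpace Z] {W : Z → Lp ℝ ∞ (vol a b)}
    {g : Z → ScalarL2 a b} {x : Z → EMField a b} (hW : StronglyMeasurable W)
    (hg : StronglyMeasurable g) (hx : StronglyMeasurable x)
    (hn : ∀ z, ‖(1 / 2 : ℝ) • (T ∘L noiseOp a b lam₁ (W z))‖ < 1) :
    StronglyMeasurable fun z => stepMap lam₁ lam₂ E T (W z) (g z) (x z) := by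
  have hc : Continuous fun w => (1 / 2 : ℝ) • (T ∘L noiseOp a b lam₁ w) :=
    (continuous_const_smul (1 / 2 : ℝ)).comp (continuous_const.clm_comp (continuous_noiseOp lam₁))
  have hS := stronglyMeasurable_tsum_pow (hc.comp_stronglyMeasurable hW) hn
  have hy : Continuous fun y : EMField a b × ScalarL2 a b =>
      T (E y.1 + (1 / 2 : ℝ) • noiseField a b lam₂ y.2) := by fun_prop
  have happ := stronglyMeasurable_clm_apply hS (hy.comp_stronglyMeasurable (hx.prodMk hg))
  have hd : Continuous fun y : EMField a b × EMField a b => (2 : ℝ) • y.1 - E y.2 := by fun_prop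
  exact hd.comp_stronglyMeasurable (happ.prodMk hx)

variable (lam₁ lam₂ E T) in
/-- One step of the midpoint method as a function of the Brownian increments. -/
def randomStep (A s : ℝ) (f : ℕ → Lp ℝ ∞ (vol a b)) (q : HilbertBasis ℕ ℝ (ScalarL2 a b))
    (η : ℕ → ℝ) (z : ℕ ⊕ ℕ → ℝ) (u : EMField a b) : EMField a b :=
  stepMap lam₁ lam₂ E T (truncatedSeries A s f fun i => z (Sum.inl i))
    (gaussianSeries q η fun k => z (Sum.inr k)) u

variable {A s : ℝ} {f : ℕ → Lp ℝ ∞ (vol a b)} {q : HilbertBasis ℕ ℝ (ScalarL2 a b)} {η : ℕ → ℝ}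

section

variable (hA : 0 ≤ A) (hf : Summable fun i => ‖f i‖)
  (hn : ∀ z, ‖(1 / 2 : ℝ) • (T ∘L noiseOp a b lam₁ (truncatedSeries A s f z))‖ < 1)

include hA hf hn

lemma measurable_randomStep :
    Measurable fun p : EMField a b × (ℕ ⊕ ℕ → ℝ) => randomStep lam₁ lam₂ E T A s f q η p.2 p.1 := by
  have h1 : Measurable fun p : EMField a b × (ℕ ⊕ ℕ → ℝ) => fun i => p.2 (Sum.inl i) := by fun_prop
  have h2 : Measurable fun p : EMField a b × (ℕ ⊕ ℕ → ℝ) => fun i => p.2 (Sum.inr i) := by fun_prop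
  have h3 := stronglyMeasurable_stepMap (lam₂ := lam₂) (E := E)
    ((stronglyMeasurable_truncatedSeries hA hf).comp_measurable h1)
    ((stronglyMeasurable_gaussianSeries q η).comp_measurable h2)
    measurable_fst.stronglyMeasurable fun p => hn _
  exact h3.measurable

end

variable (hE : ∀ u, E u =ᵐ[vol a b] fun x => Real.exp (-(σ x * Δt)) • u x) (hΔt : 0 < Δt)
  (hT : ∀ g, MaxwellEq a b (T g) ((Δt / 2 : ℝ)⁻¹ • (T g - g)))
  (hn : ∀ z, ‖(1 / 2 : ℝ) • (T ∘L noiseOp a b lam₁ (truncatedSeries A s f z))‖ < 1)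

include hE hΔt hT hn in
lemma isStep_randomStep (z : ℕ ⊕ ℕ → ℝ) (u : EMField a b) :
    IsStep a b σ lam₁ lam₂ Δt (inclusion a b (truncatedSeries A s f fun i => z (Sum.inl i)))
      (gaussianSeries q η fun k => z (Sum.inr k)) u (randomStep lam₁ lam₂ E T A s f q η z u) :=
  isStep_stepMap hE hΔt hT (inclusion_ae _) (hn _) u

include hE hΔt hT hn in
lemma isContraction_randomStep (hA : 0 ≤ A) (hf : Summable fun i => ‖f i‖) {σ₀ : ℝ} (hσ₀ : 0 < σ₀)
    (hEn : ∀ u, ‖E u‖ ≤ Real.exp (-σ₀ * Δt) * ‖u‖) (hη0 : ∀ k, 0 ≤ η k) (hη : Summable η) :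
    IsContraction (Measure.infinitePi fun _ : ℕ ⊕ ℕ => gaussianReal 0 Δt)
      (randomStep lam₁ lam₂ E T A s f q η) (Real.exp (-σ₀ * Δt)) where
  measurable := measurable_randomStep hA hf hn
  nonneg := (Real.exp_pos _).le
  lt_one := by
    rw [Real.exp_lt_one_iff]
    have : (0 : ℝ) < Δt := hΔt
    nlinarith
  lipschitz z x y := by
    rw [norm_sub_eq_of_isStep hE (inclusion_ae _) (isStep_randomStep hE hΔt hT hn z x)
      (isStep_randomStep hE hΔt hT hn z y)]
    exact hEn _
  moment := by
    set ν := Measure.infinitePi fun _ : ℕ ⊕ ℕ => gaussianReal 0 Δt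
    have hX : ∀ k : ℕ, HasLaw (fun z : ℕ ⊕ ℕ → ℝ => z (Sum.inr k)) (gaussianReal 0 Δt) ν := fun k =>
      (measurePreserving_eval_infinitePi (fun _ : ℕ ⊕ ℕ => gaussianReal 0 Δt) (Sum.inr k)).hasLaw
    have h := lintegral_sq_gaussianSeries_ne_top q.orthonormal hX hη0 hη
    have hle : ∀ z, ‖randomStep lam₁ lam₂ E T A s f q η z 0‖ₑ ^ 2 ≤
        ‖noiseField a b lam₂‖ₑ ^ 2 * ‖gaussianSeries q η fun k => z (Sum.inr k)‖ₑ ^ 2 := by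
      intro z
      rw [← mul_pow]
      gcongr
      refine le_trans (enorm_le_iff_norm_le.2 (norm_le_of_isStep_zero hE (inclusion_ae _)
        (isStep_randomStep hE hΔt hT hn z 0))) ?_
      exact (noiseField a b lam₂).le_opENorm _
    refine ne_top_of_le_ne_top ?_ (lintegral_mono hle)
    rw [lintegral_const_mul' _ _ (by finiteness)]
    exact ENNReal.mul_ne_top (by finiteness) h

end MidpointStep
end

noncomputable section

namespace MidpointStep

/-! ### Summability of the noise and the choice of the step size. -/

open CuboidSobolev

variable {a b : Fin 3 → ℝ} {q : HilbertBasis ℕ ℝ (ScalarL2 a b)}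

/-! ### Summability of the noise coefficients -/

lemma exists_summable_Linfty (hab : ∀ i, a i < b i) {s : ℝ} (hs : 2 ≤ s) {g : ℕ → ScalarL2 a b}
    (hg : (∑' i, sobolevENorm a b s (g i)) ≠ ∞) :
    ∃ f : ℕ → Lp ℝ ∞ (vol a b), (∀ i, inclusion a b (f i) = g i) ∧ Summable fun i => ‖f i‖ := by
  obtain ⟨C, hC, h⟩ := exists_eLpNorm_le_sobolevENorm hab
  have hsum : (∑' i, eLpNorm (g i) ∞ (vol a b)) ≠ ∞ := by
    refine ne_top_of_le_ne_top (ENNReal.mul_ne_top hC hg) ?_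
    rw [← ENNReal.tsum_mul_left]
    exact ENNReal.tsum_le_tsum fun i => h s hs (g i)
  have hmem : ∀ i, MemLp (g i) ∞ (vol a b) := fun i =>
    ⟨Lp.aestronglyMeasurable _, (ENNReal.ne_top_of_tsum_ne_top hsum i).lt_top⟩
  refine ⟨fun i => (hmem i).toLp, fun i => Lp.ext ?_, ?_⟩
  · exact (inclusion_ae _).trans (hmem i).coeFn_toLp
  · refine (ENNReal.summable_toReal hsum).congr fun i => ?_
    rw [Lp.norm_toLp]

lemma summable_eigenvalues (hab : ∀ i, a i < b i) {η : ℕ → ℝ} {Q Qh : ScalarL2 a b →L[ℝ] ScalarL2 a b}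
    (hQ : IsCovarianceWithRoot q η Q Qh) {s : ℝ} (hs : 2 ≤ s) (hHS : IsHilbertSchmidtInto a b q s Qh) :
    Summable η := by
  obtain ⟨C, hC, h⟩ := exists_eLpNorm_le_sobolevENorm hab
  -- Self-adjointness of the root turns the eigenvalue sum into a Hilbert–Schmidt norm on `L²(D)`.
  have hη : ∀ k, η k = ‖Qh (q k)‖ ^ 2 := by
    intro k
    have hsymm : inner ℝ (Qh (q k)) (Qh (q k)) = inner ℝ (q k) (Qh (Qh (q k))) :=
      hQ.root_positive.isSelfAdjoint.isSymmetric (q k) (Qh (q k))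
    rw [← real_inner_self_eq_norm_sq, hsymm]
    rw [show Qh (Qh (q k)) = Q (q k) by rw [← hQ.root_sq]; rfl, hQ.eigen, real_inner_smul_right,
      real_inner_self_eq_norm_sq, q.orthonormal.1 k]
    simp
  set V : ℝ≥0∞ := (vol a b) Set.univ ^ (1 / 2 : ℝ) with hV
  have hVt : V ≠ ∞ := ENNReal.rpow_ne_top_of_nonneg (by norm_num) (measure_ne_top _ _)
  have hle : ∀ k, ‖Qh (q k)‖ₑ ^ 2 ≤ (C * V) ^ 2 * sobolevENorm a b s (Qh (q k)) ^ 2 := by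
    intro k
    rw [← mul_pow]
    gcongr
    calc ‖Qh (q k)‖ₑ = eLpNorm (Qh (q k)) 2 (vol a b) := Lp.enorm_def _
      _ ≤ eLpNorm (Qh (q k)) ∞ (vol a b) * V := by
          have := eLpNorm_le_eLpNorm_mul_rpow_measure_univ (p := 2) (q := ∞) le_top
            (Lp.aestronglyMeasurable (Qh (q k)))
          simpa [hV] using this
      _ ≤ (C * sobolevENorm a b s (Qh (q k))) * V := by gcongr; exact h s hs _
      _ = _ := by ring
  have hsum : (∑' k, ‖Qh (q k)‖ₑ ^ 2) ≠ ∞ := by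
    refine ne_top_of_le_ne_top (ENNReal.mul_ne_top (a := (C * V) ^ 2) (by finiteness) hHS) ?_
    rw [← ENNReal.tsum_mul_left]
    exact ENNReal.tsum_le_tsum hle
  refine (ENNReal.summable_toReal hsum).congr fun k => ?_
  rw [ENNReal.toReal_pow, toReal_enorm, hη]

/-! ### Smallness of the truncated noise -/

/-- The product `√Δt A_Δt` equals `√(2c |Δt ln Δt|)`, which tends to zero: the logarithmic
truncation level is harmless. -/
lemma exists_step_bound (c K : ℝ) : ∃ δ : ℝ≥0, 0 < δ ∧ ∀ Δt : ℝ≥0, 0 < Δt → Δt < δ →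
    K * (√(Δt : ℝ) * truncLevel c Δt) < 1 := by
  have h1 : Tendsto (fun x : ℝ => K * √(2 * c * |Real.log x * x|)) (𝓝[>] 0) (𝓝 0) := by
    have h := tendsto_log_mul_rpow_nhdsGT_zero zero_lt_one
    simp only [Real.rpow_one] at h
    have h2 : Continuous fun y : ℝ => K * √(2 * c * |y|) := by fun_prop
    have h3 : Tendsto (fun x : ℝ => K * √(2 * c * |Real.log x * x|)) (𝓝[>] 0)
      (𝓝 (K * √(2 * c * |0|))) := (h2.tendsto 0).comp h
    simpa only [abs_zero, mul_zero, Real.sqrt_zero] using h3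
  have h2 := h1.eventually_lt_const zero_lt_one
  rw [eventually_nhdsWithin_iff, Metric.eventually_nhds_iff] at h2
  obtain ⟨ε, hε, h⟩ := h2
  refine ⟨⟨ε, hε.le⟩, hε, fun Δt h0 hlt => ?_⟩
  have h0' : (0 : ℝ) < Δt := h0
  have h3 := h (y := (Δt : ℝ)) (by rw [Real.dist_eq, sub_zero, abs_of_pos h0']; exact hlt) h0'
  rwa [truncLevel, ← Real.sqrt_mul h0'.le, show (Δt : ℝ) * (2 * c * |Real.log Δt|) =
    2 * c * |Real.log Δt * Δt| by rw [abs_mul, abs_of_pos h0']; ring]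

end MidpointStep
end

/-! ### From Brownian increments to the transition semigroup. -/

noncomputable section

/-! ### Increments of a Brownian family -/

namespace StochMaxwell.IsBrownianFamily

variable {ι Ω : Type*} {mΩ : MeasurableSpace Ω} {P : Measure Ω} {ℱ : Filtration ℝ≥0 mΩ}
  {β : ι → ℝ≥0 → Ω → ℝ}

lemma measurable_increment (h : IsBrownianFamily P ℱ β) {s t : ℝ≥0} (hst : s ≤ t) :
    Measurable[ℱ t] fun ω i => β i t ω - β i s ω :=
  @measurable_pi_lambda Ω ι (fun _ => ℝ) (ℱ t) _ _ fun i =>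
    (h.adapted i t).sub ((h.adapted i s).mono (ℱ.mono hst) le_rfl)

lemma hasLaw_increment (h : IsBrownianFamily P ℱ β) (s d : ℝ≥0) :
    HasLaw (fun ω i => β i (s + d) ω - β i s ω) (Measure.infinitePi fun _ : ι => gaussianReal 0 d)
      P := by
  refine iIndepFun.hasLaw_infinitePi (fun i => ?_) ?_ ?_
  · have h1 := (h.brownian i).toIsPreBrownianReal.hasLaw_sub (s + d) s
    have h2 : nndist ((s + d : ℝ≥0) : ℝ) (s : ℝ) = d := by
      ext
      simp
    rw [show nndist (s + d).1 s.1 = d from h2] at h1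
    exact h1
  · exact h.indep.comp (fun _ g => g (s + d) - g s) fun _ => by fun_prop
  · exact ((h.measurable_increment le_self_add).mono (ℱ.le _) le_rfl).aemeasurable

end StochMaxwell.IsBrownianFamily

/-! ### Transition semigroups of random recursions -/

namespace RandomContraction

variable {Ω : Type*} {mΩ : MeasurableSpace Ω} {P : Measure Ω} [IsProbabilityMeasure P]
  {ℱ : Filtration ℝ≥0 mΩ} {a b : Fin 3 → ℝ} {σ : R3 → ℝ} {lam₁ : ℝ} {lam₂ : R3} {Δt : ℝ≥0}
  {dW₁ dW₂ : ℕ → Ω → ScalarL2 a b} {Z : Type*} [MeasurableSpace Z] {ν : Measure Z}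
  [IsProbabilityMeasure ν] {Φ : Z → EMField a b → EMField a b} {z : ℕ → Ω → Z}

/-- Existence is by recursion through `Φ`. For the law, `u n` is measurable with respect to the past
and `z n` is independent of it, so their joint law is a product and the step is one application of
the kernel. -/
lemma isTransitionSemigroup (hΦ : Measurable fun p : EMField a b × Z => Φ p.2 p.1)
    (hz : ∀ n : ℕ, Measurable[ℱ ((n + 1 : ℕ) * Δt)] (z n)) (hlaw : ∀ n, P.map (z n) = ν)
    (hind : ∀ n : ℕ, Indep (MeasurableSpace.comap (z n) inferInstance) (ℱ (n * Δt)) P)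
    (hstep : ∀ᵐ ω ∂P, ∀ n x x', IsStep a b σ lam₁ lam₂ Δt (dW₁ n ω) (dW₂ n ω) x x' ↔
      x' = Φ (z n ω) x) :
    IsTransitionSemigroup P ℱ a b σ lam₁ lam₂ Δt dW₁ dW₂ fun n => kernel ν Φ ^ n where
  markov := isMarkovKernel_pow hΦ
  zero := rfl
  add m n := by rw [add_comm, pow_add]; rfl
  exists_solution u₀ hu₀ := by
    refine ⟨fun n => Nat.rec u₀ (fun n v ω => Φ (z n ω) (v ω)) n, ⟨fun n => ?_, ?_⟩, rfl⟩
    · induction n with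
      | zero =>
        rw [show ((0 : ℕ) : ℝ≥0) * Δt = 0 by simp]
        exact hu₀
      | succ n ih =>
        have h1 := ih.mono (ℱ.mono (show (n * Δt : ℝ≥0) ≤ (n + 1 : ℕ) * Δt by gcongr; simp)) le_rfl
        exact hΦ.comp (h1.prodMk (hz n))
    · filter_upwards [hstep] with ω hω n
      exact (hω n _ _).2 rfl
  law u hu n := by
    have hm : ∀ n, Measurable (u n) := fun n => (hu.adapted n).mono (ℱ.le _) le_rfl
    have hzm : ∀ n, Measurable (z n) := fun n => (hz n).mono (ℱ.le _) le_rfl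
    induction n with
    | zero =>
      have : (Kernel.id : Kernel (EMField a b) (EMField a b)) ∘ₘ P.map (u 0) = P.map (u 0) :=
        Measure.id_comp
      exact this.symm
    | succ n ih =>
      have := Measure.isProbabilityMeasure_map (μ := P) (hm n).aemeasurable
      have h1 : P.map (u (n + 1)) = P.map fun ω => Φ (z n ω) (u n ω) := by
        refine Measure.map_congr ?_
        filter_upwards [hstep, hu.step] with ω h2 h3
        exact (h2 n _ _).1 (h3 n)
      have hi : IndepFun (u n) (z n) P := by
        refine IndepFun.symm ?_
        exact indep_of_indep_of_le_right (hind n) (hu.adapted n).comap_le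
      have h2 : P.map (fun ω => Φ (z n ω) (u n ω)) =
          (P.map fun ω => (u n ω, z n ω)).map fun p => Φ p.2 p.1 := by
        rw [Measure.map_map hΦ ((hm n).prodMk (hzm n))]
        rfl
      have h3 : (kernel ν Φ ^ (n + 1) : Kernel _ _) ∘ₘ P.map (u 0) =
          kernel ν Φ ∘ₘ ((kernel ν Φ ^ n : Kernel _ _) ∘ₘ P.map (u 0)) := by
        rw [pow_succ', Measure.comp_assoc]
        rfl
      rw [h1, h2, (indepFun_iff_map_prod_eq_prod_map_map (hm n).aemeasurable
        (hzm n).aemeasurable).1 hi, hlaw, ← kernel_comp hΦ, ih, h3]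

end RandomContraction
end

noncomputable section

namespace MidpointStep

/-! ### Identification of the scheme's increments and conclusion. -/

open NoiseSeries

variable {a b : Fin 3 → ℝ} {q : HilbertBasis ℕ ℝ (ScalarL2 a b)}
  {Ω : Type*} {mΩ : MeasurableSpace Ω} {P : Measure Ω}

lemma truncatedIncrement_eq {f : ℕ → Lp ℝ ∞ (vol a b)} (hf : Summable fun i => ‖f i‖)
    {Qh : ScalarL2 a b →L[ℝ] ScalarL2 a b} (hfQ : ∀ i, inclusion a b (f i) = Qh (q i))
    (β : ℕ → ℝ≥0 → Ω → ℝ) (c : ℝ) (Δt : ℝ≥0) (n : ℕ) (ω : Ω) :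
    truncatedIncrement q Qh β c Δt n ω = inclusion a b (truncatedSeries (truncLevel c Δt)
      √(Δt : ℝ) f fun i => β i ((n + 1 : ℕ) * Δt) ω - β i (n * Δt) ω) := by
  rw [map_truncatedSeries (A := truncLevel c Δt) _ (Real.sqrt_nonneg _) hf]
  simp_rw [hfQ]
  rfl

/-- The Wiener series converges almost surely at each of the countably many grid times, so the two
sums may be subtracted termwise. -/
lemma wienerIncrement_eq {η : ℕ → ℝ} (hη0 : ∀ k, 0 ≤ η k) (hη : Summable η)
    {β : ℕ → ℝ≥0 → Ω → ℝ} (hβ : ∀ k, IsBrownianReal (β k) P) (Δt : ℝ≥0) :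
    ∀ᵐ ω ∂P, ∀ n : ℕ, wienerIncrement q η β Δt n ω =
      gaussianSeries q η fun k => β k ((n + 1 : ℕ) * Δt) ω - β k (n * Δt) ω := by
  refine ae_all_iff.2 fun n => ?_
  have h := fun t : ℝ≥0 => ae_summable_smul (P := P) q.orthonormal
    (fun k => (hβ k).toIsPreBrownianReal.hasLaw_eval t) hη0 hη
  filter_upwards [h ((n + 1 : ℕ) * Δt), h (n * Δt)] with ω h1 h2
  have h3 : (fun k => (√(η k) * (β k ((n + 1 : ℕ) * Δt) ω - β k (n * Δt) ω)) • q k) =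
      fun k => (√(η k) * β k ((n + 1 : ℕ) * Δt) ω) • q k - (√(η k) * β k (n * Δt) ω) • q k := by
    funext k
    rw [mul_sub, sub_smul]
  rw [gaussianSeries_eq_tsum (h3 ▸ h1.sub h2), h3, h1.tsum_sub h2]
  rfl

lemma norm_half_smul_comp_noiseOp_lt {K A s : ℝ} {lam₁ : ℝ} (hK : 0 ≤ K)
    (hB : ∀ w : Lp ℝ ∞ (vol a b), ‖noiseOp a b lam₁ w‖ ≤ K * ‖w‖) (hA : 0 ≤ A) (hs : 0 ≤ s)
    {f : ℕ → Lp ℝ ∞ (vol a b)} (hf : Summable fun i => ‖f i‖)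
    (hlt : (K * ∑' i, ‖f i‖) * (s * A) < 1) {T : EMField a b →L[ℝ] EMField a b} (hT : ‖T‖ ≤ 1)
    (z : ℕ → ℝ) : ‖(1 / 2 : ℝ) • (T ∘L noiseOp a b lam₁ (truncatedSeries A s f z))‖ < 1 := by
  have h1 : ‖T ∘L noiseOp a b lam₁ (truncatedSeries A s f z)‖ ≤ 1 * (K * (s * A * ∑' i, ‖f i‖)) := by
    refine (ContinuousLinearMap.opNorm_comp_le _ _).trans ?_
    gcongr
    refine (hB _).trans ?_
    gcongr
    exact norm_truncatedSeries_le hA hs hf z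
  rw [norm_smul, Real.norm_of_nonneg (by norm_num)]
  nlinarith [norm_nonneg (T ∘L noiseOp a b lam₁ (truncatedSeries A s f z))]

end MidpointStep
end

theorem mainTheorem4
    -- the cuboid and the damping coefficient
    (a b : Fin 3 → ℝ) (hab : ∀ i, a i < b i)
    (σ : R3 → ℝ) (hσ : MemW1Infty a b σ)
    (σ₀ : ℝ) (hσ₀ : 0 < σ₀) (hσσ₀ : ∀ᵐ x ∂(vol a b), σ₀ ≤ σ x)
    -- noise intensities
    (lam₁ : ℝ) (lam₂ : R3)
    -- covariance operators and their square roots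
    (q : HilbertBasis ℕ ℝ (ScalarL2 a b)) (η₁ η₂ : ℕ → ℝ)
    (Q₁ Q₁h Q₂ Q₂h : ScalarL2 a b →L[ℝ] ScalarL2 a b)
    (hQ₁ : IsCovarianceWithRoot q η₁ Q₁ Q₁h) (hQ₂ : IsCovarianceWithRoot q η₂ Q₂ Q₂h)
    (γ γ₂ : ℝ) (hγ : 3 / 2 < γ) (hγ₂ : 2 ≤ γ₂)
    (hQ₁HS : IsHilbertSchmidtInto a b q (2 + γ) Q₁h)
    (hQ₂HS : IsHilbertSchmidtInto a b q γ₂ Q₂h)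
    (hQ₁sum : (∑' i, sobolevENorm a b (1 + γ) (Q₁h (q i))) ≠ ∞)
    -- the filtered probability space and the Brownian motions driving the two Wiener processes
    {Ω : Type*} {mΩ : MeasurableSpace Ω} (P : Measure Ω) [IsProbabilityMeasure P]
    (ℱ : Filtration ℝ≥0 mΩ) (β₁ β₂ : ℕ → ℝ≥0 → Ω → ℝ)
    (hβ : IsBrownianFamily P ℱ (Sum.elim β₁ β₂))
    -- the truncation parameter
    (c : ℝ) (hc : 4 ≤ c) :
    ∃ δ : ℝ≥0, 0 < δ ∧ ∀ Δt : ℝ≥0, 0 < Δt → Δt < δ →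
      ∃ S : ℕ → Kernel (EMField a b) (EMField a b),
        IsTransitionSemigroup P ℱ a b σ lam₁ lam₂ Δt
          (truncatedIncrement q Q₁h β₁ c Δt) (wienerIncrement q η₂ β₂ Δt) S ∧
        ∃ π : Measure (EMField a b),
          MemP2 π ∧ IsInvariantMeasure S π ∧ (∀ π', IsInvariantMeasure S π' → π' = π) ∧
          IsErgodic S π ∧
          IsExponentiallyMixing S Δt π ∧
          ∀ μ : Measure (EMField a b), MemP2 μ → ∀ n : ℕ,
            wasserstein2 (S n ∘ₘ μ) π ≤
              ENNReal.ofReal (Real.exp (-σ₀ * (n * Δt))) * wasserstein2 μ π := by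
  -- Since `γ > 3/2`, the order `1 + γ` exceeds two and the embedding applies.
  obtain ⟨f, hfQ, hf⟩ := MidpointStep.exists_summable_Linfty hab (by linarith) hQ₁sum
  have hη := MidpointStep.summable_eigenvalues hab hQ₂ hγ₂ hQ₂HS
  obtain ⟨K, hK, hB⟩ := MidpointStep.exists_norm_noiseOp_le (a := a) (b := b) lam₁
  obtain ⟨δ, hδ, hsmall⟩ := MidpointStep.exists_step_bound c (K * ∑' i, ‖f i‖)
  refine ⟨δ, hδ, fun Δt hΔt hlt => ?_⟩
  obtain ⟨E, hE, hEn⟩ := MidpointStep.exists_damping hσ hσσ₀ Δt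
  have hΔt' : (0 : ℝ) < Δt := hΔt
  obtain ⟨T, hT1, hT⟩ := Maxwell.exists_maxwell_resolvent a b (half_pos hΔt')
  have hA : 0 ≤ truncLevel c Δt := Real.sqrt_nonneg _
  have hn := MidpointStep.norm_half_smul_comp_noiseOp_lt hK hB hA
    (Real.sqrt_nonneg _) hf (hsmall Δt hΔt hlt) hT1
  set ν := Measure.infinitePi fun _ : ℕ ⊕ ℕ => gaussianReal 0 Δt with hν
  set Φ := MidpointStep.randomStep lam₁ lam₂ E T (truncLevel c Δt) √(Δt : ℝ) f q η₂ with hΦ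
  have hC : RandomContraction.IsContraction ν Φ (Real.exp (-σ₀ * Δt)) :=
    MidpointStep.isContraction_randomStep hE hΔt hT hn hA hf hσ₀ hEn
      hQ₂.eigenvalue_nonneg hη
  have hnt : ∀ n : ℕ, (n + 1 : ℕ) * Δt = n * Δt + Δt := fun n => by push_cast; ring
  have hS : IsTransitionSemigroup P ℱ a b σ lam₁ lam₂ Δt (truncatedIncrement q Q₁h β₁ c Δt)
      (wienerIncrement q η₂ β₂ Δt) fun n => RandomContraction.kernel ν Φ ^ n := by
    refine RandomContraction.isTransitionSemigroup (z := fun n ω i =>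
      Sum.elim β₁ β₂ i ((n + 1 : ℕ) * Δt) ω - Sum.elim β₁ β₂ i (n * Δt) ω) hC.measurable
      (fun n => ?_) (fun n => ?_) (fun n => ?_) ?_
    · exact hβ.measurable_increment (by rw [hnt]; exact le_self_add)
    · have h := (hβ.hasLaw_increment (n * Δt) Δt).map_eq
      rw [← hnt] at h
      exact h
    · exact hβ.indep_past _ _ (by rw [hnt]; exact le_self_add)
    · filter_upwards [MidpointStep.wienerIncrement_eq (q := q) hQ₂.eigenvalue_nonneg hη
        (fun k => hβ.brownian (Sum.inr k)) Δt] with ω hω n x x'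
      have h1 := MidpointStep.isStep_randomStep (σ := σ) (lam₂ := lam₂) (q := q) (η := η₂) hE hΔt hT
        hn (fun i => Sum.elim β₁ β₂ i ((n + 1 : ℕ) * Δt) ω - Sum.elim β₁ β₂ i (n * Δt) ω) x
      have h2 := MidpointStep.truncatedIncrement_eq hf hfQ β₁ c Δt n ω
      have h3 := hω n
      simp only [Sum.elim_inl, Sum.elim_inr] at h1 h3
      rw [← h2] at h1
      rw [← h3] at h1
      refine ⟨fun h => ?_, fun h => h ▸ h1⟩
      -- Two steps from the same state differ in norm by `‖E 0‖ = 0`, so the relation `IsStep` is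
      -- the graph of `Φ`.
      have h4 := MidpointStep.norm_sub_eq_of_isStep hE (h2 ▸ MidpointStep.inclusion_ae _) h h1
      rw [sub_self, map_zero, norm_zero, norm_eq_zero, sub_eq_zero] at h4
      exact h4
  refine ⟨_, hS, RandomContraction.stationary ν Φ, hC.memP2_stationary,
    hC.isInvariantMeasure_stationary, fun π' h => hC.eq_stationary_of_isInvariantMeasure h,
    hC.isErgodic, hC.isExponentiallyMixing hσ₀ rfl, fun μ hμ n => ?_⟩
  have := hμ.1
  have hr : Real.exp (-σ₀ * (n * Δt)) = Real.exp (-σ₀ * Δt) ^ n := by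
    rw [← Real.exp_nat_mul]
    ring_nf
  rw [hr]
  exact hC.wasserstein2_pow_le (Real.exp_pos _) μ n
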